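/- Let $Q_8=\langle I,J\rangle\subset SL(2,\mathbb C)$, where $I=\begin{pmatrix}\sqrt{-1}&0\\0&-\sqrt{-1}\end{pmatrix}$ and $J=\begin{pmatrix}0&\sqrt{-1}\\\sqrt{-1}&0\end{pmatrix}$, and put $K=IJ$. Identify $V=\mathbb C^4$, with coordinates $x,y,z,u$ and standard basis $e_1,\dots,e_4$, with the space of complex $2\times2$ matrices through the basis $E,I,J,K$. Let $N\subset SL(V)$ be the subgroup generated by the maps $A\mapsto aAb^{-1}$ ($a,b\in Q_8$) and the scalar $\sqrt{-1}$, let $M$ be its normalizer in $SL(V)$, and let $\mathbb P^3=\mathbb P(V)$. Let $H=\{x\in\mathbb C^6:\sum x_i=0\}$. The Segre cubic $\mathcal S_3\subset\mathbb P(H)=\mathbb P^4$ is given by $\sum_{i=1}^6 x_i^3=0$. The Igusa quartic $\mathcal I_4\subset\mathbb P^{4*}$ is its dual variety, i.e. the closure of the set of tangent hyperplanes at smooth points of $\mathcal S_3$, with the reduced structure. Here $\mathbb P^{4*}$ is identified with $\mathbb P(H)$: a point $[y]$ stands for the hyperplane $\sum y_iv_i=0$. The group $\mathfrak S_6$ acts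 on $\mathcal I_4$ by permuting coordinates. Theorem. The group $N$ has order $64$, and the following hold. (1) The ring of invariants $\mathbb C[x,y,z,u]^N$ is generated by $$f_1=x^2u^2+y^2z^2,\quad f_2=x^2z^2+y^2u^2,\quad f_3=x^2y^2+z^2u^2,\quad f_4=x^4+y^4+z^4+u^4,\quad f_5=xyzu,$$ and the ideal of relations between $f_1,\dots,f_5$ is generated by the quartic relation $$(f_4+2f_1+2f_2+2f_3)\bigl(f_1f_2f_3-f_4f_5^2+2f_5^2(f_1+f_2+f_3)\bigr)-(f_1f_2+f_2f_3+f_3f_1+4f_5^2)^2=0.$$ (2) The quotient $\mathbb P^3/N$ is isomorphic to the Igusa quartic: there is a morphism $q\colon\mathbb P^3\to\mathcal I_4$ over $\mathbb C$ which is the quotient of $\mathbb P^3$ by $N$ (it is $N$-invariant, $\mathcal I_4$ carries the quotient topology, the fibres of $q$ are the $N$-orbits, and $\mathcal O_{\mathcal I_4}=(q_*\mathcal O_{\mathbb P^3})^N$). Moreover, for some linear isomorphism $T\colon\mathbb C^5\to H$, $q$ is given on closed points by $[v]\mapsto[T(f_1(v),\dots,f_5(v))]$. (3) The morphism $q$ can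 be chosen equivariant in the following sense. The group $M$ permutes the lines $W_1,\dots,W_6$ in $\wedge^2V$ spanned by $e_1\wedge e_2\pm e_3\wedge e_4$, $e_1\wedge e_3\pm e_2\wedge e_4$, $e_1\wedge e_4\pm e_2\wedge e_3$. This gives a surjective homomorphism $\pi\colon M\to\mathfrak S_6$ with kernel $N$. There is an outer (i.e. not inner) automorphism $\lambda$ of $\mathfrak S_6$ such that $q(g\cdot p)=\lambda(\pi(g))\cdot q(p)$ for all $g\in M$, as morphisms. -/

import Mathlib

open AlgebraicGeometry CategoryTheory MvPolynomial

attribute [local instance] MvPolynomial.gradedAlgebra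

noncomputable section

namespace IgusaQuotient

/-! ### Projective spaces over `ℂ` and their linear automorphisms -/

/-- The standard grading of `ℂ[X_0, …, X_{n-1}]`. -/
abbrev grading (n : ℕ) : ℕ → Submodule ℂ (MvPolynomial (Fin n) ℂ) :=
  homogeneousSubmodule (Fin n) ℂ

/-- The projective space `ℙ(ℂⁿ)` of lines in `ℂⁿ`, of dimension `n - 1`, as a scheme. -/
abbrev PP (n : ℕ) : Scheme.{0} := Proj (grading n)

/-- The structure morphism `ℙ(ℂⁿ) ⟶ Spec ℂ`. -/
def structureMap (n : ℕ) : PP n ⟶ Spec (CommRingCat.of ℂ) :=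
  Proj.toSpecZero (grading n) ≫ Spec.map (CommRingCat.ofHom (algebraMap ℂ (grading n 0)))

/-- `x` is the closed point `[v]` of `ℙ(ℂⁿ)` (for `v = 0` there is no such `x`): a form lies in the
homogeneous prime `x` exactly when it vanishes at `v`. -/
def IsPointOf {n : ℕ} (v : Fin n → ℂ) (x : PP n) : Prop :=
  ∀ (d : ℕ) (G : MvPolynomial (Fin n) ℂ), G ∈ grading n d →
    (G ∈ (show ProjectiveSpectrum (grading n) from x).asHomogeneousIdeal ↔ eval v G = 0)

/-- The substitution `G ↦ G ∘ e` for a linear automorphism `e` of `ℂⁿ`. -/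
def linSubst {n : ℕ} (e : (Fin n → ℂ) ≃ₗ[ℂ] (Fin n → ℂ)) :
    MvPolynomial (Fin n) ℂ →ₐ[ℂ] MvPolynomial (Fin n) ℂ :=
  aeval fun i => ∑ j, C (e (Pi.single j 1) i) * X j

theorem linSubst_mem {n : ℕ} (e : (Fin n → ℂ) ≃ₗ[ℂ] (Fin n → ℂ)) {d : ℕ}
    {G : MvPolynomial (Fin n) ℂ} (hG : G ∈ grading n d) : linSubst e G ∈ grading n d := by
  have hG' : G.IsHomogeneous d := hG
  have := hG'.aeval (fun i => ∑ j, C (e (Pi.single j 1) i) * X j) (n := 1)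
    (fun i => IsHomogeneous.sum _ _ _ fun j _ => isHomogeneous_C_mul_X _ _)
  simpa [linSubst] using this

theorem eval_linSubst {n : ℕ} (e : (Fin n → ℂ) ≃ₗ[ℂ] (Fin n → ℂ)) (v : Fin n → ℂ)
    (G : MvPolynomial (Fin n) ℂ) : eval v (linSubst e G) = eval (e v) G := by
  have h : (fun i => eval v (∑ j, C (e (Pi.single j 1) i) * X j)) = e v := by
    funext i
    have hv : v = ∑ j, v j • (Pi.single j 1 : Fin n → ℂ) := by
      funext k
      simp [Finset.sum_apply, Pi.single_apply]
    conv_rhs => rw [hv]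
    simp [map_sum, mul_comm]
  rw [linSubst, ← h, ← coe_aeval_eq_eval, ← coe_aeval_eq_eval]
  simp only [RingHom.coe_coe]
  rw [← AlgHom.comp_apply, comp_aeval]

theorem linSubst_linSubst_symm {n : ℕ} (e : (Fin n → ℂ) ≃ₗ[ℂ] (Fin n → ℂ))
    (G : MvPolynomial (Fin n) ℂ) : linSubst e (linSubst e.symm G) = G := by
  apply MvPolynomial.funext
  intro v
  simp [eval_linSubst]

/-- `linSubst e` as a homomorphism of graded rings. -/
def gradedSubst {n : ℕ} (e : (Fin n → ℂ) ≃ₗ[ℂ] (Fin n → ℂ)) :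
    GradedRingHom (grading n) (grading n) where
  toRingHom := (linSubst e).toRingHom
  map_mem := fun hx => linSubst_mem e hx

theorem gradedSubst_irrelevant {n : ℕ} (e : (Fin n → ℂ) ≃ₗ[ℂ] (Fin n → ℂ)) :
    HomogeneousIdeal.irrelevant (grading n) ≤
      (HomogeneousIdeal.irrelevant (grading n)).map (gradedSubst e) := by
  refine (HomogeneousIdeal.toIdeal_irrelevant_le (grading n)).mpr ?_
  intro i hi x hx
  have h : gradedSubst e (linSubst e.symm x) = x := linSubst_linSubst_symm e x
  rw [← h]
  exact Ideal.mem_map_of_mem _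
    (HomogeneousIdeal.mem_irrelevant_of_mem (grading n) hi (linSubst_mem e.symm hx))

/-- The automorphism `[v] ↦ [e v]` of `ℙ(ℂⁿ)` defined by a linear automorphism `e` of `ℂⁿ`. -/
def projAut {n : ℕ} (e : (Fin n → ℂ) ≃ₗ[ℂ] (Fin n → ℂ)) : PP n ⟶ PP n :=
  Proj.map (gradedSubst e) (gradedSubst_irrelevant e)

/-! ### Quotients -/

/-- `q : X ⟶ Y` is the quotient of the scheme `X` by a group acting through the endomorphisms
`act g`: `q` is invariant, `Y` is the topological quotient of `X` by the action, with fibres of `q`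
the orbits, and the sections of `𝒪_Y` over `U` are the invariant sections of `𝒪_X` over `q⁻¹ U`. -/
structure IsQuotient {G : Type} {X Y : Scheme.{0}} (act : G → (X ⟶ X)) (q : X ⟶ Y) : Prop where
  invariant : ∀ g, act g ≫ q = q
  quotientMap : Topology.IsQuotientMap q
  orbits : ∀ x x' : X, q x = q x' ↔ ∃ g, act g x = x'
  app_injective : ∀ U : Y.Opens, Function.Injective (q.app U)
  app_range : ∀ (U : Y.Opens) (s : Γ(X, q ⁻¹ᵁ U)), s ∈ Set.range (q.app U) ↔
    ∀ (g : G) (h : q ⁻¹ᵁ U ≤ act g ⁻¹ᵁ (q ⁻¹ᵁ U)), (act g).appLE (q ⁻¹ᵁ U) (q ⁻¹ᵁ U) h s = s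

/-! ### The group `N` of order 64 and its normalizer -/

/-- The matrix `I`. -/
def matI : Matrix.SpecialLinearGroup (Fin 2) ℂ :=
  ⟨!![Complex.I, 0; 0, -Complex.I], by simp⟩

/-- The matrix `J`. -/
def matJ : Matrix.SpecialLinearGroup (Fin 2) ℂ :=
  ⟨!![0, Complex.I; Complex.I, 0], by simp⟩

/-- The quaternion group `Q₈ ⊂ SL(2, ℂ)`. -/
def Q8 : Subgroup (Matrix.SpecialLinearGroup (Fin 2) ℂ) := Subgroup.closure {matI, matJ}

/-- The identification of `ℂ⁴` with the space of `2 × 2` matrices through the basis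
`E, I, J, K = I J`. -/
def toMat (v : Fin 4 → ℂ) : Matrix (Fin 2) (Fin 2) ℂ :=
  v 0 • (1 : Matrix (Fin 2) (Fin 2) ℂ) + v 1 • matI.1 + v 2 • matJ.1 + v 3 • (matI * matJ).1

/-- The group `N ⊂ SL(4, ℂ)` generated by the maps `A ↦ a A b⁻¹` with `a, b ∈ Q₈` on the space
of `2 × 2` matrices, and by the scalar `√-1`. -/
def N : Subgroup (Matrix.SpecialLinearGroup (Fin 4) ℂ) :=
  Subgroup.closure
    ({g | ∃ a ∈ Q8, ∃ b ∈ Q8, ∀ v, toMat (g.1.mulVec v) = a.1 * toMat v * (b⁻¹).1} ∪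
     {g | g.1 = Complex.I • (1 : Matrix (Fin 4) (Fin 4) ℂ)})

/-- The normalizer `M` of `N` in `SL(4, ℂ)`. -/
def M : Subgroup (Matrix.SpecialLinearGroup (Fin 4) ℂ) := Subgroup.normalizer N

/-- The action of `SL(4, ℂ)` on `ℂ⁴`. -/
abbrev lin (g : Matrix.SpecialLinearGroup (Fin 4) ℂ) : (Fin 4 → ℂ) ≃ₗ[ℂ] (Fin 4 → ℂ) :=
  Matrix.SpecialLinearGroup.toLin' g

/-- `e_{i+1} ∧ e_{j+1}` in the exterior square of `ℂ⁴`. -/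
def wedge (i j : Fin 4) : ⋀[ℂ]^2 (Fin 4 → ℂ) :=
  exteriorPower.ιMulti ℂ 2 ![Pi.single i 1, Pi.single j 1]

/-- The six vectors `w₁₂⁺, w₁₂⁻, w₁₃⁺, w₁₃⁻, w₁₄⁺, w₁₄⁻`. -/
def w : Fin 6 → ⋀[ℂ]^2 (Fin 4 → ℂ) :=
  ![wedge 0 1 + wedge 2 3, wedge 0 1 - wedge 2 3,
    wedge 0 2 + wedge 1 3, wedge 0 2 - wedge 1 3,
    wedge 0 3 + wedge 1 2, wedge 0 3 - wedge 1 2]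

/-- The lines `W_i` in the exterior square. -/
def W (i : Fin 6) : Submodule ℂ (⋀[ℂ]^2 (Fin 4 → ℂ)) := Submodule.span ℂ {w i}

/-! ### The invariants and their relation -/

/-- The quartic forms `f₁, …, f₅`, in the variables `x, y, z, u = X 0, X 1, X 2, X 3`. -/
def f : Fin 5 → MvPolynomial (Fin 4) ℂ :=
  ![X 0 ^ 2 * X 3 ^ 2 + X 1 ^ 2 * X 2 ^ 2,
    X 0 ^ 2 * X 2 ^ 2 + X 1 ^ 2 * X 3 ^ 2,
    X 0 ^ 2 * X 1 ^ 2 + X 2 ^ 2 * X 3 ^ 2,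
    X 0 ^ 4 + X 1 ^ 4 + X 2 ^ 4 + X 3 ^ 4,
    X 0 * X 1 * X 2 * X 3]

/-- The quartic relation between `f₁, …, f₅ = X 0, …, X 4`. -/
def relation : MvPolynomial (Fin 5) ℂ :=
  (X 3 + 2 * X 0 + 2 * X 1 + 2 * X 2) *
      (X 0 * X 1 * X 2 - X 3 * X 4 ^ 2 + 2 * X 4 ^ 2 * (X 0 + X 1 + X 2)) -
    (X 0 * X 1 + X 1 * X 2 + X 2 * X 0 + 4 * X 4 ^ 2) ^ 2

/-! ### The Segre cubic and its dual -/

/-- The hyperplane `H = {x₁ + ⋯ + x₆ = 0}` of `ℂ⁶`; the Segre cubic lies in `ℙ⁴ = ℙ(H)`. -/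
def H : Submodule ℂ (Fin 6 → ℂ) where
  carrier := {x | ∑ i, x i = 0}
  add_mem' := fun {a b} ha hb => by
    simp only [Set.mem_ofPred_eq] at *
    simp [Finset.sum_add_distrib, ha, hb]
  zero_mem' := by simp
  smul_mem' := fun c x hx => by
    simp only [Set.mem_ofPred_eq] at *
    simp [← Finset.mul_sum, hx]

/-- The cubic form `x₁³ + ⋯ + x₆³`, whose zero locus in `ℙ(H)` is the Segre cubic. -/
def segreForm : MvPolynomial (Fin 6) ℂ := ∑ i, X i ^ 3

/-- The differential of `segreForm` at `x`, in the direction `v`. -/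
def segreDiff (x v : Fin 6 → ℂ) : ℂ := ∑ i, eval x (pderiv i segreForm) * v i

/-- `[x]` is a smooth point of the Segre cubic in `ℙ(H)`. -/
def IsSmoothSegrePoint (x : Fin 6 → ℂ) : Prop :=
  x ≠ 0 ∧ x ∈ H ∧ eval x segreForm = 0 ∧ ∃ v ∈ H, segreDiff x v ≠ 0

/-- Hyperplanes of `H` are written as `{v ∈ H | ∑ yᵢ vᵢ = 0}` with `0 ≠ y ∈ H`, where `y` is unique
up to a scalar; this identifies the dual projective space `ℙ⁴*` with `ℙ(H) ⊂ ℙ(ℂ⁶)`, compatibly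
with the permutations of the coordinates. The predicate says that `[y]` is the tangent hyperplane
of the Segre cubic at the smooth point `[x]`. -/
def IsTangentHyperplane (x y : Fin 6 → ℂ) : Prop :=
  y ≠ 0 ∧ y ∈ H ∧ ∀ v ∈ H, ∑ i, y i * v i = 0 ↔ segreDiff x v = 0

/-- The Igusa quartic as a closed subset of `ℙ(ℂ⁶)`: the dual variety of the Segre cubic, that is,
the closure of the set of tangent hyperplanes at smooth points. -/
def igusaSet : TopologicalSpace.Closeds (PP 6) :=
  TopologicalSpace.Closeds.closure
    {p | ∃ x y, IsSmoothSegrePoint x ∧ IsTangentHyperplane x y ∧ IsPointOf y p}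

/-- The Igusa quartic `𝓘₄`, with its reduced scheme structure. -/
def igusaQuartic : Scheme.{0} := (Scheme.IdealSheafData.vanishingIdeal igusaSet).subscheme

/-- The embedding of the Igusa quartic in `ℙ⁴* = ℙ(H) ⊂ ℙ(ℂ⁶)`. -/
def igusaι : igusaQuartic ⟶ PP 6 := (Scheme.IdealSheafData.vanishingIdeal igusaSet).subschemeι

/-- The standard action of the symmetric group on `ℂ⁶`, permuting the basis vectors. -/
def permLin (σ : Equiv.Perm (Fin 6)) : (Fin 6 → ℂ) ≃ₗ[ℂ] (Fin 6 → ℂ) :=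
  LinearEquiv.funCongrLeft ℂ ℂ σ.symm

end IgusaQuotient

end

/-! Everything in (2) rests on two facts about `igusaHom : ℂ[X₀, …, X₅] → ℂ[x, y, z, u]`: its image
is the ring of `N`-invariants, and the zero locus of its kernel is the dual of the Segre cubic.

The group. `N` is a Heisenberg group: the sign changes `d₁, d₂`, the double transpositions `t₁, t₂`
and the scalar `√-1` generate it, and it consists of all elements of `SL(4, ℂ)` commuting up to sign
with those four. The signs give `2 ^ 4` classes, each a coset of the four scalars.

The invariants. Polynomials are spanned by products of a square-free monomial and a monomial in four
quadratic forms `sq i`. Averaging over `N` kills every such product on which a generator acts by a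
scalar other than `1`; the survivors are products of `f₅`, the `(sq i)²` and `∏ sq i`, all of them
in `ℂ[f₁, …, f₅]`. The quartic relation has unit leading coefficient in `f₅`, so a relation can be
divided by it. The remainder has degree at most three in `f₅`, while over general values of `f₁, …,
f₄` the form `f₅` takes four distinct values `± y, ± y'`; hence the remainder is zero
(`remainder_eq_zero`).

The quotient. A homomorphism that multiplies degrees and is integral induces a morphism of `Proj`.
Homogeneous going up makes it closed, with image the zero locus of the kernel; primes with the same
contraction to the invariants are conjugate, which gives the orbits; invariant fractions have
invariant numerators, which gives the sections. As the source is reduced, the scheme-theoretic image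
has the reduced structure (`exists_isQuotient`).

The dual. The Gauss map of the Segre cubic is `x ↦ x²` modulo constants. By Newton's identities its
image lies on `p₂² = 4 p₄`, with `p_k` the power sums, and the projected gradient of that quartic
inverts it generically. The linear change of coordinates `coordVec` turns this quartic into the
relation.

The normalizer. `N` acts on `∧²V` through six distinct characters, so `M` permutes the six lines. An
element fixing all of them commutes with `N` up to an element trivial on `∧²V`, that is up to sign,
and so lies in `N`. For suitable `n ∈ N` with `n² = -1`, the elements `(1 + n) / √2` realise the
adjacent transpositions of the lines, but permute the coordinates of the quartic by products of
three disjoint transpositions. This gives an automorphism of `𝔖₆` that cannot be inner. -/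

/-! ### Morphisms of projective spectra given by homomorphisms multiplying degrees -/

section DegreeMul

set_option linter.unusedSectionVars false

universe u

open HomogeneousLocalization

variable {A B C σ τ ρ : Type u} [CommRing A] [SetLike σ A] [AddSubgroupClass σ A]
  [CommRing B] [SetLike τ B] [AddSubgroupClass τ B] [CommRing C] [SetLike ρ C]
  [AddSubgroupClass ρ C] {𝒜 : ℕ → σ} {ℬ : ℕ → τ} {𝒞 : ℕ → ρ}
  [GradedRing 𝒜] [GradedRing ℬ] [GradedRing 𝒞] {e : ℕ}

/-- A ring homomorphism that multiplies degrees by `e`. -/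
structure MulsDegree (𝒜 : ℕ → σ) (ℬ : ℕ → τ) (e : ℕ) (φ : A →+* B) : Prop where
  mem : ∀ {d : ℕ} {a : A}, a ∈ 𝒜 d → φ a ∈ ℬ (e * d)

/-- The degree enters only through proofs. This is needed because the degree of a product appears
both as `deg s + deg t` and as `deg t + deg s`. -/
theorem awayι_congr {m m' : ℕ} (s : A) (hs : s ∈ 𝒜 m) (hm : 0 < m) (hs' : s ∈ 𝒜 m')
    (hm' : 0 < m') : Proj.awayι 𝒜 s hs hm = Proj.awayι 𝒜 s hs' hm' := by
  have : Proj.basicOpenIsoSpec 𝒜 s hs hm = Proj.basicOpenIsoSpec 𝒜 s hs' hm' :=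
    Iso.ext rfl
  rw [Proj.awayι, Proj.awayι, this]

namespace MulsDegree

variable {φ : A →+* B} (hφ : MulsDegree 𝒜 ℬ e φ)

include hφ in
theorem map_mem_nsmul {d n : ℕ} {a : A} (ha : a ∈ 𝒜 (n • d)) : φ a ∈ ℬ (n • (e * d)) := by
  have := hφ.mem ha
  rwa [smul_eq_mul, mul_left_comm] at this

include hφ in
-- The map on ordinary localizations preserves degree-zero fractions. As `val` is injective, the
-- ring axioms for the restricted map are inherited from `IsLocalization.map`.
theorem exists_val (s : A) (x : Away 𝒜 s) : ∃ y : Away ℬ (φ s),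
    y.val = IsLocalization.map (M := Submonoid.powers s) (T := Submonoid.powers (φ s))
      (Localization.Away (φ s)) φ (by rintro _ ⟨n, rfl⟩; exact ⟨n, by simp⟩) x.val := by
  obtain ⟨⟨i, ⟨a, ha⟩, ⟨b, hb⟩, n, hn⟩, rfl⟩ := mk_surjective x
  dsimp only at hn
  subst hn
  refine ⟨HomogeneousLocalization.mk ⟨e * i, ⟨φ a, hφ.mem ha⟩, ⟨φ (s ^ n), hφ.mem hb⟩, ⟨n, by simp⟩⟩, ?_⟩
  rw [val_mk, val_mk, Localization.mk_eq_mk', Localization.mk_eq_mk', IsLocalization.map_mk']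

/-- The homomorphism `a / s ^ n ↦ φ a / φ s ^ n` of homogeneous localizations. -/
noncomputable def awayMap (s : A) : Away 𝒜 s →+* Away ℬ (φ s) where
  toFun x := (hφ.exists_val s x).choose
  map_zero' := val_injective _ (by rw [(hφ.exists_val s _).choose_spec]; simp)
  map_one' := val_injective _ (by rw [(hφ.exists_val s _).choose_spec]; simp)
  map_add' x y := val_injective _ (by
    rw [(hφ.exists_val s _).choose_spec, val_add, val_add, (hφ.exists_val s _).choose_spec,
      (hφ.exists_val s _).choose_spec, map_add])
  map_mul' x y := val_injective _ (by
    rw [(hφ.exists_val s _).choose_spec, val_mul, val_mul, (hφ.exists_val s _).choose_spec,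
      (hφ.exists_val s _).choose_spec, map_mul])

theorem val_awayMap (s : A) (x : Away 𝒜 s) : (hφ.awayMap s x).val =
    IsLocalization.map (M := Submonoid.powers s) (T := Submonoid.powers (φ s))
      (Localization.Away (φ s)) φ (by rintro _ ⟨n, rfl⟩; exact ⟨n, by simp⟩) x.val :=
  (hφ.exists_val s x).choose_spec

theorem awayMap_mk {s : A} {d : ℕ} (hs : s ∈ 𝒜 d) (n : ℕ) (a : A) (ha : a ∈ 𝒜 (n • d)) :
    hφ.awayMap s (Away.mk 𝒜 hs n a ha) =
      Away.mk ℬ (hφ.mem hs) n (φ a) (hφ.map_mem_nsmul ha) := by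
  apply val_injective
  rw [val_awayMap, Away.val_mk, Away.val_mk, Localization.mk_eq_mk', Localization.mk_eq_mk',
    IsLocalization.map_mk']
  congr 1
  ext
  simp

theorem awayMap_comp_awayMap {s t x : A} {d d' : ℕ} (hs : s ∈ 𝒜 d) (ht : t ∈ 𝒜 d')
    (hx : x = s * t) (hx' : φ x = φ s * φ t) :
    (HomogeneousLocalization.awayMap ℬ (hφ.mem ht) hx').comp (hφ.awayMap s) =
      (hφ.awayMap x).comp (HomogeneousLocalization.awayMap 𝒜 ht hx) := by
  ext z
  obtain ⟨n, a, ha, rfl⟩ := Away.mk_surjective 𝒜 hs z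
  simp only [RingHom.comp_apply, awayMap_mk, HomogeneousLocalization.awayMap_mk]
  simp

/-- The forms not vanishing under `φ` separate the points from the empty set. -/
def Covers (_ : MulsDegree 𝒜 ℬ e φ) : Prop :=
  ∀ p : Proj ℬ, ∃ d, 0 < d ∧ ∃ s ∈ 𝒜 d, p ∈ Proj.basicOpen ℬ (φ s)

/-- Homogeneous elements of positive degree. -/
structure PosForm (𝒜 : ℕ → σ) where
  deg : ℕ
  pos : 0 < deg
  val : A
  mem : val ∈ 𝒜 deg

variable (he : 0 < e) (hc : hφ.Covers)

/-- The open cover by the `D₊(φ s)`. -/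
noncomputable def cover : (Proj ℬ).AffineOpenCover where
  I₀ := PosForm 𝒜
  X s := .of (Away ℬ (φ s.val))
  f s := Proj.awayι ℬ (φ s.val) (hφ.mem s.mem) (Nat.mul_pos he s.pos)
  idx p := ⟨(hc p).choose, (hc p).choose_spec.1, (hc p).choose_spec.2.choose,
    (hc p).choose_spec.2.choose_spec.1⟩
  covers p := by
    have := (hc p).choose_spec.2.choose_spec.2
    rw [← Proj.opensRange_awayι ℬ _ (hφ.mem (hc p).choose_spec.2.choose_spec.1)
      (Nat.mul_pos he (hc p).choose_spec.1)] at this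
    exact this

/-- The morphism on `D₊(φ s)`. -/
noncomputable def localMap (s : PosForm 𝒜) : Spec (.of (Away ℬ (φ s.val))) ⟶ Proj 𝒜 :=
  Spec.map (CommRingCat.ofHom (hφ.awayMap s.val)) ≫ Proj.awayι 𝒜 s.val s.mem s.pos

theorem localMap_compat (s t : PosForm 𝒜) (hx : φ (s.val * t.val) = φ s.val * φ t.val) :
    Spec.map (CommRingCat.ofHom (HomogeneousLocalization.awayMap ℬ (hφ.mem t.mem) hx)) ≫
      hφ.localMap s =
    Spec.map (CommRingCat.ofHom (hφ.awayMap (s.val * t.val))) ≫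
      Proj.awayι 𝒜 (s.val * t.val) (SetLike.mul_mem_graded s.mem t.mem)
        (Nat.add_pos_left s.pos _) := by
  rw [localMap, ← Spec.map_comp_assoc, ← CommRingCat.ofHom_comp,
    hφ.awayMap_comp_awayMap s.mem t.mem rfl, CommRingCat.ofHom_comp, Spec.map_comp_assoc,
    Proj.SpecMap_awayMap_awayι]

/-- The overlap of two charts is `D₊(φ (s t))`, and both local morphisms restrict there to the one
attached to `s t`. -/
theorem pullback_compat (s t : PosForm 𝒜) :
    Limits.pullback.fst
        (Proj.awayι ℬ (φ s.val) (hφ.mem s.mem) (Nat.mul_pos he s.pos))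
        (Proj.awayι ℬ (φ t.val) (hφ.mem t.mem) (Nat.mul_pos he t.pos)) ≫ hφ.localMap s =
      Limits.pullback.snd _ _ ≫ hφ.localMap t := by
  have hx : φ (s.val * t.val) = φ s.val * φ t.val := map_mul _ _ _
  rw [← cancel_epi (Proj.pullbackAwayιIso ℬ (hφ.mem s.mem) (Nat.mul_pos he s.pos) (hφ.mem t.mem)
    (Nat.mul_pos he t.pos) hx).inv, ← Category.assoc, ← Category.assoc,
    Proj.pullbackAwayιIso_inv_fst, Proj.pullbackAwayιIso_inv_snd, localMap_compat, localMap,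
    ← Spec.map_comp_assoc, ← CommRingCat.ofHom_comp,
    hφ.awayMap_comp_awayMap t.mem s.mem (mul_comm s.val t.val), CommRingCat.ofHom_comp,
    Spec.map_comp_assoc, Proj.SpecMap_awayMap_awayι]
  exact congrArg _ (awayι_congr _ _ _ _ _)

/-- The morphism of projective spectra defined by `φ`. -/
noncomputable def projMap : Proj ℬ ⟶ Proj 𝒜 :=
  (hφ.cover he hc).openCover.glueMorphisms hφ.localMap (hφ.pullback_compat he)

theorem awayι_projMap (s : PosForm 𝒜) :
    Proj.awayι ℬ (φ s.val) (hφ.mem s.mem) (Nat.mul_pos he s.pos) ≫ hφ.projMap he hc =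
      hφ.localMap s :=
  (hφ.cover he hc).openCover.ι_glueMorphisms _ _ s

include he hc in
theorem hom_ext {X : Scheme.{u}} {g h : Proj ℬ ⟶ X}
    (H : ∀ s : PosForm 𝒜, Proj.awayι ℬ (φ s.val) (hφ.mem s.mem) (Nat.mul_pos he s.pos) ≫ g =
      Proj.awayι ℬ (φ s.val) (hφ.mem s.mem) (Nat.mul_pos he s.pos) ≫ h) : g = h :=
  (hφ.cover he hc).openCover.hom_ext _ _ H

theorem projMap_congr {φ' : A →+* B} (hφ' : MulsDegree 𝒜 ℬ e φ') (hc' : hφ'.Covers)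
    (h : φ = φ') : hφ.projMap he hc = hφ'.projMap he hc' := by
  subst h
  rfl

theorem preimage_basicOpen {d : ℕ} (hd : 0 < d) {s : A} (hs : s ∈ 𝒜 d) :
    hφ.projMap he hc ⁻¹ᵁ Proj.basicOpen 𝒜 s = Proj.basicOpen ℬ (φ s) := by
  have key (t : PosForm 𝒜) :
      Proj.awayι ℬ (φ t.val) (hφ.mem t.mem) (Nat.mul_pos he t.pos) ⁻¹ᵁ
        (hφ.projMap he hc ⁻¹ᵁ Proj.basicOpen 𝒜 s) =
      Proj.awayι ℬ (φ t.val) (hφ.mem t.mem) (Nat.mul_pos he t.pos) ⁻¹ᵁ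
        Proj.basicOpen ℬ (φ s) := by
    rw [← Scheme.Hom.comp_preimage, awayι_projMap, localMap, Scheme.Hom.comp_preimage,
      Proj.awayι_preimage_basicOpen 𝒜 t.mem t.pos hs hd,
      Proj.awayι_preimage_basicOpen ℬ (hφ.mem t.mem) (Nat.mul_pos he t.pos) (hφ.mem hs)
        (Nat.mul_pos he hd)]
    ext x
    change hφ.awayMap t.val _ ∉ x.asIdeal ↔ _ ∉ x.asIdeal
    rw [hφ.awayMap_mk]
    -- In the chart of `t`, `D₊(s)` is cut out by `s ^ deg t / t ^ d`. The corresponding fraction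
    -- for `φ s` and `φ t` is the `e`-th power of its image, so a prime contains one exactly when it
    -- contains the other.
    have hpow : Away.isLocalizationElem (hφ.mem t.mem) (hφ.mem hs) =
        (Away.mk ℬ (hφ.mem t.mem) d (φ (s ^ t.deg)) (by
          rw [map_pow]
          convert SetLike.pow_mem_graded t.deg (hφ.mem hs) using 2
          simp only [smul_eq_mul]; ring)) ^ e := by
      apply val_injective
      simp only [Away.val_mk, val_pow, Localization.mk_pow, map_pow]
      rw [Localization.mk_eq_mk_iff, Localization.r_iff_exists]
      refine ⟨1, ?_⟩
      simp only [OneMemClass.coe_one, one_mul, SubmonoidClass.coe_pow]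
      ring
    rw [hpow, x.2.pow_mem_iff_mem _ he]
  ext p
  obtain ⟨t, x, rfl⟩ := (hφ.cover he hc).openCover.exists_eq p
  exact SetLike.ext_iff.mp (key t) x

theorem notMem_projMap_iff {d : ℕ} (hd : 0 < d) {s : A} (hs : s ∈ 𝒜 d) (p : Proj ℬ) :
    s ∉ (hφ.projMap he hc p).asHomogeneousIdeal ↔ φ s ∉ p.asHomogeneousIdeal :=
  SetLike.ext_iff.mp (hφ.preimage_basicOpen he hc hd hs) p

end MulsDegree

end DegreeMul

/-! ### Composition with graded homomorphisms, and sections over basic opens. -/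

section DegreeMulComp

set_option linter.unusedSectionVars false

universe u

open HomogeneousLocalization Graded HomogeneousIdeal

variable {A B C σ τ ρ : Type u} [CommRing A] [SetLike σ A] [AddSubgroupClass σ A]
  [CommRing B] [SetLike τ B] [AddSubgroupClass τ B] [CommRing C] [SetLike ρ C]
  [AddSubgroupClass ρ C] {𝒜 : ℕ → σ} {ℬ : ℕ → τ} {𝒞 : ℕ → ρ}
  [GradedRing 𝒜] [GradedRing ℬ] [GradedRing 𝒞] {e : ℕ}

namespace MulsDegree

variable {φ : A →+* B} (hφ : MulsDegree 𝒜 ℬ e φ) (he : 0 < e) (hc : hφ.Covers)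

include hφ in
theorem postcomp (f : ℬ →+*ᵍ 𝒞) : MulsDegree 𝒜 𝒞 e ((f : B →+* C).comp φ) :=
  ⟨fun ha => map_mem f (hφ.mem ha)⟩

include hφ in
theorem precomp (g : 𝒞 →+*ᵍ 𝒜) : MulsDegree 𝒞 ℬ e (φ.comp (g : C →+* A)) :=
  ⟨fun ha => hφ.mem (map_mem g ha)⟩

theorem map_comp_projMap (f : ℬ →+*ᵍ 𝒞) (hf : irrelevant 𝒞 ≤ (irrelevant ℬ).map f)
    (hc' : (hφ.postcomp f).Covers) :
    Proj.map f hf ≫ hφ.projMap he hc = (hφ.postcomp f).projMap he hc' := by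
  refine (hφ.postcomp f).hom_ext he hc' fun s => ?_
  rw [awayι_projMap, localMap]
  refine (Category.assoc _ _ _).symm.trans ?_
  refine (congrArg (· ≫ hφ.projMap he hc) (Proj.awayι_comp_map f hf (Nat.mul_pos he s.pos)
    (φ s.val) (hφ.mem s.mem))).trans ?_
  refine (Category.assoc _ _ _).trans ?_
  rw [awayι_projMap, localMap, ← Spec.map_comp_assoc, ← CommRingCat.ofHom_comp]
  congr 3
  ext z
  obtain ⟨n, a, ha, rfl⟩ := Away.mk_surjective 𝒜 s.mem z
  refine congrArg HomogeneousLocalization.val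
    (Eq.trans ?_ ((hφ.postcomp f).awayMap_mk s.mem n a ha).symm)
  exact (congrArg (Away.map f (φ s.val)) (hφ.awayMap_mk s.mem n a ha)).trans (Away.map_mk ..)

theorem projMap_comp_map (g : 𝒞 →+*ᵍ 𝒜) (hg : irrelevant 𝒜 ≤ (irrelevant 𝒞).map g)
    (hc' : (hφ.precomp g).Covers) :
    hφ.projMap he hc ≫ Proj.map g hg = (hφ.precomp g).projMap he hc' := by
  refine (hφ.precomp g).hom_ext he hc' fun s => ?_
  rw [awayι_projMap, localMap]
  refine (Category.assoc _ _ _).symm.trans ?_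
  refine (congrArg (· ≫ Proj.map g hg) (hφ.awayι_projMap he hc
    ⟨s.deg, s.pos, g s.val, map_mem g s.mem⟩)).trans ?_
  rw [localMap, Category.assoc]
  refine (congrArg (Spec.map (CommRingCat.ofHom (hφ.awayMap (g s.val))) ≫ ·)
    (Proj.awayι_comp_map g hg s.pos s.val s.mem)).trans ?_
  rw [← Spec.map_comp_assoc, ← CommRingCat.ofHom_comp]
  congr 3
  ext z
  obtain ⟨n, a, ha, rfl⟩ := Away.mk_surjective 𝒞 s.mem z
  refine congrArg HomogeneousLocalization.val
    (Eq.trans ?_ ((hφ.precomp g).awayMap_mk s.mem n a ha).symm)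
  exact (congrArg (hφ.awayMap (g s.val)) (Away.map_mk g s.val s.mem n a ha)).trans
    (hφ.awayMap_mk ..)

/-- This reduces the question of which sections over `D₊(φ s)` come from `D₊(s)` to one about
fractions. -/
theorem awayToSection_appLE {d : ℕ} (hd : 0 < d) {s : A} (hs : s ∈ 𝒜 d) :
    Proj.awayToSection 𝒜 s ≫ (hφ.projMap he hc).appLE (Proj.basicOpen 𝒜 s)
      (Proj.basicOpen ℬ (φ s)) (hφ.preimage_basicOpen he hc hd hs).ge =
    CommRingCat.ofHom (hφ.awayMap s) ≫ Proj.awayToSection ℬ (φ s) := by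
  have hU : IsAffineOpen (Proj.basicOpen ℬ (φ s)) :=
    Proj.isAffineOpen_basicOpen ℬ _ (hφ.mem hs) (Nat.mul_pos he hd)
  have hι : (Proj.basicOpen ℬ (φ s)).toSpecΓ ≫ Spec.map (Proj.awayToSection ℬ (φ s)) ≫
      Proj.awayι ℬ (φ s) (hφ.mem hs) (Nat.mul_pos he hd) = (Proj.basicOpen ℬ (φ s)).ι := by
    rw [Proj.awayι, ← Category.assoc]
    exact (Proj.basicOpenIsoSpec ℬ (φ s) (hφ.mem hs) (Nat.mul_pos he hd)).hom_inv_id_assoc _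
  have hι' : (Proj.basicOpen 𝒜 s).toSpecΓ ≫ Spec.map (Proj.awayToSection 𝒜 s) ≫
      Proj.awayι 𝒜 s hs hd = (Proj.basicOpen 𝒜 s).ι := by
    rw [Proj.awayι, ← Category.assoc]
    exact (Proj.basicOpenIsoSpec 𝒜 s hs hd).hom_inv_id_assoc _
  have : IsIso (Proj.basicOpen ℬ (φ s)).toSpecΓ := hU.isoSpec.isIso_hom
  apply Spec.map_injective
  rw [← cancel_epi (Proj.basicOpen ℬ (φ s)).toSpecΓ, ← cancel_mono (Proj.awayι 𝒜 s hs hd)]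
  rw [Spec.map_comp, Spec.map_comp, Category.assoc, Category.assoc, Category.assoc,
    Category.assoc, Scheme.Opens.toSpecΓ_SpecMap_appLE_assoc, hι', Scheme.Hom.resLE_comp_ι]
  have h := hφ.awayι_projMap he hc ⟨d, hd, s, hs⟩
  rw [localMap] at h
  dsimp only at h
  rw [← h, ← hι]
  simp only [Category.assoc]

end MulsDegree

/-- Numerator and denominator of a degree-zero fraction are multiplied by the same power of `c`. -/
theorem Proj.map_eq_id_of_scaling (f : 𝒜 →+*ᵍ 𝒜) (hf : irrelevant 𝒜 ≤ (irrelevant 𝒜).map f)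
    {c c' : A} (hc' : c' ∈ 𝒜 0) (hcc : c * c' = 1)
    (h : ∀ {d : ℕ} {a : A}, a ∈ 𝒜 d → f a = c ^ d * a) : Proj.map f hf = 𝟙 (Proj 𝒜) := by
  refine (Proj.affineOpenCover 𝒜).openCover.hom_ext _ _ fun s => ?_
  obtain ⟨⟨d, hd⟩, s, hs⟩ := s
  change s ∈ 𝒜 d at hs
  have hcd : c' ^ d ∈ 𝒜 0 := by simpa using SetLike.pow_mem_graded d hc'
  have hx : s = f s * c' ^ d := by
    rw [h hs, mul_right_comm, ← mul_pow, hcc, one_pow, one_mul]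
  change Proj.awayι 𝒜 s hs hd ≫ _ = Proj.awayι 𝒜 s hs hd ≫ _
  rw [Category.comp_id]
  have h2 : Proj.awayι 𝒜 s hs hd =
      Spec.map (CommRingCat.ofHom (HomogeneousLocalization.awayMap 𝒜 hcd hx)) ≫
        Proj.awayι 𝒜 (f s) (map_mem f hs) hd :=
    (awayι_congr _ _ _ _ _).trans (Proj.SpecMap_awayMap_awayι 𝒜 (map_mem f hs) hd hcd hx).symm
  conv_lhs => rw [h2]
  rw [Category.assoc, Proj.awayι_comp_map, ← Spec.map_comp_assoc, ← CommRingCat.ofHom_comp]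
  suffices H : (HomogeneousLocalization.awayMap 𝒜 hcd hx).comp (Away.map f s) =
      RingHom.id (Away 𝒜 s) by
    rw [H, CommRingCat.ofHom_id, Spec.map_id, Category.id_comp]
  ext z
  obtain ⟨n, a, ha, rfl⟩ := Away.mk_surjective 𝒜 hs z
  rw [RingHom.comp_apply, Away.map_mk, HomogeneousLocalization.awayMap_mk, RingHom.id_apply,
    Away.val_mk, Away.val_mk]
  congr 1
  rw [h ha, smul_eq_mul, mul_right_comm, mul_comm n, pow_mul, ← mul_pow, ← mul_pow, hcc,
    one_pow, one_pow, one_mul]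

end DegreeMulComp

/-! ### Integral homomorphisms: going up, closedness and image. -/

section DegreeMulTopology

set_option linter.unusedSectionVars false

universe u

open HomogeneousLocalization Graded HomogeneousIdeal

variable {A B σ τ : Type u} [CommRing A] [SetLike σ A] [AddSubgroupClass σ A]
  [CommRing B] [SetLike τ B] [AddSubgroupClass τ B] {𝒜 : ℕ → σ} {ℬ : ℕ → τ}
  [GradedRing 𝒜] [GradedRing ℬ] {e : ℕ}

namespace MulsDegree

variable {φ : A →+* B} (hφ : MulsDegree 𝒜 ℬ e φ) (he : 0 < e) (hc : hφ.Covers)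

include hφ he in
theorem decompose_map (a : A) (i : ℕ) :
    (DirectSum.decompose ℬ (φ a) (e * i) : B) = φ (DirectSum.decompose 𝒜 a i) := by
  classical
  conv_lhs => rw [← DirectSum.sum_support_decompose 𝒜 a, map_sum, DirectSum.decompose_sum]
  rw [DFinsupp.finsetSum_apply, AddSubmonoidClass.coe_finsetSum]
  have h (j : ℕ) : (DirectSum.decompose ℬ (φ (DirectSum.decompose 𝒜 a j)) (e * i) : B) =
      if j = i then φ (DirectSum.decompose 𝒜 a i) else 0 := by
    split_ifs with hj
    · subst hj
      exact DirectSum.decompose_of_mem_same ℬ (hφ.mem (SetLike.coe_mem _))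
    · exact DirectSum.decompose_of_mem_ne ℬ (hφ.mem (SetLike.coe_mem _))
        fun h => hj (Nat.eq_of_mul_eq_mul_left he h)
  simp_rw [h]
  rw [Finset.sum_ite_eq']
  split_ifs with hi
  · rfl
  · have : DirectSum.decompose 𝒜 a i = 0 := by simpa using hi
    simp [this]

include hφ he in
theorem isHomogeneous_comap {I : Ideal B} (hI : I.IsHomogeneous ℬ) :
    (I.comap φ).IsHomogeneous 𝒜 := by
  intro i a ha
  rw [Ideal.mem_comap, ← hφ.decompose_map he]
  exact hI _ ha

theorem mem_projMap_iff (p : Proj ℬ) (a : A) :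
    a ∈ (hφ.projMap he hc p).asHomogeneousIdeal ↔ φ a ∈ p.asHomogeneousIdeal := by
  have hom {d : ℕ} {a : A} (ha : a ∈ 𝒜 d) :
      a ∈ (hφ.projMap he hc p).asHomogeneousIdeal ↔ φ a ∈ p.asHomogeneousIdeal := by
    -- The description of preimages of basic opens needs positive degree. Multiplying by a form `s`
    -- with `φ s ∉ p` covers degree zero as well.
    obtain ⟨d', hd', s, hs, hps⟩ := hc p
    have h1 : s ∉ (hφ.projMap he hc p).asHomogeneousIdeal :=
      (hφ.notMem_projMap_iff he hc hd' hs p).mpr hps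
    have h2 := not_iff_not.mp (hφ.notMem_projMap_iff he hc (Nat.add_pos_right d hd')
      (SetLike.mul_mem_graded ha hs) p)
    have h3 : a * s ∈ (hφ.projMap he hc p).asHomogeneousIdeal.toIdeal ↔
        a ∈ (hφ.projMap he hc p).asHomogeneousIdeal.toIdeal :=
      ⟨fun h => ((hφ.projMap he hc p).isPrime.mem_or_mem h).resolve_right h1,
        fun h => Ideal.mul_mem_right _ _ h⟩
    have h4 : φ a * φ s ∈ p.asHomogeneousIdeal.toIdeal ↔ φ a ∈ p.asHomogeneousIdeal.toIdeal :=
      ⟨fun h => (p.isPrime.mem_or_mem h).resolve_right hps,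
        fun h => Ideal.mul_mem_right _ _ h⟩
    rw [map_mul] at h2
    exact h3.symm.trans (h2.trans h4)
  have h1 := Ideal.IsHomogeneous.mem_iff (𝒜 := 𝒜) (hφ.projMap he hc p).asHomogeneousIdeal.isHomogeneous
    (x := a)
  have h2 := (hφ.isHomogeneous_comap he p.asHomogeneousIdeal.isHomogeneous).mem_iff (x := a)
  exact h1.trans (Iff.trans (forall_congr' fun i => hom (SetLike.coe_mem _)) h2.symm)

theorem asHomogeneousIdeal_projMap (p : Proj ℬ) :
    (hφ.projMap he hc p).asHomogeneousIdeal.toIdeal = p.asHomogeneousIdeal.toIdeal.comap φ :=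
  Ideal.ext (hφ.mem_projMap_iff he hc p)

/-- Going up for homogeneous primes. -/
theorem exists_projMap_eq (hint : φ.IsIntegral) (J : HomogeneousIdeal ℬ) (P : Proj 𝒜)
    (hJ : J.toIdeal.comap φ ≤ P.asHomogeneousIdeal.toIdeal) :
    ∃ p : Proj ℬ, J ≤ p.asHomogeneousIdeal ∧ hφ.projMap he hc p = P := by
  let := φ.toAlgebra
  have := P.isPrime
  have : Algebra.IsIntegral A B := ⟨hint⟩
  obtain ⟨Q, hJQ, hQ, hQP⟩ := Ideal.exists_ideal_over_prime_of_isIntegral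
    P.asHomogeneousIdeal.toIdeal J.toIdeal hJ
  -- The prime `Q` given by going up need not be homogeneous. Its homogeneous core still contracts
  -- to `P`, because `P` is generated by forms and `φ` takes forms to forms.
  have hcomap : (Q.homogeneousCore ℬ).toIdeal.comap φ = P.asHomogeneousIdeal.toIdeal := by
    apply le_antisymm
    · exact (Ideal.comap_mono (Ideal.toIdeal_homogeneousCore_le ℬ Q)).trans hQP.le
    · intro a ha
      refine ((hφ.isHomogeneous_comap he (Q.homogeneousCore ℬ).isHomogeneous).mem_iff).mpr ?_
      intro i
      refine Ideal.mem_homogeneousCore_of_homogeneous_of_mem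
        ⟨_, hφ.mem (SetLike.coe_mem _)⟩ ?_
      have := P.asHomogeneousIdeal.isHomogeneous i ha
      rw [← hQP] at this
      exact this
  have hirr : ¬ irrelevant ℬ ≤ Q.homogeneousCore ℬ := by
    intro h
    refine P.not_irrelevant_le ?_
    refine (HomogeneousIdeal.toIdeal_irrelevant_le 𝒜).mpr fun i hi a ha => ?_
    refine hcomap.le (x := a) ?_
    exact h (mem_irrelevant_of_mem ℬ (Nat.mul_pos he hi) (hφ.mem ha))
  refine ⟨⟨Q.homogeneousCore ℬ, hQ.homogeneousCore, hirr⟩, ?_, ?_⟩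
  · have := Ideal.homogeneousCore_mono ℬ hJQ
    rwa [J.toIdeal_homogeneousCore_eq_self] at this
  · refine ProjectiveSpectrum.ext (HomogeneousIdeal.ext ?_)
    exact (hφ.asHomogeneousIdeal_projMap he hc _).trans hcomap

/-- By going up, the image of the zero locus of `J` is the zero locus of the contraction of `J`. -/
theorem isClosedMap_projMap (hint : φ.IsIntegral) : IsClosedMap (hφ.projMap he hc) := by
  intro Z hZ
  have hZ' : ProjectiveSpectrum.zeroLocus ℬ (ProjectiveSpectrum.vanishingIdeal Z) = Z :=
    (ProjectiveSpectrum.zeroLocus_vanishingIdeal_eq_closure ℬ Z).trans hZ.closure_eq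
  have : hφ.projMap he hc '' Z = ProjectiveSpectrum.zeroLocus 𝒜
      ((ProjectiveSpectrum.vanishingIdeal Z : HomogeneousIdeal ℬ).toIdeal.comap φ) := by
    ext P
    constructor
    · rintro ⟨p, hp, rfl⟩ a ha
      refine (hφ.mem_projMap_iff he hc p a).mpr ?_
      exact (ProjectiveSpectrum.mem_vanishingIdeal ..).mp ha p hp
    · intro hP
      obtain ⟨p, hp, rfl⟩ := hφ.exists_projMap_eq he hc hint
        (ProjectiveSpectrum.vanishingIdeal Z) P hP
      exact ⟨p, hZ' ▸ hp, rfl⟩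
  rw [this]
  exact ProjectiveSpectrum.isClosed_zeroLocus 𝒜 _

theorem range_projMap (hint : φ.IsIntegral) :
    Set.range (hφ.projMap he hc) = {P : Proj 𝒜 | RingHom.ker φ ≤ P.asHomogeneousIdeal.toIdeal} := by
  ext P
  constructor
  · rintro ⟨p, rfl⟩ a ha
    refine (hφ.mem_projMap_iff he hc p a).mpr ?_
    rw [(RingHom.mem_ker).mp ha]
    exact p.asHomogeneousIdeal.toIdeal.zero_mem
  · intro hP
    obtain ⟨p, -, rfl⟩ := hφ.exists_projMap_eq he hc hint ⊥ P (by
      rw [HomogeneousIdeal.toIdeal_bot]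
      exact hP)
    exact ⟨p, rfl⟩

end MulsDegree

end DegreeMulTopology

/-! ### Scheme-theoretic images and a local criterion for invariant sections. -/

section QuotientCriterion

open TopologicalSpace Opposite

/-- The ideal sheaf is kept as a variable so that the vanishing ideal of a closed set, which is
equal to the kernel but not by definition, can take its place. Injectivity on sections follows from
injectivity on stalks. -/
theorem Scheme.Hom.exists_subscheme_factorization {X P : Scheme.{0}} (f : X ⟶ P)
    [QuasiCompact f] (I : P.IdealSheafData) (hI : I = f.ker) :
    ∃ q : X ⟶ I.subscheme, q ≫ I.subschemeι = f ∧
      ∀ U : I.subscheme.Opens, Function.Injective (q.app U) := by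
  subst hI
  refine ⟨f.toImage, f.toImage_imageι, fun U => ?_⟩
  exact TopCat.Presheaf.app_injective_of_stalkFunctor_map_injective
    (F := f.image.sheaf) f.toImage.c U fun x _ => f.stalkFunctor_toImage_injective x

/-- On the reduced scheme `X` the zero ideal sheaf is the vanishing ideal of the whole space. Its
pushforward is the kernel of `f` on the one hand and the vanishing ideal of the closure of the range
on the other. -/
theorem Scheme.Hom.ker_eq_vanishingIdeal {X P : Scheme.{0}} (f : X ⟶ P) [IsReduced X]
    (Z : Closeds P) (hZ : Set.range f = Z) :
    Scheme.IdealSheafData.vanishingIdeal Z = f.ker := by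
  have h := Scheme.IdealSheafData.map_vanishingIdeal f ⊤
  rw [Scheme.IdealSheafData.vanishingIdeal_top, Scheme.nilradical_eq_bot,
    Scheme.IdealSheafData.map_bot] at h
  rw [h]
  congr 1
  ext1
  simp [Set.image_univ, hZ, Z.isClosed.closure_eq]

namespace IgusaQuotient

/-- The sections condition for a quotient can be checked on a basis of open sets. -/
theorem app_range_of_basis {G : Type} {X Y : Scheme.{0}} (act : G → (X ⟶ X)) (q : X ⟶ Y)
    (invariant : ∀ g, act g ≫ q = q)
    (inj : ∀ U : Y.Opens, Function.Injective (q.app U)) (B : Set Y.Opens)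
    (hB : Opens.IsBasis B)
    (hrange : ∀ U ∈ B, ∀ s : Γ(X, q ⁻¹ᵁ U),
      (∀ (g : G) (h : q ⁻¹ᵁ U ≤ act g ⁻¹ᵁ (q ⁻¹ᵁ U)), (act g).appLE (q ⁻¹ᵁ U) (q ⁻¹ᵁ U) h s = s) →
        s ∈ Set.range (q.app U))
    (U : Y.Opens) (s : Γ(X, q ⁻¹ᵁ U)) :
    s ∈ Set.range (q.app U) ↔
      ∀ (g : G) (h : q ⁻¹ᵁ U ≤ act g ⁻¹ᵁ (q ⁻¹ᵁ U)),
        (act g).appLE (q ⁻¹ᵁ U) (q ⁻¹ᵁ U) h s = s := by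
  have hpre (g : G) (V : Y.Opens) : act g ⁻¹ᵁ (q ⁻¹ᵁ V) = q ⁻¹ᵁ V := by
    rw [← Scheme.Hom.comp_preimage, invariant]
  constructor
  · rintro ⟨t, rfl⟩ g h
    have h1 : q.app U ≫ (act g).appLE (q ⁻¹ᵁ U) (q ⁻¹ᵁ U) h = q.app U := by
      rw [Scheme.Hom.app_eq_appLE, Scheme.Hom.appLE_comp_appLE]
      simp only [invariant]
    exact congr($h1 t)
  · intro hs
    have hcov : ∀ y : U, ∃ V ∈ B, y.1 ∈ V ∧ V ≤ U := fun y =>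
      Opens.isBasis_iff_nbhd.mp hB y.2
    choose V hVB hyV hVU using hcov
    have hloc : ∀ y : U, ∃ t : Γ(Y, V y), q.app (V y) t =
        X.presheaf.map (homOfLE (q.preimage_mono (hVU y))).op s := by
      intro y
      refine hrange (V y) (hVB y) _ fun g h => ?_
      have h2 : X.presheaf.map (homOfLE (q.preimage_mono (hVU y))).op ≫
          (act g).appLE (q ⁻¹ᵁ V y) (q ⁻¹ᵁ V y) h =
          (act g).appLE (q ⁻¹ᵁ U) (q ⁻¹ᵁ U) (hpre g U).ge ≫
            X.presheaf.map (homOfLE (q.preimage_mono (hVU y))).op := by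
        rw [Scheme.Hom.map_appLE, Scheme.Hom.appLE_map]
      have h3 := congr($h2 s)
      refine h3.trans ?_
      exact congrArg _ (hs g _)
    choose t ht using hloc
    -- The local preimages agree on overlaps because `q.app` is injective there, so they glue.
    obtain ⟨r, hr, -⟩ := Y.sheaf.existsUnique_gluing' V U (fun y => homOfLE (hVU y))
      (fun y hy => Opens.mem_iSup.mpr ⟨⟨y, hy⟩, hyV _⟩) t (by
        intro y z
        apply inj
        have e1 : (q.app (V y ⊓ V z)).hom (Y.presheaf.map (Opens.infLELeft (V y) (V z)).op (t y)) =
            X.presheaf.map (homOfLE (q.preimage_mono inf_le_left)).op (q.app (V y) (t y)) := by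
          exact congr($(q.naturality (Opens.infLELeft (V y) (V z)).op) (t y))
        have e2 : (q.app (V y ⊓ V z)).hom (Y.presheaf.map (Opens.infLERight (V y) (V z)).op (t z)) =
            X.presheaf.map (homOfLE (q.preimage_mono inf_le_right)).op (q.app (V z) (t z)) := by
          exact congr($(q.naturality (Opens.infLERight (V y) (V z)).op) (t z))
        refine e1.trans (Eq.trans ?_ e2.symm)
        rw [ht, ht, ← ConcreteCategory.comp_apply, ← ConcreteCategory.comp_apply,
          ← Functor.map_comp, ← Functor.map_comp]
        rfl)
    refine ⟨r, ?_⟩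
    refine X.sheaf.eq_of_locally_eq' (fun y => q ⁻¹ᵁ V y) (q ⁻¹ᵁ U)
      (fun y => homOfLE (q.preimage_mono (hVU y)))
      (fun x hx => Opens.mem_iSup.mpr ⟨⟨q x, hx⟩, hyV _⟩) _ _ fun y => ?_
    refine Eq.trans ?_ (ht y)
    have e3 := congr($(q.naturality (homOfLE (hVU y)).op) r)
    refine e3.symm.trans ?_
    exact congrArg (q.app (V y)) (hr y)

end IgusaQuotient

end QuotientCriterion

/-! ### Polynomial rings, finite group actions and fractions. -/

section InvariantQuotient

namespace IgusaQuotient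

open HomogeneousLocalization Graded

instance isReduced_PP (n : ℕ) : AlgebraicGeometry.IsReduced (PP n) := by
  have (i : (Proj.affineOpenCover (grading n)).openCover.I₀) :
      AlgebraicGeometry.IsReduced ((Proj.affineOpenCover (grading n)).openCover.X i) := by
    obtain ⟨⟨d, hd⟩, s, hs⟩ := i
    change AlgebraicGeometry.IsReduced (Spec (.of (Away (grading n) s)))
    have : _root_.IsReduced (Localization.Away s) :=
      isReduced_localizationPreserves (Submonoid.powers s) (Localization.Away s)
        (inferInstance : _root_.IsReduced (MvPolynomial (Fin n) ℂ))
    have : _root_.IsReduced (Away (grading n) s) :=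
      isReduced_of_injective
        (algebraMap (Away (grading n) s) (Localization.Away s)) (val_injective _)
    infer_instance
  exact AlgebraicGeometry.IsReduced.of_openCover _ (Proj.affineOpenCover (grading n)).openCover

theorem mem_grading_one {n : ℕ} (j : Fin n) : (X j : MvPolynomial (Fin n) ℂ) ∈ grading n 1 :=
  isHomogeneous_X _ _

theorem C_mem_grading {n : ℕ} (c : ℂ) : (C c : MvPolynomial (Fin n) ℂ) ∈ grading n 0 :=
  isHomogeneous_C _ _

theorem exists_X_notMem {n : ℕ} (p : PP n) :
    ∃ j, (X j : MvPolynomial (Fin n) ℂ) ∉ p.asHomogeneousIdeal := by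
  by_contra! h
  refine p.not_irrelevant_le ((HomogeneousIdeal.toIdeal_irrelevant_le _).mpr fun i hi a ha => ?_)
  change a ∈ p.asHomogeneousIdeal.toIdeal
  have ha' : a.IsHomogeneous i := ha
  rw [a.as_sum]
  refine Ideal.sum_mem _ fun c hc => ?_
  obtain ⟨j, hj⟩ : ∃ j, c j ≠ 0 := by
    by_contra! h0
    have h1 := ha' (mem_support_iff.mp hc)
    have : c = 0 := Finsupp.ext h0
    rw [this, map_zero] at h1
    omega
  exact Ideal.mem_of_dvd _ ((X_dvd_monomial.mpr (Or.inr hj))) (h j)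

instance compactSpace_PP (n : ℕ) : CompactSpace (PP n) := by
  rw [← isCompact_univ_iff]
  have h : (Set.univ : Set (PP n)) =
      ⋃ j : Fin n, (Proj.basicOpen (grading n) (X j) : Set (PP n)) := by
    refine (Set.eq_univ_of_forall fun p => Set.mem_iUnion.mpr ?_).symm
    exact exists_X_notMem p
  rw [h]
  exact isCompact_iUnion fun j =>
    (Proj.isAffineOpen_basicOpen (grading n) (X j) (mem_grading_one j) one_pos).isCompact

theorem coe_decompose_zero {n : ℕ} (a : MvPolynomial (Fin n) ℂ) :
    (DirectSum.decompose (grading n) a 0 : MvPolynomial (Fin n) ℂ) = C (coeff 0 a) :=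
  (decomposition.decompose'_apply a 0).trans (homogeneousComponent_zero a)

/-- A homogeneous ideal contains the constant terms of its elements, and nonzero constants are
units. -/
theorem le_ker_constantCoeff {n : ℕ} (p : Ideal (MvPolynomial (Fin n) ℂ))
    (hp : p.IsHomogeneous (grading n)) (hp1 : p ≠ ⊤) : p ≤ RingHom.ker constantCoeff := by
  intro a ha
  have h0 := hp 0 ha
  rw [coe_decompose_zero] at h0
  rw [RingHom.mem_ker, constantCoeff_eq]
  by_contra h
  refine hp1 (p.eq_top_of_isUnit_mem h0 ?_)
  exact (isUnit_iff_ne_zero.mpr h).map C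

variable {m n : ℕ} {φ : MvPolynomial (Fin m) ℂ →+* MvPolynomial (Fin n) ℂ} {e : ℕ}

/-- If `p` contained the images of all forms of positive degree, its contraction would be the
maximal ideal of the origin. By integrality `p` would be maximal, hence itself the ideal of the
origin, which contains every variable. -/
theorem covers_of_isIntegral (hφ : MulsDegree (grading m) (grading n) e φ) (he : 0 < e)
    (hint : φ.IsIntegral) : hφ.Covers := by
  intro p
  by_contra! hcon
  have := p.isPrime
  have hmax : (RingHom.ker (constantCoeff : MvPolynomial (Fin m) ℂ →+* ℂ)).IsMaximal :=
    RingHom.ker_isMaximal_of_surjective _ fun c => ⟨C c, constantCoeff_C _ c⟩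
  have hle : RingHom.ker (constantCoeff : MvPolynomial (Fin m) ℂ →+* ℂ) ≤
      p.asHomogeneousIdeal.toIdeal.comap φ := by
    intro a ha
    refine ((hφ.isHomogeneous_comap he p.asHomogeneousIdeal.isHomogeneous).mem_iff).mpr
      fun i => ?_
    rcases Nat.eq_zero_or_pos i with rfl | hi
    · rw [RingHom.mem_ker, constantCoeff_eq] at ha
      have h0 := coe_decompose_zero a
      rw [ha, C_0] at h0
      exact h0 ▸ Ideal.zero_mem _
    · by_contra h
      exact hcon i hi _ (SetLike.coe_mem _) h
  have heq := hmax.eq_of_le (Ideal.IsPrime.ne_top inferInstance) hle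
  have hpmax := Ideal.isMaximal_of_isIntegral_of_isMaximal_comap' φ hint
    p.asHomogeneousIdeal.toIdeal (heq ▸ hmax)
  have heq' := hpmax.eq_of_le (RingHom.ker_ne_top _)
    (le_ker_constantCoeff _ p.asHomogeneousIdeal.isHomogeneous hpmax.ne_top)
  obtain ⟨j, hj⟩ := exists_X_notMem p
  refine hj ?_
  change X j ∈ p.asHomogeneousIdeal.toIdeal
  rw [heq', RingHom.mem_ker, constantCoeff_X]

section Action

variable {Γ : Type} [Group Γ] [Finite Γ] (ρ : Γ →* ((Fin n → ℂ) ≃ₗ[ℂ] (Fin n → ℂ)))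

/-- The action of a group on polynomial functions. -/
noncomputable abbrev polyAction : MulSemiringAction Γ (MvPolynomial (Fin n) ℂ) where
  -- Substitution is contravariant; the inverse makes this a left action.
  smul g a := linSubst (ρ g⁻¹) a
  one_smul a := MvPolynomial.funext fun v => by
    change eval v (linSubst _ a) = _
    rw [eval_linSubst, inv_one, map_one]
    rfl
  mul_smul g h a := MvPolynomial.funext fun v => by
    change eval v (linSubst _ a) = eval v (linSubst _ (linSubst _ a))
    rw [eval_linSubst, eval_linSubst, eval_linSubst, mul_inv_rev, map_mul]
    rfl
  smul_zero g := map_zero (linSubst _)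
  smul_add g := map_add (linSubst _)
  smul_one g := map_one (linSubst _)
  smul_mul g := map_mul (linSubst _)

variable {ρ} (hinv : ∀ p, (∀ g, linSubst (ρ g) p = p) ↔ ∃ a, φ a = p)

include hinv in
theorem isIntegral_of_invariant : φ.IsIntegral := by
  let := φ.toAlgebra
  let := polyAction ρ
  have : Algebra.IsInvariant (MvPolynomial (Fin m) ℂ) (MvPolynomial (Fin n) ℂ) Γ := by
    refine ⟨fun b hb => (hinv b).mp fun g => ?_⟩
    have := hb g⁻¹
    change linSubst (ρ g⁻¹⁻¹) b = b at this
    rwa [inv_inv] at this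
  exact (Algebra.IsInvariant.isIntegral (MvPolynomial (Fin m) ℂ) (MvPolynomial (Fin n) ℂ) Γ).1

include hinv in
-- A finite group acts transitively on the primes over a given prime of the ring of invariants. This
-- holds for all primes, so the orbit condition will hold at all scheme points and not only at
-- closed ones.
theorem exists_forall_mem_iff (P Q : Ideal (MvPolynomial (Fin n) ℂ)) [P.IsPrime] [Q.IsPrime]
    (h : P.comap φ = Q.comap φ) : ∃ g, ∀ a, a ∈ Q ↔ linSubst (ρ g) a ∈ P := by
  let := φ.toAlgebra
  let := polyAction ρ
  have : Algebra.IsInvariant (MvPolynomial (Fin m) ℂ) (MvPolynomial (Fin n) ℂ) Γ := by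
    refine ⟨fun b hb => (hinv b).mp fun g => ?_⟩
    have := hb g⁻¹
    change linSubst (ρ g⁻¹⁻¹) b = b at this
    rwa [inv_inv] at this
  have : SMulCommClass Γ (MvPolynomial (Fin m) ℂ) (MvPolynomial (Fin n) ℂ) := by
    refine ⟨fun g a b => ?_⟩
    change linSubst (ρ g⁻¹) (φ a * b) = φ a * linSubst (ρ g⁻¹) b
    rw [map_mul, (hinv (φ a)).mpr ⟨a, rfl⟩]
  obtain ⟨g, hg⟩ := Algebra.IsInvariant.exists_smul_of_under_eq (MvPolynomial (Fin m) ℂ)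
    (MvPolynomial (Fin n) ℂ) Γ P Q h
  refine ⟨g, fun a => ?_⟩
  rw [hg, Ideal.mem_pointwise_smul_iff_inv_smul_mem]
  change linSubst (ρ g⁻¹⁻¹) a ∈ P ↔ _
  rw [inv_inv]

end Action

theorem appLE_map_awayToSection {n : ℕ} (f : grading n →+*ᵍ grading n)
    (hf : HomogeneousIdeal.irrelevant (grading n) ≤ (HomogeneousIdeal.irrelevant (grading n)).map f)
    {d : ℕ} {s t : MvPolynomial (Fin n) ℂ} (hs : s ∈ grading n d) (ht : t ∈ grading n d)
    (hst : f s = t) (h : Proj.basicOpen _ t ≤ Proj.map f hf ⁻¹ᵁ Proj.basicOpen _ s)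
    (k : ℕ) (a : MvPolynomial (Fin n) ℂ) (ha : a ∈ grading n (k • d)) :
    (Proj.map f hf).appLE (Proj.basicOpen _ s) (Proj.basicOpen _ t) h
      (Proj.awayToSection _ s (Away.mk _ hs k a ha)) =
    Proj.awayToSection _ t (Away.mk _ ht k (f a) (map_mem f ha)) := by
  subst hst
  have := congr($(Proj.awayToSection_comp_appLE f hf hs) (Away.mk _ hs k a ha))
  refine Eq.trans this ?_
  change Proj.awayToSection _ (f s) (Away.map f s (Away.mk _ hs k a ha)) = _
  rw [Away.map_mk]

theorem awayToSection_injective {n : ℕ} {d : ℕ} (hd : 0 < d) {s : MvPolynomial (Fin n) ℂ}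
    (hs : s ∈ grading n d) : Function.Injective (Proj.awayToSection (grading n) s) :=
  (Proj.basicOpenIsoAway (grading n) s hs hd).commRingCatIsoToRingEquiv.injective

theorem awayToSection_surjective {n : ℕ} {d : ℕ} (hd : 0 < d) {s : MvPolynomial (Fin n) ℂ}
    (hs : s ∈ grading n d) : Function.Surjective (Proj.awayToSection (grading n) s) :=
  (Proj.basicOpenIsoAway (grading n) s hs hd).commRingCatIsoToRingEquiv.surjective

theorem away_mk_injective {n : ℕ} {d : ℕ} {s : MvPolynomial (Fin n) ℂ} (hs0 : s ≠ 0)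
    (hs : s ∈ grading n d) (k : ℕ) (a b : MvPolynomial (Fin n) ℂ) (ha : a ∈ grading n (k • d))
    (hb : b ∈ grading n (k • d)) (h : Away.mk _ hs k a ha = Away.mk _ hs k b hb) : a = b := by
  have h1 := congrArg HomogeneousLocalization.val h
  rw [Away.val_mk, Away.val_mk, Localization.mk_eq_mk_iff, Localization.r_iff_exists] at h1
  obtain ⟨⟨_, j, rfl⟩, hc⟩ := h1
  dsimp only at hc
  exact mul_left_cancel₀ (pow_ne_zero k hs0) (mul_left_cancel₀ (pow_ne_zero j hs0) hc)

end IgusaQuotient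
end InvariantQuotient

/-! ### From rings of invariants to quotient schemes. -/

section InvariantQuotientScheme

namespace IgusaQuotient

set_option linter.unusedSectionVars false

open HomogeneousLocalization Graded TopologicalSpace

variable {m n : ℕ} {φ : MvPolynomial (Fin m) ℂ →+* MvPolynomial (Fin n) ℂ} {e : ℕ}
  {Γ : Type} [Group Γ] [Finite Γ] {ρ : Γ →* ((Fin n → ℂ) ≃ₗ[ℂ] (Fin n → ℂ))}
  (hφ : MulsDegree (grading m) (grading n) e φ) (he : 0 < e) (hc : hφ.Covers)
  (hinv : ∀ p, (∀ g, linSubst (ρ g) p = p) ↔ ∃ a, φ a = p)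

include hinv in
theorem projAut_comp_projMap (g : Γ) :
    projAut (ρ g) ≫ hφ.projMap he hc = hφ.projMap he hc := by
  have hcomp : ((gradedSubst (ρ g) : MvPolynomial (Fin n) ℂ →+* _).comp φ) = φ :=
    RingHom.ext fun a => (hinv (φ a)).mpr ⟨a, rfl⟩ g
  have hc' : (hφ.postcomp (gradedSubst (ρ g))).Covers := by
    intro p
    obtain ⟨d, hd, s, hs, hp⟩ := hc p
    refine ⟨d, hd, s, hs, ?_⟩
    rwa [hcomp]
  exact (hφ.map_comp_projMap he hc _ _ hc').trans
    ((hφ.postcomp (gradedSubst (ρ g))).projMap_congr he hc' hφ hc hcomp)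

include hinv in
theorem projMap_eq_iff (p p' : PP n) : hφ.projMap he hc p = hφ.projMap he hc p' ↔
    ∃ g, projAut (ρ g) p = p' := by
  constructor
  · intro h
    have := p.isPrime
    have := p'.isPrime
    obtain ⟨g, hg⟩ := exists_forall_mem_iff hinv p.asHomogeneousIdeal.toIdeal
      p'.asHomogeneousIdeal.toIdeal (by
        rw [← hφ.asHomogeneousIdeal_projMap he hc, ← hφ.asHomogeneousIdeal_projMap he hc, h])
    refine ⟨g, ProjectiveSpectrum.ext (HomogeneousIdeal.ext (Ideal.ext fun a => ?_))⟩
    exact (hg a).symm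
  · rintro ⟨g, rfl⟩
    conv_lhs => rw [← projAut_comp_projMap hφ he hc hinv g]
    rfl

include hinv in
-- An invariant section is a fraction `a / φ s ^ k`. Its denominator is invariant and the ring is a
-- domain, so `a` is invariant and equals `φ b` for some `b`.
theorem exists_appLE_eq {d : ℕ} (hd : 0 < d) {s : MvPolynomial (Fin m) ℂ} (hs : s ∈ grading m d)
    (V : (PP n).Opens) (hV : V = Proj.basicOpen (grading n) (φ s)) (r : Γ(PP n, V))
    (hr : ∀ (g : Γ) (h : V ≤ projAut (ρ g) ⁻¹ᵁ V), (projAut (ρ g)).appLE V V h r = r)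
    (h : V ≤ hφ.projMap he hc ⁻¹ᵁ Proj.basicOpen (grading m) s) :
    ∃ t, (hφ.projMap he hc).appLE (Proj.basicOpen (grading m) s) V h t = r := by
  -- If `φ s = 0` the open set is empty and its ring of sections is trivial.
  by_cases hs0 : φ s = 0
  · have hV0 : V = ⊥ := by rw [hV, hs0, Proj.basicOpen_zero]
    subst hV0
    exact ⟨0, Subsingleton.elim _ _⟩
  subst hV
  have hφs := hφ.mem hs
  obtain ⟨x, rfl⟩ := awayToSection_surjective (Nat.mul_pos he hd) hφs r
  obtain ⟨k, a, ha, rfl⟩ := Away.mk_surjective _ hφs x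
  have hga : ∀ g, linSubst (ρ g) a = a := by
    intro g
    have hgs : linSubst (ρ g) (φ s) = φ s := (hinv (φ s)).mpr ⟨s, rfl⟩ g
    have hle : Proj.basicOpen (grading n) (φ s) ≤
        projAut (ρ g) ⁻¹ᵁ Proj.basicOpen (grading n) (φ s) := by
      change _ ≤ Proj.basicOpen (grading n) (linSubst (ρ g) (φ s))
      rw [hgs]
    have h1 := (appLE_map_awayToSection (gradedSubst (ρ g)) (gradedSubst_irrelevant (ρ g))
      hφs hφs hgs hle k a ha).symm.trans (hr g hle)
    exact away_mk_injective hs0 hφs k _ _ _ _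
      (awayToSection_injective (Nat.mul_pos he hd) hφs h1)
  obtain ⟨b, hb⟩ := (hinv a).mp hga
  -- Since `φ` multiplies degrees by `e`, only the component of `b` in degree `k d` contributes to
  -- `a`.
  have hb' : φ (DirectSum.decompose (grading m) b (k • d)) = a := by
    have h1 := hφ.decompose_map he b (k • d)
    rw [← h1, hb]
    refine DirectSum.decompose_of_mem_same _ ?_
    rwa [smul_eq_mul, mul_left_comm]
  refine ⟨Proj.awayToSection _ s (Away.mk _ hs k _ (SetLike.coe_mem
    (DirectSum.decompose (grading m) b (k • d)))), ?_⟩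
  have h2 := congr($(hφ.awayToSection_appLE he hc hd hs) (Away.mk _ hs k _ (SetLike.coe_mem
    (DirectSum.decompose (grading m) b (k • d)))))
  refine Eq.trans h2 ?_
  change Proj.awayToSection _ (φ s) (hφ.awayMap s _) = _
  rw [hφ.awayMap_mk]
  congr 2

theorem isBasis_preimage_basicOpen {Y : Scheme.{0}} (i : Y ⟶ PP m) (hi : Topology.IsInducing i) :
    Opens.IsBasis {U : Y.Opens | ∃ (d : ℕ) (s : MvPolynomial (Fin m) ℂ), 0 < d ∧ s ∈ grading m d ∧
      U = i ⁻¹ᵁ Proj.basicOpen (grading m) s} := by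
  refine Opens.isBasis_iff_nbhd.mpr fun {U y} hy => ?_
  obtain ⟨V, hV, hVU⟩ := hi.isOpen_iff.mp U.2
  have hyV : i y ∈ (⟨V, hV⟩ : (PP m).Opens) := by
    have : y ∈ i ⁻¹' V := hVU ▸ hy
    exact this
  obtain ⟨_, ⟨G, rfl⟩, hyG, hGV⟩ :=
    Opens.isBasis_iff_nbhd.mp (Proj.isBasis_basicOpen (grading m)) hyV
  rw [Proj.basicOpen_eq_iSup_proj] at hyG
  obtain ⟨k, hk⟩ := Opens.mem_iSup.mp hyG
  obtain ⟨j, hj⟩ := exists_X_notMem (i y)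
  -- The component `k` may be `0`; the extra variable makes the degree positive.
  have hmem : i y ∈ Proj.basicOpen (grading m) (GradedRing.proj (grading m) k G * X j) := by
    rw [Proj.basicOpen_mul]
    exact ⟨hk, hj⟩
  refine ⟨_, ⟨k + 1, GradedRing.proj (grading m) k G * X j, k.succ_pos,
    SetLike.mul_mem_graded (SetLike.coe_mem _) (mem_grading_one j), rfl⟩, hmem, ?_⟩
  intro z hz
  have hz1 : i z ∈ Proj.basicOpen (grading m) G := by
    have hz' : i z ∈ Proj.basicOpen (grading m) (GradedRing.proj (grading m) k G * X j) := hz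
    rw [Proj.basicOpen_mul] at hz'
    rw [Proj.basicOpen_eq_iSup_proj]
    exact Opens.mem_iSup.mpr ⟨k, hz'.1⟩
  have hz2 : z ∈ i ⁻¹' V := hGV hz1
  rwa [hVU] at hz2

include hinv in
-- The image is `Z` by going up, so the scheme-theoretic image is `Z` with its reduced structure.
-- The quotient topology comes from a closed surjection, the orbits from conjugacy of primes, and
-- the sections from `exists_appLE_eq` on a basis.
theorem exists_isQuotient (Z : Closeds (PP m))
    (hZ : ∀ P : PP m, P ∈ Z ↔ RingHom.ker φ ≤ P.asHomogeneousIdeal.toIdeal) :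
    ∃ q : PP n ⟶ (Scheme.IdealSheafData.vanishingIdeal Z).subscheme,
      q ≫ (Scheme.IdealSheafData.vanishingIdeal Z).subschemeι = hφ.projMap he hc ∧
      IsQuotient (fun g => projAut (ρ g)) q := by
  have hint := isIntegral_of_invariant hinv
  have hrange : Set.range (hφ.projMap he hc) = Z := by
    rw [hφ.range_projMap he hc hint]
    exact Set.ext fun P => (hZ P).symm
  obtain ⟨q, hq, hinj⟩ := Scheme.Hom.exists_subscheme_factorization (hφ.projMap he hc)
    (Scheme.IdealSheafData.vanishingIdeal Z)
    (Scheme.Hom.ker_eq_vanishingIdeal (hφ.projMap he hc) Z hrange)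
  set ι := (Scheme.IdealSheafData.vanishingIdeal Z).subschemeι with hιdef
  have hι : Topology.IsClosedEmbedding ι := ι.isClosedEmbedding
  have hιq (x : PP n) : ι (q x) = hφ.projMap he hc x := by
    rw [← hq]
    rfl
  have hrι : Set.range ι = Z := by
    rw [hιdef, Scheme.IdealSheafData.range_subschemeι,
      Scheme.IdealSheafData.coe_support_vanishingIdeal]
  have inv (g : Γ) : projAut (ρ g) ≫ q = q := by
    rw [← cancel_mono ι, Category.assoc, hq, projAut_comp_projMap hφ he hc hinv]
  refine ⟨q, hq, inv, ?_, ?_, hinj, ?_⟩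
  · refine IsClosedMap.isQuotientMap (fun C hC => ?_) q.continuous fun y => ?_
    · rw [hι.isClosed_iff_image_isClosed, ← Set.image_comp]
      have : ι ∘ q = hφ.projMap he hc := funext hιq
      rw [this]
      exact hφ.isClosedMap_projMap he hc hint C hC
    · have : ι y ∈ Set.range (hφ.projMap he hc) := by
        rw [hrange, ← hrι]
        exact ⟨y, rfl⟩
      obtain ⟨x, hx⟩ := this
      exact ⟨x, hι.injective ((hιq x).trans hx)⟩
  · intro x x'
    rw [← projMap_eq_iff hφ he hc hinv, ← hιq, ← hιq, hι.injective.eq_iff]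
  · refine app_range_of_basis _ q inv hinj _ (isBasis_preimage_basicOpen ι hι.isInducing) ?_
    rintro _ ⟨d, s, hd, hs, rfl⟩ r hr
    have hpre : q ⁻¹ᵁ ι ⁻¹ᵁ Proj.basicOpen (grading m) s =
        hφ.projMap he hc ⁻¹ᵁ Proj.basicOpen (grading m) s := by
      rw [← hq]
      rfl
    obtain ⟨t, ht⟩ := exists_appLE_eq hφ he hc hinv hd hs _
      (hpre.trans (hφ.preimage_basicOpen he hc hd hs)) r hr hpre.le
    refine ⟨ι.app _ t, ?_⟩
    rw [← ht]
    have h1 : ι.app (Proj.basicOpen (grading m) s) ≫ q.app (ι ⁻¹ᵁ Proj.basicOpen (grading m) s) =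
        (hφ.projMap he hc).appLE _ _ hpre.le := by
      rw [Scheme.Hom.app_eq_appLE, Scheme.Hom.app_eq_appLE, Scheme.Hom.appLE_comp_appLE]
      simp only [hq]
    exact congr($h1 t)

end IgusaQuotient
end InvariantQuotientScheme

/-! ### Closed points, structure morphisms and equivariance. -/

section ProjMapPoints

namespace IgusaQuotient

open HomogeneousLocalization Graded TopologicalSpace

theorem exists_isPointOf {n : ℕ} {v : Fin n → ℂ} (hv : v ≠ 0) : ∃ p : PP n, IsPointOf v p := by
  have hprime : (RingHom.ker (eval v : MvPolynomial (Fin n) ℂ →+* ℂ)).IsPrime :=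
    RingHom.ker_isPrime _
  refine ⟨⟨(RingHom.ker (eval v)).homogeneousCore (grading n), hprime.homogeneousCore, ?_⟩, ?_⟩
  · intro h
    obtain ⟨j, hj⟩ := Function.ne_iff.mp hv
    have h1 := h (HomogeneousIdeal.mem_irrelevant_of_mem (grading n) one_pos (mem_grading_one j))
    have h2 := Ideal.toIdeal_homogeneousCore_le _ _ h1
    rw [RingHom.mem_ker, eval_X] at h2
    exact hj h2
  · intro d G hG
    constructor
    · intro h
      exact (RingHom.mem_ker).mp (Ideal.toIdeal_homogeneousCore_le _ _ h)
    · intro h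
      exact Ideal.mem_homogeneousCore_of_homogeneous_of_mem ⟨d, hG⟩ h

theorem projAut_smul {n : ℕ} (b b' : (Fin n → ℂ) ≃ₗ[ℂ] (Fin n → ℂ)) {c : ℂ} (hc : c ≠ 0)
    (h : ∀ v, b' v = c • b v) : projAut b' = projAut b := by
  let sc : (Fin n → ℂ) ≃ₗ[ℂ] (Fin n → ℂ) := LinearEquiv.smulOfNeZero ℂ (Fin n → ℂ) c hc
  have h1 : gradedSubst b' = (gradedSubst b).comp (gradedSubst sc) := by
    refine GradedRingHom.ext fun G => MvPolynomial.funext fun v => ?_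
    change eval v (linSubst b' G) = eval v (linSubst b (linSubst sc G))
    rw [eval_linSubst, eval_linSubst, eval_linSubst, h]
    rfl
  have h2 : projAut sc = 𝟙 _ := by
    refine Proj.map_eq_id_of_scaling _ _ (c := C c) (c' := C c⁻¹) (C_mem_grading _)
      (by rw [← C_mul, mul_inv_cancel₀ hc, C_1]) fun {d a} ha => MvPolynomial.funext fun v => ?_
    change eval v (linSubst sc a) = _
    rw [eval_linSubst, map_mul, map_pow, eval_C]
    have ha' : a.IsHomogeneous d := ha
    change eval (c • v) a = _
    rw [eval_eq, eval_eq, Finset.mul_sum]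
    refine Finset.sum_congr rfl fun x hx => ?_
    have hx' : ∑ i, x i = d := by
      rw [← ha' (mem_support_iff.mp hx), Finsupp.weight_apply, Finsupp.sum_fintype _ _ (by simp)]
      simp
    have h3 : ∏ i ∈ x.support, (c • v) i ^ x i = c ^ d * ∏ i ∈ x.support, v i ^ x i := by
      simp_rw [Pi.smul_apply, smul_eq_mul, mul_pow]
      rw [Finset.prod_mul_distrib, Finset.prod_pow_eq_pow_sum, ← hx']
      congr 2
      exact Finset.sum_subset (Finset.subset_univ _) (by simp)
    rw [h3]
    ring
  have h3 : projAut b' = projAut b ≫ projAut sc := by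
    have := Proj.map_comp (gradedSubst sc) (gradedSubst b) (gradedSubst_irrelevant sc)
      (gradedSubst_irrelevant b)
    refine Eq.trans ?_ this
    unfold projAut
    congr 1
  rw [h3, h2, Category.comp_id]

variable {m n : ℕ} {φ : MvPolynomial (Fin m) ℂ →+* MvPolynomial (Fin n) ℂ} {e : ℕ}
  (hφ : MulsDegree (grading m) (grading n) e φ) (he : 0 < e) (hc : hφ.Covers)
  (hC : ∀ c, φ (C c) = C c)

include hC in
theorem eval_map_eq (v : Fin n → ℂ) (G : MvPolynomial (Fin m) ℂ) :
    eval v (φ G) = eval (fun i => eval v (φ (X i))) G := by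
  have : (eval v).comp φ = eval (fun i => eval v (φ (X i))) := by
    apply MvPolynomial.ringHom_ext
    · intro c
      simp [hC]
    · intro i
      simp
  exact congr($this G)

include hC in
theorem isPointOf_projMap {v : Fin n → ℂ} {p : PP n} (hp : IsPointOf v p) :
    IsPointOf (fun i => eval v (φ (X i))) (hφ.projMap he hc p) := by
  intro d G hG
  rw [← eval_map_eq hC]
  exact (hφ.mem_projMap_iff he hc p G).trans (hp _ _ (hφ.mem hG))

include hC in
theorem projMap_structureMap : hφ.projMap he hc ≫ structureMap m = structureMap n := by
  refine hφ.hom_ext he hc fun s => ?_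
  rw [structureMap, structureMap, ← Category.assoc, hφ.awayι_projMap, MulsDegree.localMap,
    Category.assoc, Proj.awayι_toSpecZero_assoc, Proj.awayι_toSpecZero_assoc, ← Spec.map_comp,
    ← Spec.map_comp, ← Spec.map_comp]
  congr 1
  ext c
  change (hφ.awayMap s.val (fromZeroRingHom _ _ (algebraMap ℂ (grading m 0) c))).val =
    Localization.mk (C c) 1
  rw [MulsDegree.val_awayMap]
  have h : algebraMap (MvPolynomial (Fin n) ℂ) (Localization.Away (φ s.val)) (φ (C (show ℂ from c))) =
      algebraMap (MvPolynomial (Fin n) ℂ) (Localization.Away (φ s.val)) (C (show ℂ from c)) := by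
    rw [hC]
  refine Eq.trans ?_ h
  exact IsLocalization.map_eq (M := Submonoid.powers s.val) (S := Localization.Away s.val)
    (T := Submonoid.powers (φ s.val)) (Q := Localization.Away (φ s.val)) _ (C (show ℂ from c))

include hC in
-- Equivariance of the vectors of values up to a scalar is enough, because homotheties act trivially
-- on projective space.
theorem projAut_comp_projMap_eq (a : (Fin n → ℂ) ≃ₗ[ℂ] (Fin n → ℂ))
    (b : (Fin m → ℂ) ≃ₗ[ℂ] (Fin m → ℂ)) {c : ℂ} (hc0 : c ≠ 0)
    (h : ∀ v, (fun i => eval (a v) (φ (X i))) = c • b (fun i => eval v (φ (X i)))) :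
    projAut a ≫ hφ.projMap he hc = hφ.projMap he hc ≫ projAut b := by
  -- Absorbing the scalar into `b` turns the hypothesis into an exact equality of ring
  -- homomorphisms.
  let b' := b.trans (LinearEquiv.smulOfNeZero ℂ (Fin m → ℂ) c hc0)
  have hb' : projAut b' = projAut b := projAut_smul b b' hc0 fun v => rfl
  have hcomp : ((gradedSubst a : MvPolynomial (Fin n) ℂ →+* _).comp φ) =
      φ.comp (gradedSubst b' : MvPolynomial (Fin m) ℂ →+* _) := by
    refine RingHom.ext fun G => MvPolynomial.funext fun v => ?_
    change eval v (linSubst a (φ G)) = eval v (φ (linSubst b' G))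
    rw [eval_linSubst, eval_map_eq hC, eval_map_eq hC, eval_linSubst, h]
    rfl
  have hc1 : (hφ.postcomp (gradedSubst a)).Covers := by
    intro p
    obtain ⟨d, hd, s, hs, hp⟩ := hc (projAut a p)
    exact ⟨d, hd, s, hs, hp⟩
  have hc2 : (hφ.precomp (gradedSubst b')).Covers := by
    intro p
    obtain ⟨d, hd, s, hs, hp⟩ := hc1 p
    refine ⟨d, hd, s, hs, ?_⟩
    rwa [← hcomp]
  rw [← hb']
  exact (hφ.map_comp_projMap he hc _ _ hc1).trans
    (((hφ.postcomp (gradedSubst a)).projMap_congr he hc1 (hφ.precomp (gradedSubst b')) hc2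
      hcomp).trans (hφ.projMap_comp_map he hc _ _ hc2).symm)

end IgusaQuotient
end ProjMapPoints

/-! ### The Heisenberg group of order 64 and quaternion multiplication. -/

section HeisenbergGroup

namespace IgusaQuotient

open Matrix

set_option linter.unnecessarySeqFocus false

/-- `SL(4, ℂ)`. -/
abbrev SL4 := Matrix.SpecialLinearGroup (Fin 4) ℂ

noncomputable def d₁ : SL4 :=
  ⟨!![1, 0, 0, 0; 0, 1, 0, 0; 0, 0, -1, 0; 0, 0, 0, -1], by
    simp [det_succ_row_zero, Fin.sum_univ_succ]⟩

noncomputable def d₂ : SL4 :=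
  ⟨!![1, 0, 0, 0; 0, -1, 0, 0; 0, 0, 1, 0; 0, 0, 0, -1], by
    simp [det_succ_row_zero, Fin.sum_univ_succ]⟩

noncomputable def t₁ : SL4 :=
  ⟨!![0, 1, 0, 0; 1, 0, 0, 0; 0, 0, 0, 1; 0, 0, 1, 0], by
    simp [det_succ_row_zero, Fin.sum_univ_succ, Fin.succAbove]⟩

noncomputable def t₂ : SL4 :=
  ⟨!![0, 0, 1, 0; 0, 0, 0, 1; 1, 0, 0, 0; 0, 1, 0, 0], by
    simp [det_succ_row_zero, Fin.sum_univ_succ, Fin.succAbove]⟩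

/-- The scalar `√-1`. -/
noncomputable def sI : SL4 :=
  ⟨Complex.I • (1 : Matrix (Fin 4) (Fin 4) ℂ), by simp⟩

/-- Generators of the Heisenberg group modulo scalars. -/
noncomputable def heis : Fin 4 → SL4 := ![d₁, d₂, t₁, t₂]

theorem SL4_ext {g h : SL4} (H : ∀ v, g.1 *ᵥ v = h.1 *ᵥ v) : g = h :=
  Subtype.ext (Matrix.ext_of_mulVec_single fun _ => H _)

theorem val_mul (g h : SL4) : (g * h).1 = g.1 * h.1 := rfl

theorem val_one : (1 : SL4).1 = 1 := rfl

theorem val_sI : sI.1 = Complex.I • (1 : Matrix (Fin 4) (Fin 4) ℂ) := rfl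

theorem mul_mulVec (g h : SL4) (v : Fin 4 → ℂ) : (g * h).1 *ᵥ v = g.1 *ᵥ (h.1 *ᵥ v) := by
  rw [val_mul, mulVec_mulVec]

theorem one_mulVec' (v : Fin 4 → ℂ) : (1 : SL4).1 *ᵥ v = v := by
  rw [val_one, one_mulVec]

theorem val_sI_pow (n : ℕ) : (sI ^ n).1 = Complex.I ^ n • (1 : Matrix (Fin 4) (Fin 4) ℂ) := by
  induction n with
  | zero => simp
  | succ n ih => rw [pow_succ, val_mul, ih, val_sI, smul_mul_smul, mul_one, pow_succ]

theorem sI_mul (g : SL4) : sI * g = g * sI := by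
  apply Subtype.ext
  rw [val_mul, val_mul, val_sI, smul_mul_assoc, one_mul, mul_smul_comm, mul_one]

theorem sI_pow_four : sI ^ 4 = 1 := by
  apply Subtype.ext
  rw [val_sI_pow, Complex.I_pow_four, one_smul, val_one]

theorem d₁_mulVec (v : Fin 4 → ℂ) : d₁.1 *ᵥ v = ![v 0, v 1, -v 2, -v 3] := by
  funext i; fin_cases i <;> simp [d₁, mulVec, dotProduct, Fin.sum_univ_four]

theorem d₂_mulVec (v : Fin 4 → ℂ) : d₂.1 *ᵥ v = ![v 0, -v 1, v 2, -v 3] := by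
  funext i; fin_cases i <;> simp [d₂, mulVec, dotProduct, Fin.sum_univ_four]

theorem t₁_mulVec (v : Fin 4 → ℂ) : t₁.1 *ᵥ v = ![v 1, v 0, v 3, v 2] := by
  funext i; fin_cases i <;> simp [t₁, mulVec, dotProduct, Fin.sum_univ_four]

theorem t₂_mulVec (v : Fin 4 → ℂ) : t₂.1 *ᵥ v = ![v 2, v 3, v 0, v 1] := by
  funext i; fin_cases i <;> simp [t₂, mulVec, dotProduct, Fin.sum_univ_four]

theorem sI_mulVec (v : Fin 4 → ℂ) :
    sI.1 *ᵥ v = ![Complex.I * v 0, Complex.I * v 1, Complex.I * v 2, Complex.I * v 3] := by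
  funext i; fin_cases i <;> simp [val_sI, smul_mulVec]

/-- The scalar `-1`. -/
noncomputable def sNeg : SL4 := sI ^ 2

theorem sNeg_mulVec (v : Fin 4 → ℂ) : sNeg.1 *ᵥ v = -v := by
  rw [sNeg, val_sI_pow, Complex.I_sq, smul_mulVec, one_mulVec, neg_one_smul]

/-- The commutator pairing is a perfect one: `d₁` anticommutes with `t₂` only, and `d₂` with `t₁`
only. -/
theorem heis_mul (j k : Fin 4) : heis j * heis k = sNeg ^
    ((![![0, 0, 0, 1], ![0, 0, 1, 0], ![0, 1, 0, 0], ![1, 0, 0, 0]] : Fin 4 → Fin 4 → ℕ) j k) *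
      (heis k * heis j) := by
  apply SL4_ext
  intro v
  rw [mul_mulVec, mul_mulVec, mul_mulVec]
  fin_cases j <;> fin_cases k <;>
    simp [heis, d₁_mulVec, d₂_mulVec, t₁_mulVec, t₂_mulVec, sNeg_mulVec, -mulVec_mulVec]

/-- Schur's lemma by hand: commuting with the sign changes makes `g` diagonal, commuting with the
translations makes it scalar, and determinant one leaves the fourth roots of unity. -/
theorem eq_sI_pow_of_commute {g : SL4} (h : ∀ j, g * heis j = heis j * g) :
    ∃ n : Fin 4, g = sI ^ (n : ℕ) := by
  have h1 : ∀ i j, (d₁.1 * g.1) i j = (g.1 * d₁.1) i j := fun i j =>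
    congrFun (congrFun (congrArg Subtype.val (h 0)).symm i) j
  have h2 : ∀ i j, (d₂.1 * g.1) i j = (g.1 * d₂.1) i j := fun i j =>
    congrFun (congrFun (congrArg Subtype.val (h 1)).symm i) j
  have h3 : ∀ i j, (t₁.1 * g.1) i j = (g.1 * t₁.1) i j := fun i j =>
    congrFun (congrFun (congrArg Subtype.val (h 2)).symm i) j
  have h4 : ∀ i j, (t₂.1 * g.1) i j = (g.1 * t₂.1) i j := fun i j =>
    congrFun (congrFun (congrArg Subtype.val (h 3)).symm i) j
  have a1 := h3 0 1
  have a2 := h4 0 2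
  have a3 := h4 1 3
  have b1 := h2 0 1
  have b2 := h1 0 2
  have b3 := h1 0 3
  have b4 := h2 1 0
  have b5 := h1 1 2
  have b6 := h1 1 3
  have b7 := h1 2 0
  have b8 := h1 2 1
  have b9 := h2 2 3
  have b10 := h1 3 0
  have b11 := h1 3 1
  have b12 := h2 3 2
  clear h1 h2 h3 h4
  simp [mul_apply, Fin.sum_univ_four, d₁, d₂, t₁, t₂, self_eq_neg, neg_eq_self] at a1 a2 a3 b1 b2 b3 b4 b5 b6 b7 b8 b9 b10 b11 b12
  have hg : g.1 = g.1 0 0 • (1 : Matrix (Fin 4) (Fin 4) ℂ) := by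
    ext i j
    fin_cases i <;> fin_cases j <;> simp [a1, a2, a3, b1, b2, b3, b4, b5, b6, b7, b8, b9, b10, b11, b12]
  have hdet := g.2
  rw [hg, det_smul, det_one, mul_one, Fintype.card_fin] at hdet
  have : (g.1 0 0 - 1) * ((g.1 0 0 + 1) * ((g.1 0 0 - Complex.I) * (g.1 0 0 + Complex.I))) = 0 := by
    linear_combination hdet + (1 - g.1 0 0 ^ 2) * Complex.I_sq
  have hval : ∃ n : Fin 4, g.1 0 0 = Complex.I ^ (n : ℕ) := by
    rcases mul_eq_zero.mp this with h | h
    · exact ⟨0, by simpa [sub_eq_zero] using h⟩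
    rcases mul_eq_zero.mp h with h | h
    · exact ⟨2, by simpa [add_eq_zero_iff_eq_neg] using h⟩
    rcases mul_eq_zero.mp h with h | h
    · exact ⟨1, by simpa [sub_eq_zero] using h⟩
    · exact ⟨3, by simpa [add_eq_zero_iff_eq_neg, Complex.I_pow_three] using h⟩
  obtain ⟨n, hn⟩ := hval
  refine ⟨n, Subtype.ext ?_⟩
  rw [hg, hn, val_sI_pow]

theorem sNeg_pow_mul (n : ℕ) (g : SL4) : sNeg ^ n * g = g * sNeg ^ n := by
  have h : Commute sI g := sI_mul g
  exact (h.pow_left 2).pow_left n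

theorem sNeg_pow_two_mul (n : ℕ) : sNeg ^ n * sNeg ^ n = 1 := by
  rw [sNeg, ← pow_mul, ← pow_add, show 2 * n + 2 * n = 4 * n by ring, pow_mul, sI_pow_four, one_pow]

theorem sNeg_ne_one : sNeg ≠ 1 := by
  intro h
  have h1 := sNeg_mulVec 1
  rw [h, one_mulVec'] at h1
  have h2 := congrFun h1 0
  norm_num at h2

/-- The commutator of `g` and `h` is the scalar `(-1) ^ n`. -/
def CommSign (g h : SL4) (n : ℕ) : Prop := g * h = sNeg ^ n * (h * g)

theorem CommSign.mul {g g' h : SL4} {n n' : ℕ} (H : CommSign g h n) (H' : CommSign g' h n') :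
    CommSign (g * g') h (n + n') := by
  unfold CommSign at *
  calc g * g' * h = g * (sNeg ^ n' * (h * g')) := by rw [mul_assoc, H']
    _ = sNeg ^ n' * (g * h) * g' := by
      rw [← mul_assoc g, ← sNeg_pow_mul]
      simp only [mul_assoc]
    _ = _ := by
      rw [H, add_comm, pow_add]
      simp only [mul_assoc]

theorem CommSign.one (h : SL4) : CommSign 1 h 0 := by
  simp [CommSign]

theorem CommSign.inv {g h : SL4} {n : ℕ} (H : CommSign g h n) : CommSign g⁻¹ h n := by
  unfold CommSign at *
  rw [inv_mul_eq_iff_eq_mul, ← mul_assoc, ← sNeg_pow_mul, mul_assoc, ← mul_assoc g, H,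
    ← mul_assoc, ← mul_assoc, sNeg_pow_two_mul, one_mul, mul_inv_cancel_right]

theorem CommSign.pow {g h : SL4} {n : ℕ} (H : CommSign g h n) (k : ℕ) :
    CommSign (g ^ k) h (k * n) := by
  induction k with
  | zero => simpa using CommSign.one h
  | succ k ih =>
    rw [pow_succ, Nat.succ_mul]
    exact ih.mul H

theorem CommSign.unique {g h : SL4} {m n : ℕ} (H : CommSign g h m) (H' : CommSign g h n)
    (hm : m < 2) (hn : n < 2) : m = n := by
  have h1 := mul_right_cancel (H.symm.trans H')
  interval_cases m <;> interval_cases n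
  · rfl
  · exact absurd (by simpa using h1.symm) sNeg_ne_one
  · exact absurd (by simpa using h1) sNeg_ne_one
  · rfl

theorem CommSign.mod {g h : SL4} {n : ℕ} (H : CommSign g h n) : CommSign g h (n % 2) := by
  unfold CommSign at *
  rw [H]
  congr 1
  have h2 : sNeg ^ 2 = 1 := by simpa [pow_two] using sNeg_pow_two_mul 1
  exact pow_eq_pow_mod n h2

/-- The elements of `SL(4, ℂ)` that commute up to sign with the generators of the Heisenberg
group. -/
def heisGroup : Subgroup SL4 where
  carrier := {g | ∀ j, ∃ n, CommSign g (heis j) n}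
  mul_mem' := fun hg hg' j => by
    obtain ⟨n, hn⟩ := hg j
    obtain ⟨n', hn'⟩ := hg' j
    exact ⟨_, hn.mul hn'⟩
  one_mem' := fun j => ⟨0, CommSign.one _⟩
  inv_mem' := fun hg j => by
    obtain ⟨n, hn⟩ := hg j
    exact ⟨n, hn.inv⟩

theorem heis_mem_heisGroup (k : Fin 4) : heis k ∈ heisGroup := fun j => ⟨_, heis_mul k j⟩

theorem sI_mem_heisGroup : sI ∈ heisGroup := fun j => ⟨0, by
  rw [CommSign, pow_zero, one_mul, sI_mul]⟩

/-- The word with prescribed commutation signs with the generators. -/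
noncomputable def heisWord (ε : Fin 4 → ℕ) : SL4 := t₂ ^ ε 0 * t₁ ^ ε 1 * d₂ ^ ε 2 * d₁ ^ ε 3

/-- Each letter anticommutes with exactly one generator, which explains the reversed order of the
letters relative to `heis`. -/
theorem commSign_heisWord (ε : Fin 4 → ℕ) (j : Fin 4) : CommSign (heisWord ε) (heis j) (ε j) := by
  have h := ((((show CommSign t₂ (heis j) _ from heis_mul 3 j).pow (ε 0)).mul
    ((show CommSign t₁ (heis j) _ from heis_mul 2 j).pow (ε 1))).mul
    ((show CommSign d₂ (heis j) _ from heis_mul 1 j).pow (ε 2))).mul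
    ((show CommSign d₁ (heis j) _ from heis_mul 0 j).pow (ε 3))
  unfold heisWord
  fin_cases j <;> simpa using h

/-- Dividing `g` by the word with the same commutation signs leaves an element that commutes with
all generators, hence a scalar. -/
theorem exists_eq_heisWord {g : SL4} (hg : g ∈ heisGroup) :
    ∃ (n : Fin 4) (ε : Fin 4 → Fin 2), g = sI ^ (n : ℕ) * heisWord fun j => ε j := by
  choose ε hε using hg
  let ε' : Fin 4 → Fin 2 := fun j => ⟨ε j % 2, Nat.mod_lt _ two_pos⟩
  obtain ⟨n, hn⟩ := eq_sI_pow_of_commute (g := (heisWord fun j => ε' j)⁻¹ * g) (fun j => by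
    have h := (commSign_heisWord (fun j => ε' j) j).inv.mul (hε j).mod
    have h' : CommSign ((heisWord fun j => ε' j)⁻¹ * g) (heis j) (ε j % 2 + ε j % 2) := h
    rw [CommSign, pow_add, sNeg_pow_two_mul, one_mul] at h'
    exact h')
  refine ⟨n, ε', ?_⟩
  rw [inv_mul_eq_iff_eq_mul] at hn
  rw [hn]
  exact ((show Commute sI _ from sI_mul _).pow_left _).symm

theorem I_pow_injective (m n : Fin 4) (h : Complex.I ^ (m : ℕ) = Complex.I ^ (n : ℕ)) : m = n := by
  fin_cases m <;> fin_cases n <;> simp [Complex.ext_iff, Complex.I_pow_three] at h ⊢ <;> norm_num at h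

/-- The signs determine the word, and the word determines the scalar, so there are `4 · 2 ^ 4`
elements. -/
theorem card_heisGroup : Nat.card heisGroup = 64 := by
  have hw (ε : Fin 4 → ℕ) : heisWord ε ∈ heisGroup := fun j => ⟨_, commSign_heisWord ε j⟩
  let e : Fin 4 × (Fin 4 → Fin 2) → heisGroup := fun x =>
    ⟨sI ^ (x.1 : ℕ) * heisWord fun j => x.2 j, mul_mem (pow_mem sI_mem_heisGroup _) (hw _)⟩
  have he : Function.Bijective e := by
    constructor
    · rintro ⟨n, ε⟩ ⟨n', ε'⟩ h
      have h1 : sI ^ (n : ℕ) * heisWord (fun j => ε j) = sI ^ (n' : ℕ) * heisWord fun j => ε' j :=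
        congrArg Subtype.val h
      have hs (n : ℕ) (j : Fin 4) (ε : Fin 4 → ℕ) :
          CommSign (sI ^ n * heisWord ε) (heis j) (ε j) := by
        have h2 : CommSign (sI ^ n) (heis j) 0 := by
          rw [CommSign, pow_zero, one_mul]
          exact (show Commute sI _ from sI_mul _).pow_left _
        simpa using h2.mul (commSign_heisWord ε j)
      have hε : ε = ε' := by
        funext j
        refine Fin.ext ((hs n j fun j => ε j).unique ?_ (ε j).2 (ε' j).2)
        rw [h1]
        exact hs n' j fun j => ε' j
      subst hε
      have h3 := congrArg (fun g : SL4 => g.1 0 0) (mul_right_cancel h1)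
      simp only [val_sI_pow] at h3
      simp only [Prod.mk.injEq, and_true]
      exact I_pow_injective _ _ (by simpa using h3)
    · rintro ⟨g, hg⟩
      obtain ⟨n, ε, rfl⟩ := exists_eq_heisWord hg
      exact ⟨(n, ε), rfl⟩
  rw [← Nat.card_congr (Equiv.ofBijective e he)]
  simp

theorem toMat_eq (v : Fin 4 → ℂ) : toMat v =
    !![v 0 + Complex.I * v 1, Complex.I * v 2 - v 3; Complex.I * v 2 + v 3, v 0 - Complex.I * v 1] := by
  have hK : (matI * matJ).1 = !![0, -1; 1, 0] := by
    change matI.1 * matJ.1 = _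
    simp [matI, matJ]
  rw [toMat, hK]
  ext i j
  fin_cases i <;> fin_cases j <;> simp [matI, matJ] <;> ring

theorem toMat_injective : Function.Injective toMat := by
  intro v v' h
  rw [toMat_eq, toMat_eq] at h
  have h00 := congrFun (congrFun h 0) 0
  have h01 := congrFun (congrFun h 0) 1
  have h10 := congrFun (congrFun h 1) 0
  have h11 := congrFun (congrFun h 1) 1
  simp only [of_apply, cons_val', cons_val_zero, cons_val_one, cons_val_fin_one] at h00 h01 h10 h11
  funext i
  fin_cases i <;> simp
  · linear_combination (h00 + h11) / 2
  · linear_combination (-Complex.I) * (h00 - h11) / 2 + (v 1 - v' 1) * Complex.I_sq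
  · linear_combination (-Complex.I) * (h01 + h10) / 2 + (v 2 - v' 2) * Complex.I_sq
  · linear_combination (h10 - h01) / 2

/-- This and the next three identities translate the multiplications by the generators of `Q8` into
words in `d₁, d₂, t₁, t₂`. -/
theorem toMat_left_I (v : Fin 4 → ℂ) : toMat ((t₁ * d₂).1 *ᵥ v) = matI.1 * toMat v := by
  rw [mul_mulVec, d₂_mulVec, t₁_mulVec, toMat_eq, toMat_eq]
  ext i j
  fin_cases i <;> fin_cases j <;> simp [matI, Matrix.mul_apply] <;> ring_nf <;> simp <;> ring

theorem toMat_left_J (v : Fin 4 → ℂ) : toMat ((t₂ * (d₁ * d₂)).1 *ᵥ v) = matJ.1 * toMat v := by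
  rw [mul_mulVec, mul_mulVec, d₂_mulVec, d₁_mulVec, t₂_mulVec, toMat_eq, toMat_eq]
  ext i j
  fin_cases i <;> fin_cases j <;> simp [matJ, Matrix.mul_apply] <;> ring_nf <;> simp <;> ring

theorem toMat_right_I (v : Fin 4 → ℂ) : toMat ((t₁ * (d₁ * d₂)).1 *ᵥ v) = toMat v * matI.1 := by
  rw [mul_mulVec, mul_mulVec, d₂_mulVec, d₁_mulVec, t₁_mulVec, toMat_eq, toMat_eq]
  ext i j
  fin_cases i <;> fin_cases j <;> simp [matI, Matrix.mul_apply] <;> ring_nf <;> simp <;> ring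

theorem toMat_right_J (v : Fin 4 → ℂ) : toMat ((t₂ * d₁).1 *ᵥ v) = toMat v * matJ.1 := by
  rw [mul_mulVec, d₁_mulVec, t₂_mulVec, toMat_eq, toMat_eq]
  ext i j
  fin_cases i <;> fin_cases j <;> simp [matJ, Matrix.mul_apply] <;> ring_nf <;> simp <;> ring

end IgusaQuotient
end HeisenbergGroup

/-! ### Identification of `N` with the Heisenberg group. -/

section HeisenbergGroupEq

namespace IgusaQuotient

open Matrix

abbrev SL2 := Matrix.SpecialLinearGroup (Fin 2) ℂ

theorem SL2_mul_inv (a : SL2) : a.1 * (a⁻¹).1 = 1 :=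
  congrArg Subtype.val (mul_inv_cancel a)

theorem SL2_inv_mul (a : SL2) : (a⁻¹).1 * a.1 = 1 :=
  congrArg Subtype.val (inv_mul_cancel a)

theorem matI_mem : matI ∈ Q8 := Subgroup.subset_closure (by simp)

theorem matJ_mem : matJ ∈ Q8 := Subgroup.subset_closure (by simp)

theorem d₁_mem_heisGroup : d₁ ∈ heisGroup := heis_mem_heisGroup 0
theorem d₂_mem_heisGroup : d₂ ∈ heisGroup := heis_mem_heisGroup 1
theorem t₁_mem_heisGroup : t₁ ∈ heisGroup := heis_mem_heisGroup 2
theorem t₂_mem_heisGroup : t₂ ∈ heisGroup := heis_mem_heisGroup 3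

theorem exists_left {a : SL2} (ha : a ∈ Q8) :
    ∃ g ∈ heisGroup, ∀ v, toMat (g.1 *ᵥ v) = a.1 * toMat v := by
  induction ha using Subgroup.closure_induction with
  | mem x hx =>
    rcases hx with rfl | rfl
    · exact ⟨_, mul_mem t₁_mem_heisGroup d₂_mem_heisGroup, toMat_left_I⟩
    · exact ⟨_, mul_mem t₂_mem_heisGroup (mul_mem d₁_mem_heisGroup d₂_mem_heisGroup), toMat_left_J⟩
  | one => exact ⟨1, one_mem _, fun v => by rw [one_mulVec']; exact (one_mul _).symm⟩
  | mul x y _ _ hx hy =>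
    obtain ⟨g, hg, h⟩ := hx
    obtain ⟨g', hg', h'⟩ := hy
    refine ⟨g * g', mul_mem hg hg', fun v => ?_⟩
    rw [mul_mulVec, h, h']
    exact (mul_assoc x.1 y.1 _).symm
  | inv x _ hx =>
    obtain ⟨g, hg, h⟩ := hx
    refine ⟨g⁻¹, inv_mem hg, fun v => ?_⟩
    have h1 := h ((g⁻¹).1 *ᵥ v)
    rw [← mul_mulVec, mul_inv_cancel, one_mulVec'] at h1
    rw [h1, ← mul_assoc, SL2_inv_mul, one_mul]

theorem exists_right {b : SL2} (hb : b ∈ Q8) :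
    ∃ g ∈ heisGroup, ∀ v, toMat (g.1 *ᵥ v) = toMat v * b.1 := by
  induction hb using Subgroup.closure_induction with
  | mem x hx =>
    rcases hx with rfl | rfl
    · exact ⟨_, mul_mem t₁_mem_heisGroup (mul_mem d₁_mem_heisGroup d₂_mem_heisGroup), toMat_right_I⟩
    · exact ⟨_, mul_mem t₂_mem_heisGroup d₁_mem_heisGroup, toMat_right_J⟩
  | one => exact ⟨1, one_mem _, fun v => by rw [one_mulVec']; exact (mul_one _).symm⟩
  | mul x y _ _ hx hy =>
    obtain ⟨g, hg, h⟩ := hx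
    obtain ⟨g', hg', h'⟩ := hy
    refine ⟨g' * g, mul_mem hg' hg, fun v => ?_⟩
    rw [mul_mulVec, h', h]
    exact mul_assoc _ x.1 y.1
  | inv x _ hx =>
    obtain ⟨g, hg, h⟩ := hx
    refine ⟨g⁻¹, inv_mem hg, fun v => ?_⟩
    have h1 := h ((g⁻¹).1 *ᵥ v)
    rw [← mul_mulVec, mul_inv_cancel, one_mulVec'] at h1
    rw [h1, mul_assoc, SL2_mul_inv, mul_one]

theorem N_le_heisGroup : N ≤ heisGroup := by
  refine (Subgroup.closure_le _).mpr ?_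
  rintro g (⟨a, ha, b, hb, h⟩ | h)
  · obtain ⟨l, hl, hl'⟩ := exists_left ha
    obtain ⟨r, hr, hr'⟩ := exists_right (inv_mem hb)
    have : g = l * r := SL4_ext fun v => toMat_injective (by
      rw [h, mul_mulVec, hl', hr', mul_assoc])
    rw [this]
    exact mul_mem hl hr
  · have : g = sI := Subtype.ext h
    rw [this]
    exact sI_mem_heisGroup

theorem mem_N_of_toMat {g : SL4} {a b : SL2} (ha : a ∈ Q8) (hb : b ∈ Q8)
    (h : ∀ v, toMat (g.1 *ᵥ v) * b.1 = a.1 * toMat v) : g ∈ N := by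
  refine Subgroup.subset_closure (Or.inl ⟨a, ha, b, hb, fun v => ?_⟩)
  rw [← h, mul_assoc, SL2_mul_inv, mul_one]

theorem sI_mem_N : sI ∈ N := Subgroup.subset_closure (Or.inr rfl)

/-- Conjugation by `I` fixes `E, I` and negates `J, K`. In the same way `d₂` is conjugation by `J`.
-/
theorem d₁_mem_N : d₁ ∈ N := by
  refine mem_N_of_toMat matI_mem matI_mem fun v => ?_
  rw [← toMat_right_I, ← toMat_left_I, mul_mulVec, mul_mulVec, mul_mulVec]
  congr 1
  simp [d₁_mulVec, d₂_mulVec, t₁_mulVec, -mulVec_mulVec]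

theorem d₂_mem_N : d₂ ∈ N := by
  refine mem_N_of_toMat matJ_mem matJ_mem fun v => ?_
  rw [← toMat_right_J, ← toMat_left_J, mul_mulVec, mul_mulVec, mul_mulVec]

theorem t₁_mem_N : t₁ ∈ N := by
  have h : t₁ * d₂ ∈ N := mem_N_of_toMat matI_mem (one_mem _) fun v => by
    rw [toMat_left_I]
    exact mul_one _
  exact (Subgroup.mul_mem_cancel_right N d₂_mem_N).mp h

theorem t₂_mem_N : t₂ ∈ N := by
  have h : t₂ * (d₁ * d₂) ∈ N := mem_N_of_toMat matJ_mem (one_mem _) fun v => by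
    rw [toMat_left_J]
    exact mul_one _
  exact (Subgroup.mul_mem_cancel_right N (mul_mem d₁_mem_N d₂_mem_N)).mp h

theorem heis_mem_N (j : Fin 4) : heis j ∈ N := by
  fin_cases j
  exacts [d₁_mem_N, d₂_mem_N, t₁_mem_N, t₂_mem_N]

theorem N_eq_heisGroup : N = heisGroup := by
  refine le_antisymm N_le_heisGroup fun g hg => ?_
  obtain ⟨n, ε, rfl⟩ := exists_eq_heisWord hg
  exact mul_mem (pow_mem sI_mem_N _) (mul_mem (mul_mem (mul_mem (pow_mem t₂_mem_N _)
    (pow_mem t₁_mem_N _)) (pow_mem d₂_mem_N _)) (pow_mem d₁_mem_N _))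

theorem card_N : Nat.card N = 64 := by
  rw [N_eq_heisGroup, card_heisGroup]

/-- A subgroup containing the standard generators contains `N`. -/
theorem N_induction {p : SL4 → Prop} (hs : p sI) (hh : ∀ j, p (heis j)) (h1 : p 1)
    (hm : ∀ g h, p g → p h → p (g * h)) {g : SL4} (hg : g ∈ N) : p g := by
  rw [N_eq_heisGroup] at hg
  obtain ⟨n, ε, rfl⟩ := exists_eq_heisWord hg
  have hp (g : SL4) (h : p g) (k : ℕ) : p (g ^ k) := by
    induction k with
    | zero => simpa using h1
    | succ k ih =>
      rw [pow_succ]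
      exact hm _ _ ih h
  exact hm _ _ (hp _ hs _) (hm _ _ (hm _ _ (hm _ _ (hp _ (hh 3) _) (hp _ (hh 2) _))
    (hp _ (hh 1) _)) (hp _ (hh 0) _))

theorem lin_apply (g : SL4) (v : Fin 4 → ℂ) : lin g v = g.1 *ᵥ v := rfl

end IgusaQuotient
end HeisenbergGroupEq

/-! ### A spanning set adapted to the group, and averaging. -/

section InvariantRing

namespace IgusaQuotient

open Matrix

theorem linSubst_X (g : SL4) (i : Fin 4) : linSubst (lin g) (X i) = ∑ j, C (g.1 i j) * X j := by
  simp only [linSubst, aeval_X]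
  refine Finset.sum_congr rfl fun j _ => ?_
  rw [lin_apply, mulVec_single_one]
  rfl

theorem linSubst_d₁ (i : Fin 4) : linSubst (lin d₁) (X i) = (![X 0, X 1, -X 2, -X 3] : Fin 4 → _) i := by
  rw [linSubst_X]
  fin_cases i <;> simp [Fin.sum_univ_four, d₁]

theorem linSubst_d₂ (i : Fin 4) : linSubst (lin d₂) (X i) = (![X 0, -X 1, X 2, -X 3] : Fin 4 → _) i := by
  rw [linSubst_X]
  fin_cases i <;> simp [Fin.sum_univ_four, d₂]

theorem linSubst_t₁ (i : Fin 4) : linSubst (lin t₁) (X i) = (![X 1, X 0, X 3, X 2] : Fin 4 → _) i := by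
  rw [linSubst_X]
  fin_cases i <;> simp [Fin.sum_univ_four, t₁]

theorem linSubst_t₂ (i : Fin 4) : linSubst (lin t₂) (X i) = (![X 2, X 3, X 0, X 1] : Fin 4 → _) i := by
  rw [linSubst_X]
  fin_cases i <;> simp [Fin.sum_univ_four, t₂]

theorem linSubst_sI (i : Fin 4) : linSubst (lin sI) (X i) = C Complex.I * X i := by
  rw [linSubst_X, val_sI]
  fin_cases i <;> simp [Fin.sum_univ_four, Matrix.one_apply]

theorem linSubst_mul (g h : SL4) (p : MvPolynomial (Fin 4) ℂ) :
    linSubst (lin (g * h)) p = linSubst (lin h) (linSubst (lin g) p) := by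
  apply MvPolynomial.funext
  intro v
  rw [eval_linSubst, eval_linSubst, eval_linSubst, lin_apply, lin_apply, lin_apply, mul_mulVec]

theorem linSubst_one (p : MvPolynomial (Fin 4) ℂ) : linSubst (lin 1) p = p := by
  apply MvPolynomial.funext
  intro v
  rw [eval_linSubst, lin_apply, one_mulVec']

theorem C_I_sq : (C Complex.I : MvPolynomial (Fin 4) ℂ) ^ 2 = -1 := by
  rw [← C_pow, Complex.I_sq, C_neg, C_1]

theorem linSubst_f {g : SL4} (hg : g ∈ N) : ∀ i, linSubst (lin g) (f i) = f i := by
  refine N_induction (p := fun g => ∀ i, linSubst (lin g) (f i) = f i) ?_ ?_ ?_ ?_ hg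
  · have h4 : (C Complex.I : MvPolynomial (Fin 4) ℂ) ^ 4 = 1 := by
      rw [← C_pow, Complex.I_pow_four, C_1]
    intro i
    fin_cases i <;> simp only [f, map_add, map_mul, map_pow, linSubst_sI, cons_val, Fin.isValue,
      Fin.reduceFinMk, Fin.zero_eta, Fin.mk_one]
    · linear_combination (X 0 ^ 2 * X 3 ^ 2 + X 1 ^ 2 * X 2 ^ 2) * h4
    · linear_combination (X 0 ^ 2 * X 2 ^ 2 + X 1 ^ 2 * X 3 ^ 2) * h4
    · linear_combination (X 0 ^ 2 * X 1 ^ 2 + X 2 ^ 2 * X 3 ^ 2) * h4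
    · linear_combination (X 0 ^ 4 + X 1 ^ 4 + X 2 ^ 4 + X 3 ^ 4) * h4
    · linear_combination (X 0 * X 1 * X 2 * X 3) * h4
  · intro j i
    fin_cases j <;> fin_cases i <;>
      simp only [f, heis, map_add, map_mul, map_pow, linSubst_d₁, linSubst_d₂, linSubst_t₁,
        linSubst_t₂, cons_val, Fin.isValue, Fin.reduceFinMk, Fin.zero_eta, Fin.mk_one] <;> ring
  · exact fun i => linSubst_one _
  · intro g h hg hh i
    rw [linSubst_mul, hg, hh]

theorem linSubst_of_mem_adjoin {g : SL4} (hg : g ∈ N) {p : MvPolynomial (Fin 4) ℂ}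
    (hp : p ∈ Algebra.adjoin ℂ (Set.range f)) : linSubst (lin g) p = p := by
  have h : Algebra.adjoin ℂ (Set.range f) ≤ AlgHom.equalizer (linSubst (lin g)) (AlgHom.id ℂ _) := by
    refine Algebra.adjoin_le ?_
    rintro _ ⟨i, rfl⟩
    exact linSubst_f hg i
  exact h hp

/-- The sums of squares of the variables that are diagonalised by the translations. -/
noncomputable def sq : Fin 4 → MvPolynomial (Fin 4) ℂ :=
  ![X 0 ^ 2 + X 1 ^ 2 + X 2 ^ 2 + X 3 ^ 2, X 0 ^ 2 + X 1 ^ 2 - X 2 ^ 2 - X 3 ^ 2,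
    X 0 ^ 2 - X 1 ^ 2 + X 2 ^ 2 - X 3 ^ 2, X 0 ^ 2 - X 1 ^ 2 - X 2 ^ 2 + X 3 ^ 2]

noncomputable def varMonomial (ε : Fin 4 → Fin 2) : MvPolynomial (Fin 4) ℂ :=
  ∏ i, X i ^ (ε i : ℕ)

noncomputable def sqMonomial (a : Fin 4 → ℕ) : MvPolynomial (Fin 4) ℂ :=
  ∏ i, sq i ^ a i

/-- The scalar `√-1` and the sign changes act on each of these by a constant. The translations do so
when the square-free part is `1` or the product of all four variables. -/
noncomputable def eigenMonomial (x : (Fin 4 → Fin 2) × (Fin 4 → ℕ)) : MvPolynomial (Fin 4) ℂ :=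
  varMonomial x.1 * sqMonomial x.2

theorem X_sq_eq (i : Fin 4) : ∃ c : Fin 4 → ℂ,
    (X i ^ 2 : MvPolynomial (Fin 4) ℂ) = ∑ j, C (c j) * sq j := by
  have h4 : (4 : MvPolynomial (Fin 4) ℂ) * C (1 / 4) = 1 := by
    rw [show (4 : MvPolynomial (Fin 4) ℂ) = C 4 from rfl, ← C_mul]
    norm_num
  fin_cases i
  · refine ⟨![1 / 4, 1 / 4, 1 / 4, 1 / 4], ?_⟩
    simp only [Fin.sum_univ_four, sq, cons_val, Fin.isValue, Fin.zero_eta]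
    linear_combination (-X 0 ^ 2) * h4
  · refine ⟨![1 / 4, 1 / 4, -(1 / 4), -(1 / 4)], ?_⟩
    simp only [Fin.sum_univ_four, sq, cons_val, Fin.isValue, Fin.mk_one, C_neg]
    linear_combination (-X 1 ^ 2) * h4
  · refine ⟨![1 / 4, -(1 / 4), 1 / 4, -(1 / 4)], ?_⟩
    simp only [Fin.sum_univ_four, sq, cons_val, Fin.isValue, Fin.reduceFinMk, C_neg]
    linear_combination (-X 2 ^ 2) * h4
  · refine ⟨![1 / 4, -(1 / 4), -(1 / 4), 1 / 4], ?_⟩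
    simp only [Fin.sum_univ_four, sq, cons_val, Fin.isValue, Fin.reduceFinMk, C_neg]
    linear_combination (-X 3 ^ 2) * h4

theorem X_mul_varMonomial_update (i : Fin 4) (ε : Fin 4 → Fin 2) :
    X i * varMonomial (Function.update ε i 0) = varMonomial (Function.update ε i 1) := by
  have hprod (k : Fin 2) : varMonomial (Function.update ε i k) =
      X i ^ (k : ℕ) * ∏ j ∈ Finset.univ.erase i, X j ^ (ε j : ℕ) := by
    rw [varMonomial, ← Finset.mul_prod_erase _ _ (Finset.mem_univ i), Function.update_self]
    congr 1
    refine Finset.prod_congr rfl fun j hj => ?_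
    rw [Function.update_of_ne (Finset.ne_of_mem_erase hj)]
  rw [hprod, hprod]
  simp

theorem sq_mul_sqMonomial (j : Fin 4) (a : Fin 4 → ℕ) :
    sq j * sqMonomial a = sqMonomial (a + Pi.single j 1) := by
  simp_rw [sqMonomial, Pi.add_apply, pow_add, Finset.prod_mul_distrib]
  rw [mul_comm]
  congr 1
  rw [Finset.prod_eq_single j]
  · simp
  · intro k _ hk
    simp [Pi.single_eq_of_ne hk]
  · simp

theorem X_mul_eigenMonomial (i : Fin 4) (x : (Fin 4 → Fin 2) × (Fin 4 → ℕ)) :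
    X i * eigenMonomial x ∈ Submodule.span ℂ (Set.range eigenMonomial) := by
  obtain ⟨ε, a⟩ := x
  obtain ⟨ε', k, rfl⟩ : ∃ ε' : Fin 4 → Fin 2, ∃ k, ε = Function.update ε' i k :=
    ⟨ε, ε i, (Function.update_eq_self i ε).symm⟩
  have hk : k = 0 ∨ k = 1 := by omega
  rcases hk with rfl | rfl
  · refine Submodule.subset_span ⟨(Function.update ε' i 1, a), ?_⟩
    rw [eigenMonomial, eigenMonomial, ← X_mul_varMonomial_update, mul_assoc]
  -- A square `X i ^ 2` is traded for the forms `sq j`, so the first factor stays square-free.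
  · obtain ⟨c, hc⟩ := X_sq_eq i
    have hsum : X i * eigenMonomial (Function.update ε' i 1, a) =
        ∑ j, c j • eigenMonomial (Function.update ε' i 0, a + Pi.single j 1) := by
      have h1 : X i * eigenMonomial (Function.update ε' i 1, a) =
          X i ^ 2 * (varMonomial (Function.update ε' i 0) * sqMonomial a) := by
        rw [eigenMonomial, ← X_mul_varMonomial_update]
        ring
      rw [h1, hc, Finset.sum_mul]
      refine Finset.sum_congr rfl fun j _ => ?_
      rw [eigenMonomial, ← sq_mul_sqMonomial, smul_eq_C_mul]
      ring
    rw [hsum]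
    exact Submodule.sum_mem _ fun j _ => Submodule.smul_mem _ _
      (Submodule.subset_span (Set.mem_range_self _))

theorem span_eigenMonomial : Submodule.span ℂ (Set.range eigenMonomial) = ⊤ := by
  rw [eq_top_iff]
  rintro p -
  induction p using MvPolynomial.induction_on with
  | C c =>
    have : C c = c • eigenMonomial (0, 0) := by
      simp [eigenMonomial, varMonomial, sqMonomial, smul_eq_C_mul]
    rw [this]
    exact Submodule.smul_mem _ _ (Submodule.subset_span (Set.mem_range_self _))
  | add p q hp hq => exact Submodule.add_mem _ hp hq
  | mul_X p i hp =>
    induction hp using Submodule.span_induction with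
    | mem x hx =>
      obtain ⟨x, rfl⟩ := hx
      rw [mul_comm]
      exact X_mul_eigenMonomial i x
    | zero =>
      rw [zero_mul]
      exact Submodule.zero_mem _
    | add x y _ _ hx hy =>
      rw [add_mul]
      exact Submodule.add_mem _ hx hy
    | smul c x _ hx =>
      rw [smul_mul_assoc]
      exact Submodule.smul_mem _ _ hx

/-- The sum over the group `N`. -/
noncomputable def reynolds : MvPolynomial (Fin 4) ℂ →ₗ[ℂ] MvPolynomial (Fin 4) ℂ :=
  ∑ᶠ g : N, (linSubst (lin g.1)).toLinearMap

instance finite_N : Finite N := Nat.finite_of_card_ne_zero (by rw [card_N]; norm_num)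

theorem reynolds_linSubst {g : SL4} (hg : g ∈ N) (p : MvPolynomial (Fin 4) ℂ) :
    reynolds (linSubst (lin g) p) = reynolds p := by
  have := Fintype.ofFinite N
  rw [reynolds, finsum_eq_sum_of_fintype, LinearMap.sum_apply, LinearMap.sum_apply]
  refine Fintype.sum_equiv (Equiv.mulLeft (⟨g, hg⟩ : N)) _ _ fun h => ?_
  exact (linSubst_mul g h.1 p).symm

theorem reynolds_of_invariant {p : MvPolynomial (Fin 4) ℂ}
    (hp : ∀ g ∈ N, linSubst (lin g) p = p) : reynolds p = (64 : ℂ) • p := by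
  have := Fintype.ofFinite N
  rw [reynolds, finsum_eq_sum_of_fintype, LinearMap.sum_apply,
    Finset.sum_congr rfl fun g _ => hp g.1 g.2, Finset.sum_const, Finset.card_univ,
    ← Nat.card_eq_fintype_card, card_N, ← Nat.cast_smul_eq_nsmul ℂ]
  norm_num

/-- The average is unchanged by `g` and also multiplied by `c ≠ 1`. -/
theorem reynolds_eq_zero {g : SL4} (hg : g ∈ N) {p : MvPolynomial (Fin 4) ℂ} {c : ℂ} (hc : c ≠ 1)
    (h : linSubst (lin g) p = c • p) : reynolds p = 0 := by
  have h1 := reynolds_linSubst hg p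
  rw [h, map_smul] at h1
  have h2 : (c - 1) • reynolds p = 0 := by rw [sub_smul, h1, one_smul, sub_self]
  exact (smul_eq_zero.mp h2).resolve_left (sub_ne_zero.mpr hc)

end IgusaQuotient
end InvariantRing

/-! ### Generators of the ring of invariants. -/

section InvariantRingGenerators

namespace IgusaQuotient

open Matrix

theorem map_prod_pow_eq {R : Type*} [CommRing R] [Algebra ℂ R] (φ : R →ₐ[ℂ] R) (y : Fin 4 → R)
    (β : Fin 4 → ℂ) (h : ∀ i, φ (y i) = β i • y i) (a : Fin 4 → ℕ) :
    φ (∏ i, y i ^ a i) = (β 0 ^ a 0 * β 1 ^ a 1 * β 2 ^ a 2 * β 3 ^ a 3) • ∏ i, y i ^ a i := by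
  rw [map_prod]
  simp_rw [map_pow, h, Fin.prod_univ_four, smul_pow, smul_mul_smul_comm]

theorem linSubst_eigenMonomial_of_eigen {g : SL4} {x : (Fin 4 → Fin 2) × (Fin 4 → ℕ)} {c d : ℂ}
    (h : linSubst (lin g) (varMonomial x.1) = c • varMonomial x.1)
    (h' : linSubst (lin g) (sqMonomial x.2) = d • sqMonomial x.2) :
    linSubst (lin g) (eigenMonomial x) = (c * d) • eigenMonomial x := by
  rw [eigenMonomial, map_mul, h, h', smul_mul_smul_comm]

theorem linSubst_d₁_X (i : Fin 4) :
    linSubst (lin d₁) (X i) = (![1, 1, -1, -1] : Fin 4 → ℂ) i • (X i : MvPolynomial (Fin 4) ℂ) := by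
  rw [linSubst_d₁]
  fin_cases i <;> simp

theorem linSubst_d₁_sq (i : Fin 4) :
    linSubst (lin d₁) (sq i) = (![1, 1, 1, 1] : Fin 4 → ℂ) i • sq i := by
  fin_cases i <;> simp only [sq, map_add, map_sub, map_pow, linSubst_d₁, cons_val, Fin.isValue,
      Fin.reduceFinMk, Fin.zero_eta, Fin.mk_one, one_smul] <;> ring

theorem linSubst_d₂_X (i : Fin 4) :
    linSubst (lin d₂) (X i) = (![1, -1, 1, -1] : Fin 4 → ℂ) i • (X i : MvPolynomial (Fin 4) ℂ) := by
  rw [linSubst_d₂]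
  fin_cases i <;> simp

theorem linSubst_d₂_sq (i : Fin 4) :
    linSubst (lin d₂) (sq i) = (![1, 1, 1, 1] : Fin 4 → ℂ) i • sq i := by
  fin_cases i <;> simp only [sq, map_add, map_sub, map_pow, linSubst_d₂, cons_val, Fin.isValue,
      Fin.reduceFinMk, Fin.zero_eta, Fin.mk_one, one_smul] <;> ring

theorem linSubst_sI_X (i : Fin 4) :
    linSubst (lin sI) (X i) = Complex.I • (X i : MvPolynomial (Fin 4) ℂ) := by
  rw [linSubst_sI, smul_eq_C_mul]

theorem linSubst_sI_sq (i : Fin 4) : linSubst (lin sI) (sq i) = (-1 : ℂ) • sq i := by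
  rw [neg_one_smul]
  fin_cases i <;> simp only [sq, map_add, map_sub, map_pow, linSubst_sI, cons_val, Fin.isValue,
      Fin.reduceFinMk, Fin.zero_eta, Fin.mk_one, mul_pow, C_I_sq] <;> ring

theorem linSubst_t₁_sq (i : Fin 4) :
    linSubst (lin t₁) (sq i) = (![1, 1, -1, -1] : Fin 4 → ℂ) i • sq i := by
  fin_cases i <;> simp only [sq, map_add, map_sub, map_pow, linSubst_t₁, cons_val, Fin.isValue,
      Fin.reduceFinMk, Fin.zero_eta, Fin.mk_one, one_smul, neg_one_smul] <;> ring

theorem linSubst_t₂_sq (i : Fin 4) :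
    linSubst (lin t₂) (sq i) = (![1, -1, 1, -1] : Fin 4 → ℂ) i • sq i := by
  fin_cases i <;> simp only [sq, map_add, map_sub, map_pow, linSubst_t₂, cons_val, Fin.isValue,
      Fin.reduceFinMk, Fin.zero_eta, Fin.mk_one, one_smul, neg_one_smul] <;> ring

theorem linSubst_t₁_varMonomial (k : Fin 2) :
    linSubst (lin t₁) (varMonomial fun _ => k) = (1 : ℂ) • varMonomial fun _ => k := by
  rw [one_smul, varMonomial, Finset.prod_pow, map_pow]
  congr 1
  simp only [Fin.prod_univ_four, map_mul, linSubst_t₁, cons_val]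
  ring

theorem linSubst_t₂_varMonomial (k : Fin 2) :
    linSubst (lin t₂) (varMonomial fun _ => k) = (1 : ℂ) • varMonomial fun _ => k := by
  rw [one_smul, varMonomial, Finset.prod_pow, map_pow]
  congr 1
  simp only [Fin.prod_univ_four, map_mul, linSubst_t₂, cons_val]
  ring

theorem linSubst_d₁_eigenMonomial (x : (Fin 4 → Fin 2) × (Fin 4 → ℕ)) :
    linSubst (lin d₁) (eigenMonomial x) = ((-1 : ℂ) ^ (x.1 2 + x.1 3 : ℕ)) • eigenMonomial x := by
  have h := linSubst_eigenMonomial_of_eigen (x := x) (map_prod_pow_eq _ _ _ linSubst_d₁_X fun i => x.1 i)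
    (map_prod_pow_eq _ _ _ linSubst_d₁_sq x.2)
  rw [h]
  congr 1
  simp [pow_add]

theorem linSubst_d₂_eigenMonomial (x : (Fin 4 → Fin 2) × (Fin 4 → ℕ)) :
    linSubst (lin d₂) (eigenMonomial x) = ((-1 : ℂ) ^ (x.1 1 + x.1 3 : ℕ)) • eigenMonomial x := by
  have h := linSubst_eigenMonomial_of_eigen (x := x) (map_prod_pow_eq _ _ _ linSubst_d₂_X fun i => x.1 i)
    (map_prod_pow_eq _ _ _ linSubst_d₂_sq x.2)
  rw [h]
  congr 1
  simp [pow_add]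

theorem linSubst_sI_eigenMonomial (x : (Fin 4 → Fin 2) × (Fin 4 → ℕ)) :
    linSubst (lin sI) (eigenMonomial x) = (Complex.I ^ (x.1 0 + x.1 1 + x.1 2 + x.1 3 +
      2 * (x.2 0 + x.2 1 + x.2 2 + x.2 3) : ℕ)) • eigenMonomial x := by
  have h := linSubst_eigenMonomial_of_eigen (x := x) (map_prod_pow_eq _ _ _ linSubst_sI_X fun i => x.1 i)
    (map_prod_pow_eq _ _ _ linSubst_sI_sq x.2)
  rw [h]
  congr 1
  simp only [pow_add, pow_mul, Complex.I_sq]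

theorem linSubst_t₁_eigenMonomial (k : Fin 2) (a : Fin 4 → ℕ) :
    linSubst (lin t₁) (eigenMonomial (fun _ => k, a)) = ((-1 : ℂ) ^ (a 2 + a 3)) • eigenMonomial (fun _ => k, a) := by
  have h := linSubst_eigenMonomial_of_eigen (x := (fun _ => k, a)) (linSubst_t₁_varMonomial k)
    (map_prod_pow_eq _ _ _ linSubst_t₁_sq a)
  rw [h]
  congr 1
  simp [pow_add]

theorem linSubst_t₂_eigenMonomial (k : Fin 2) (a : Fin 4 → ℕ) :
    linSubst (lin t₂) (eigenMonomial (fun _ => k, a)) = ((-1 : ℂ) ^ (a 1 + a 3)) • eigenMonomial (fun _ => k, a) := by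
  have h := linSubst_eigenMonomial_of_eigen (x := (fun _ => k, a)) (linSubst_t₂_varMonomial k)
    (map_prod_pow_eq _ _ _ linSubst_t₂_sq a)
  rw [h]
  congr 1
  simp [pow_add]

theorem f_mem_adjoin (i : Fin 5) : f i ∈ Algebra.adjoin ℂ (Set.range f) :=
  Algebra.subset_adjoin (Set.mem_range_self i)

theorem sq_sq_mem_adjoin (i : Fin 4) : sq i ^ 2 ∈ Algebra.adjoin ℂ (Set.range f) := by
  have h0 : sq 0 ^ 2 = f 3 + (2 : ℂ) • f 0 + (2 : ℂ) • f 1 + (2 : ℂ) • f 2 := by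
    simp only [sq, f, smul_eq_C_mul, cons_val, Fin.isValue, map_ofNat]; ring
  have h1 : sq 1 ^ 2 = f 3 - (2 : ℂ) • f 0 - (2 : ℂ) • f 1 + (2 : ℂ) • f 2 := by
    simp only [sq, f, smul_eq_C_mul, cons_val, Fin.isValue, map_ofNat]; ring
  have h2 : sq 2 ^ 2 = f 3 - (2 : ℂ) • f 0 + (2 : ℂ) • f 1 - (2 : ℂ) • f 2 := by
    simp only [sq, f, smul_eq_C_mul, cons_val, Fin.isValue, map_ofNat]; ring
  have h3 : sq 3 ^ 2 = f 3 + (2 : ℂ) • f 0 - (2 : ℂ) • f 1 - (2 : ℂ) • f 2 := by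
    simp only [sq, f, smul_eq_C_mul, cons_val, Fin.isValue, map_ofNat]; ring
  have hm (i : Fin 5) : (2 : ℂ) • f i ∈ Algebra.adjoin ℂ (Set.range f) :=
    Subalgebra.smul_mem _ (f_mem_adjoin i) _
  fin_cases i
  · exact h0 ▸ add_mem (add_mem (add_mem (f_mem_adjoin _) (hm _)) (hm _)) (hm _)
  · exact h1 ▸ add_mem (sub_mem (sub_mem (f_mem_adjoin _) (hm _)) (hm _)) (hm _)
  · exact h2 ▸ sub_mem (add_mem (sub_mem (f_mem_adjoin _) (hm _)) (hm _)) (hm _)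
  · exact h3 ▸ sub_mem (sub_mem (add_mem (f_mem_adjoin _) (hm _)) (hm _)) (hm _)

theorem sq_prod_mem_adjoin : sq 0 * sq 1 * sq 2 * sq 3 ∈ Algebra.adjoin ℂ (Set.range f) := by
  have h : sq 0 * sq 1 * sq 2 * sq 3 =
      f 3 ^ 2 - (4 : ℂ) • (f 0 ^ 2 + f 1 ^ 2 + f 2 ^ 2) + (32 : ℂ) • f 4 ^ 2 := by
    simp only [sq, f, smul_eq_C_mul, cons_val, Fin.isValue, map_ofNat]; ring
  have hp (i : Fin 5) : f i ^ 2 ∈ Algebra.adjoin ℂ (Set.range f) := pow_mem (f_mem_adjoin i) 2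
  rw [h]
  exact add_mem (sub_mem (hp _) (Subalgebra.smul_mem _ (add_mem (add_mem (hp _) (hp _)) (hp _)) _))
    (Subalgebra.smul_mem _ (hp _) _)

/-- When all exponents of the `sq i` have the parity of `r`, the product is `∏ sq i` to the power
`r` times squares of the `sq i`; both kinds of factor are polynomials in the `f i`. -/
theorem eigenMonomial_mem_adjoin (k : Fin 2) (a b : Fin 4 → ℕ) (r : ℕ) (h : ∀ i, a i = r + 2 * b i) :
    eigenMonomial (fun _ => k, a) ∈ Algebra.adjoin ℂ (Set.range f) := by
  have h4 : varMonomial (fun _ => k) = f 4 ^ (k : ℕ) := by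
    rw [varMonomial, Finset.prod_pow, Fin.prod_univ_four]
    rfl
  have h5 : sqMonomial a = (∏ i, sq i) ^ r * ∏ i, (sq i ^ 2) ^ b i := by
    rw [sqMonomial, ← Finset.prod_pow, ← Finset.prod_mul_distrib]
    simp_rw [h, pow_add, pow_mul]
  have h1 : eigenMonomial (fun _ => k, a) = f 4 ^ (k : ℕ) * ((sq 0 * sq 1 * sq 2 * sq 3) ^ r *
      ∏ i, (sq i ^ 2) ^ b i) := by
    rw [eigenMonomial, h4, h5, Fin.prod_univ_four]
  rw [h1]
  have hs := sq_sq_mem_adjoin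
  exact mul_mem (pow_mem (f_mem_adjoin _) _) (mul_mem (pow_mem sq_prod_mem_adjoin _)
    (prod_mem fun i _ => pow_mem (hs i) _))

theorem neg_one_pow_ne_one {n : ℕ} (hn : ¬ Even n) : (-1 : ℂ) ^ n ≠ 1 := by
  rw [(Nat.not_even_iff_odd.mp hn).neg_one_pow]
  norm_num

theorem reynolds_eigenMonomial (x : (Fin 4 → Fin 2) × (Fin 4 → ℕ)) :
    reynolds (eigenMonomial x) ∈ Algebra.adjoin ℂ (Set.range f) := by
  have hz {p : MvPolynomial (Fin 4) ℂ} (hp : p = 0) : p ∈ Algebra.adjoin ℂ (Set.range f) :=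
    hp ▸ zero_mem _
  by_cases h1 : Even (x.1 2 + x.1 3 : ℕ)
  swap
  · exact hz (reynolds_eq_zero d₁_mem_N (neg_one_pow_ne_one h1) (linSubst_d₁_eigenMonomial x))
  by_cases h2 : Even (x.1 1 + x.1 3 : ℕ)
  swap
  · exact hz (reynolds_eq_zero d₂_mem_N (neg_one_pow_ne_one h2) (linSubst_d₂_eigenMonomial x))
  by_cases h3 : 4 ∣ (x.1 0 + x.1 1 + x.1 2 + x.1 3 +
      2 * (x.2 0 + x.2 1 + x.2 2 + x.2 3) : ℕ)
  swap
  · refine hz (reynolds_eq_zero sI_mem_N ?_ (linSubst_sI_eigenMonomial x))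
    intro h
    rw [Complex.I_pow_eq_pow_mod] at h
    have h4 := I_pow_injective ⟨_, Nat.mod_lt _ (by norm_num)⟩ 0 (by simpa using h)
    exact h3 (Nat.dvd_of_mod_eq_zero (congrArg Fin.val h4))
  rw [Nat.even_iff] at h1 h2
  -- The sign changes equate the last three exponents. Divisibility by four makes the sum of all
  -- four exponents even, which brings in the first.
  have hc : x.1 = fun _ => x.1 0 := by
    have e1 := (x.1 0).2
    have e2 := (x.1 1).2
    have e3 := (x.1 2).2
    have e4 := (x.1 3).2
    funext i
    apply Fin.ext
    fin_cases i <;> simp <;> omega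
  obtain ⟨ε, a⟩ := x
  dsimp only at *
  generalize ε 0 = k at *
  subst hc
  by_cases h4 : Even (a 2 + a 3)
  swap
  · exact hz (reynolds_eq_zero t₁_mem_N (neg_one_pow_ne_one h4) (linSubst_t₁_eigenMonomial k a))
  by_cases h5 : Even (a 1 + a 3)
  swap
  · exact hz (reynolds_eq_zero t₂_mem_N (neg_one_pow_ne_one h5) (linSubst_t₂_eigenMonomial k a))
  rw [Nat.even_iff] at h4 h5
  -- With a constant square-free part, the scalar `√-1` forces the sum of the exponents of the `sq
  -- i` to be even. Together with the two conditions from the translations, all four exponents have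
  -- the same parity.
  have hmem : eigenMonomial (fun _ => k, a) ∈ Algebra.adjoin ℂ (Set.range f) := by
    refine eigenMonomial_mem_adjoin k a (fun i => a i / 2) (a 0 % 2) fun i => ?_
    fin_cases i <;> simp <;> omega
  rw [reynolds_of_invariant fun g hg => linSubst_of_mem_adjoin hg hmem]
  exact Subalgebra.smul_mem _ hmem _

theorem invariant_iff (p : MvPolynomial (Fin 4) ℂ) :
    (∀ g ∈ N, linSubst (lin g) p = p) ↔ p ∈ Algebra.adjoin ℂ (Set.range f) := by
  refine ⟨fun hp => ?_, fun hp g hg => linSubst_of_mem_adjoin hg hp⟩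
  have h : ∀ p, reynolds p ∈ Algebra.adjoin ℂ (Set.range f) := by
    intro p
    have hp : p ∈ Submodule.span ℂ (Set.range eigenMonomial) := span_eigenMonomial ▸ Submodule.mem_top
    induction hp using Submodule.span_induction with
    | mem x hx =>
      obtain ⟨x, rfl⟩ := hx
      exact reynolds_eigenMonomial x
    | zero => exact (map_zero reynolds).symm ▸ zero_mem _
    | add x y _ _ hx hy => exact (map_add reynolds x y).symm ▸ add_mem hx hy
    | smul c x _ hx => exact (map_smul reynolds c x).symm ▸ Subalgebra.smul_mem _ hx _
  have h1 := h p
  rw [reynolds_of_invariant hp] at h1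
  have h2 := Subalgebra.smul_mem _ h1 (1 / 64 : ℂ)
  rwa [smul_smul, show (1 / 64 : ℂ) * 64 = 1 by norm_num, one_smul] at h2

end IgusaQuotient
end InvariantRingGenerators

/-! ### The ideal of relations. -/

section RelationIdeal

namespace IgusaQuotient

open Matrix

theorem aeval_f_relation : aeval (R := ℂ) f relation = 0 := by
  simp only [relation, map_sub, map_mul, map_add, map_pow, aeval_X, map_ofNat, f, cons_val]
  ring

/-- Remainders of the division by `relation` with respect to the last variable. -/
theorem exists_eq_mul_relation_add (p : MvPolynomial (Fin 5) ℂ) :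
    ∃ (q : MvPolynomial (Fin 5) ℂ) (r : Fin 4 → MvPolynomial (Fin 4) ℂ),
      p = q * relation + ∑ i, rename Fin.castSucc (r i) * X 4 ^ (i : ℕ) := by
  induction p using MvPolynomial.induction_on with
  | C c => exact ⟨0, ![C c, 0, 0, 0], by simp [Fin.sum_univ_four]⟩
  | add p p' hp hp' =>
    obtain ⟨q, r, h⟩ := hp
    obtain ⟨q', r', h'⟩ := hp'
    refine ⟨q + q', r + r', ?_⟩
    conv_lhs => rw [h, h']
    simp only [Fin.sum_univ_four, Pi.add_apply, map_add]
    ring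
  | mul_X p j hp =>
    obtain ⟨q, r, h⟩ := hp
    induction j using Fin.lastCases with
    | cast j =>
      refine ⟨q * X j.castSucc, fun i => r i * X j, ?_⟩
      conv_lhs => rw [h]
      simp only [Fin.sum_univ_four, map_mul, rename_X]
      ring
    | last =>
      -- The relation is `a + b X₄² - 16 X₄⁴`. Its leading coefficient in `X 4` is a unit, so `X₄⁴`
      -- can be eliminated.
      let a : MvPolynomial (Fin 4) ℂ := (X 3 + 2 * X 0 + 2 * X 1 + 2 * X 2) * (X 0 * X 1 * X 2) -
        (X 0 * X 1 + X 1 * X 2 + X 2 * X 0) ^ 2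
      let b : MvPolynomial (Fin 4) ℂ :=
        (X 3 + 2 * X 0 + 2 * X 1 + 2 * X 2) * (2 * (X 0 + X 1 + X 2) - X 3) -
          8 * (X 0 * X 1 + X 1 * X 2 + X 2 * X 0)
      have hrel : relation = rename Fin.castSucc a + rename Fin.castSucc b * X 4 ^ 2 -
          16 * X 4 ^ 4 := by
        simp only [a, b, relation, map_sub, map_mul, map_add, map_pow, rename_X, map_ofNat]
        simp only [Fin.castSucc_zero, Fin.castSucc_one, Fin.reduceCastSucc]
        ring
      have h16 : (16 : MvPolynomial (Fin 5) ℂ) * C (1 / 16) = 1 := by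
        rw [show (16 : MvPolynomial (Fin 5) ℂ) = C 16 from rfl, ← C_mul]
        norm_num
      refine ⟨q * X 4 - C (1 / 16) * rename Fin.castSucc (r 3),
        ![C (1 / 16) * (r 3 * a), r 0, r 1 + C (1 / 16) * (r 3 * b), r 2], ?_⟩
      conv_lhs => rw [h]
      simp only [Fin.sum_univ_four, cons_val, map_mul, map_add, rename_C, Fin.coe_ofNat_eq_mod,
        Nat.reduceMod, pow_zero, pow_one, Fin.reduceLast]
      rw [hrel]
      linear_combination (-rename Fin.castSucc (r 3) * X 4 ^ 4) * h16

/-- The squares of the coordinates of a point, in terms of the diagonalising coordinates. -/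
def hadamard (s : Fin 4 → ℂ) : Fin 4 → ℂ :=
  ![s 0 + s 1 + s 2 + s 3, s 0 + s 1 - s 2 - s 3, s 0 - s 1 + s 2 - s 3, s 0 - s 1 - s 2 + s 3]

/-- The values of `f₁, …, f₄` in terms of the diagonalising coordinates. -/
def quadValues (s : Fin 4 → ℂ) : Fin 4 → ℂ :=
  ![2 * (s 0 ^ 2 - s 1 ^ 2 - s 2 ^ 2 + s 3 ^ 2), 2 * (s 0 ^ 2 - s 1 ^ 2 + s 2 ^ 2 - s 3 ^ 2),
    2 * (s 0 ^ 2 + s 1 ^ 2 - s 2 ^ 2 - s 3 ^ 2), 4 * (s 0 ^ 2 + s 1 ^ 2 + s 2 ^ 2 + s 3 ^ 2)]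

/-- Square roots of the four values of `hadamard s` have product `± y`, and changing the sign of one
of them corrects the sign of the product. -/
theorem exists_eval_f_eq (s : Fin 4 → ℂ) (y : ℂ)
    (hy : y ^ 2 = hadamard s 0 * hadamard s 1 * hadamard s 2 * hadamard s 3) :
    ∃ v, (∀ i : Fin 4, eval v (f i.castSucc) = quadValues s i) ∧ eval v (f 4) = y := by
  obtain ⟨x, hx⟩ : ∃ x : Fin 4 → ℂ, ∀ i, x i ^ 2 = hadamard s i := by
    choose x hx using fun i => IsAlgClosed.exists_pow_nat_eq (hadamard s i) two_pos
    exact ⟨x, hx⟩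
  obtain ⟨x, hx, hxy⟩ : ∃ x : Fin 4 → ℂ, (∀ i, x i ^ 2 = hadamard s i) ∧
      x 0 * x 1 * x 2 * x 3 = y := by
    have h : (x 0 * x 1 * x 2 * x 3) ^ 2 = y ^ 2 := by
      rw [hy, ← hx, ← hx, ← hx, ← hx]
      ring
    rcases sq_eq_sq_iff_eq_or_eq_neg.mp h with h | h
    · exact ⟨x, hx, h⟩
    · refine ⟨![-x 0, x 1, x 2, x 3], fun i => ?_, ?_⟩
      · fin_cases i <;> simp [← hx]
      · simp only [cons_val]
        linear_combination -h
  have h0 : x 0 ^ 2 = _ := hx 0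
  have h1 : x 1 ^ 2 = _ := hx 1
  have h2 : x 2 ^ 2 = _ := hx 2
  have h3 : x 3 ^ 2 = _ := hx 3
  have e (i : Fin 4) : x i ^ 4 = (x i ^ 2) ^ 2 := by ring
  refine ⟨x, fun i => ?_, ?_⟩
  · fin_cases i <;>
      simp only [f, map_add, map_mul, map_pow, eval_X, cons_val, Fin.isValue, Fin.reduceFinMk,
        Fin.zero_eta, Fin.mk_one, Fin.castSucc_zero, Fin.castSucc_one, Fin.reduceCastSucc,
        quadValues, e, h0, h1, h2, h3, hadamard] <;> ring
  · simpa [f] using hxy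

/-- A cubic polynomial with the roots `± y`, `± y'` vanishes. -/
theorem cubic_coeff_eq_zero {r₀ r₁ r₂ r₃ y y' : ℂ} (hy : y ≠ 0) (hy' : y' ≠ 0) (h : y ^ 2 ≠ y' ^ 2)
    (H : ∀ z, z ^ 2 = y ^ 2 ∨ z ^ 2 = y' ^ 2 → r₀ + r₁ * z + r₂ * z ^ 2 + r₃ * z ^ 3 = 0) :
    r₀ = 0 ∧ r₁ = 0 ∧ r₂ = 0 ∧ r₃ = 0 := by
  have a1 := H y (Or.inl rfl)
  have a2 := H (-y) (Or.inl (by ring))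
  have a3 := H y' (Or.inr rfl)
  have a4 := H (-y') (Or.inr (by ring))
  have b1 : r₀ + r₂ * y ^ 2 = 0 := by linear_combination (a1 + a2) / 2
  have b2 : r₀ + r₂ * y' ^ 2 = 0 := by linear_combination (a3 + a4) / 2
  have b3 : r₁ + r₃ * y ^ 2 = 0 := by
    refine (mul_eq_zero.mp (?_ : y * _ = 0)).resolve_left hy
    linear_combination (a1 - a2) / 2
  have b4 : r₁ + r₃ * y' ^ 2 = 0 := by
    refine (mul_eq_zero.mp (?_ : y' * _ = 0)).resolve_left hy'
    linear_combination (a3 - a4) / 2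
  have c2 : r₂ = 0 := by
    refine (mul_eq_zero.mp (?_ : (y ^ 2 - y' ^ 2) * _ = 0)).resolve_left (sub_ne_zero.mpr h)
    linear_combination b1 - b2
  have c3 : r₃ = 0 := by
    refine (mul_eq_zero.mp (?_ : (y ^ 2 - y' ^ 2) * _ = 0)).resolve_left (sub_ne_zero.mpr h)
    linear_combination b3 - b4
  subst c2 c3
  exact ⟨by simpa using b1, by simpa using b3, rfl, rfl⟩

theorem eval_aeval_f (v : Fin 4 → ℂ) (p : MvPolynomial (Fin 5) ℂ) :
    eval v (aeval (R := ℂ) f p) = eval (fun i => eval v (f i)) p := by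
  rw [← coe_aeval_eq_eval, ← coe_aeval_eq_eval]
  simp only [RingHom.coe_coe]
  rw [← AlgHom.comp_apply, comp_aeval]

theorem exists_quadValues_eq (t : Fin 4 → ℂ) : ∃ s, quadValues s = t := by
  -- These combinations express `(sq i)²` through `f₁, …, f₄`; here `sq i` takes the value `4 s i`,
  -- whence the division by `16`.
  choose s hs using fun i : Fin 4 => IsAlgClosed.exists_pow_nat_eq
    ((![t 3 + 2 * t 0 + 2 * t 1 + 2 * t 2, t 3 - 2 * t 0 - 2 * t 1 + 2 * t 2,
      t 3 - 2 * t 0 + 2 * t 1 - 2 * t 2, t 3 + 2 * t 0 - 2 * t 1 - 2 * t 2] : Fin 4 → ℂ) i / 16)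
    two_pos
  refine ⟨s, ?_⟩
  funext i
  fin_cases i <;> simp only [quadValues, hs, cons_val, Fin.isValue, Fin.reduceFinMk, Fin.zero_eta,
    Fin.mk_one] <;> ring

/-- A polynomial vanishing at the values of `f₁, …, f₄` over a nonempty open set is zero. -/
theorem eq_zero_of_eval_quadValues {r D : MvPolynomial (Fin 4) ℂ} (hD : D ≠ 0)
    (h : ∀ s, eval s D ≠ 0 → eval (quadValues s) r = 0) : r = 0 := by
  let Q : Fin 4 → MvPolynomial (Fin 4) ℂ :=
    ![2 * (X 0 ^ 2 - X 1 ^ 2 - X 2 ^ 2 + X 3 ^ 2), 2 * (X 0 ^ 2 - X 1 ^ 2 + X 2 ^ 2 - X 3 ^ 2),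
      2 * (X 0 ^ 2 + X 1 ^ 2 - X 2 ^ 2 - X 3 ^ 2), 4 * (X 0 ^ 2 + X 1 ^ 2 + X 2 ^ 2 + X 3 ^ 2)]
  have hQ (s : Fin 4 → ℂ) : (fun i => eval s (Q i)) = quadValues s := by
    funext i
    fin_cases i <;> simp [Q, quadValues]
  have heval (s : Fin 4 → ℂ) : eval s (aeval (R := ℂ) Q r) = eval (quadValues s) r := by
    rw [← hQ, ← coe_aeval_eq_eval, ← coe_aeval_eq_eval]
    simp only [RingHom.coe_coe]
    rw [← AlgHom.comp_apply, comp_aeval]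
  have hzero : D * aeval (R := ℂ) Q r = 0 := by
    apply MvPolynomial.funext
    intro s
    rw [map_mul, heval, map_zero]
    by_cases hs : eval s D = 0
    · rw [hs, zero_mul]
    · rw [h s hs, mul_zero]
  have hQr := (mul_eq_zero.mp hzero).resolve_left hD
  apply MvPolynomial.funext
  intro t
  obtain ⟨s, rfl⟩ := exists_quadValues_eq t
  rw [← heval, hQr, map_zero, map_zero]

/-- For general `s` the values of `f₁, …, f₄` do not see the sign of `s 0`, but `f₅²` does. So `f₅`
takes four distinct values over the same `f₁, …, f₄`, too many for a nonzero cubic. -/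
theorem remainder_eq_zero {r : Fin 4 → MvPolynomial (Fin 4) ℂ}
    (h : aeval (R := ℂ) f (∑ i, rename Fin.castSucc (r i) * X 4 ^ (i : ℕ)) = 0) : r = 0 := by
  have key (s : Fin 4 → ℂ) (y : ℂ)
      (hy : y ^ 2 = hadamard s 0 * hadamard s 1 * hadamard s 2 * hadamard s 3) :
      eval (quadValues s) (r 0) + eval (quadValues s) (r 1) * y +
        eval (quadValues s) (r 2) * y ^ 2 + eval (quadValues s) (r 3) * y ^ 3 = 0 := by
    obtain ⟨v, hv, hv4⟩ := exists_eval_f_eq s y hy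
    have h1 := congrArg (eval v) h
    rw [eval_aeval_f, map_zero, map_sum, Fin.sum_univ_four] at h1
    have hq : (fun i => eval v (f i)) ∘ Fin.castSucc = quadValues s := funext hv
    simp only [map_mul, map_pow, eval_rename, hq, eval_X, hv4] at h1
    simpa using h1
  -- The three groups of factors make `y² ≠ y'²`, `y ≠ 0` and `y' ≠ 0` respectively.
  let D : MvPolynomial (Fin 4) ℂ := X 0 * X 1 * X 2 * X 3 *
    ((X 0 + X 1 + X 2 + X 3) * (X 0 + X 1 - X 2 - X 3) * (X 0 - X 1 + X 2 - X 3) *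
      (X 0 - X 1 - X 2 + X 3)) *
    ((-X 0 + X 1 + X 2 + X 3) * (-X 0 + X 1 - X 2 - X 3) * (-X 0 - X 1 + X 2 - X 3) *
      (-X 0 - X 1 - X 2 + X 3))
  have hD : D ≠ 0 := by
    intro h0
    have := congrArg (eval ![5, -1, -1, 1]) h0
    simp [D] at this
    norm_num at this
  have hvanish (s : Fin 4 → ℂ) (hs : eval s D ≠ 0) (i : Fin 4) : eval (quadValues s) (r i) = 0 := by
    let s' : Fin 4 → ℂ := ![-s 0, s 1, s 2, s 3]
    have hq : quadValues s' = quadValues s := by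
      funext i
      fin_cases i <;> simp [quadValues, s']
    have hsD : s 0 * s 1 * s 2 * s 3 *
        (hadamard s 0 * hadamard s 1 * hadamard s 2 * hadamard s 3) *
        (hadamard s' 0 * hadamard s' 1 * hadamard s' 2 * hadamard s' 3) ≠ 0 := by
      simpa [D, hadamard, s'] using hs
    obtain ⟨y, hy⟩ := IsAlgClosed.exists_pow_nat_eq
      (hadamard s 0 * hadamard s 1 * hadamard s 2 * hadamard s 3) two_pos
    obtain ⟨y', hy'⟩ := IsAlgClosed.exists_pow_nat_eq
      (hadamard s' 0 * hadamard s' 1 * hadamard s' 2 * hadamard s' 3) two_pos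
    rw [← hy, ← hy'] at hsD
    have hdiff : y ^ 2 - y' ^ 2 = 16 * (s 0 * s 1 * s 2 * s 3) := by
      rw [hy, hy']
      simp only [hadamard, s', cons_val]
      ring
    have hy0 : y ≠ 0 := by rintro rfl; simp at hsD
    have hy0' : y' ≠ 0 := by rintro rfl; simp at hsD
    have hne : y ^ 2 ≠ y' ^ 2 := by
      intro heq
      rw [heq, sub_self, eq_comm, mul_eq_zero] at hdiff
      have h0 := hdiff.resolve_left (by norm_num)
      rw [h0, zero_mul, zero_mul] at hsD
      exact hsD rfl
    obtain ⟨h0, h1, h2, h3⟩ := cubic_coeff_eq_zero hy0 hy0' hne (fun z hz => by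
      rcases hz with hz | hz
      · exact key s z (hz.trans hy)
      · have := key s' z (hz.trans hy')
        rwa [hq] at this)
    fin_cases i
    exacts [h0, h1, h2, h3]
  funext i
  exact eq_zero_of_eval_quadValues hD fun s hs => hvanish s hs i

theorem ker_aeval_f : RingHom.ker (aeval (R := ℂ) f) = Ideal.span {relation} := by
  apply le_antisymm
  · intro p hp
    obtain ⟨q, r, rfl⟩ := exists_eq_mul_relation_add p
    rw [RingHom.mem_ker, map_add, map_mul, aeval_f_relation, mul_zero, zero_add] at hp
    rw [remainder_eq_zero hp]
    simpa using Ideal.mul_mem_left _ q (Ideal.mem_span_singleton_self relation)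
  · rw [Ideal.span_singleton_le_iff_mem, RingHom.mem_ker]
    exact aeval_f_relation

end IgusaQuotient
end RelationIdeal

/-! ### The dual of the Segre cubic. -/

section DualVariety

namespace IgusaQuotient

/-- Power sums. -/
def psum (x : Fin 6 → ℂ) (k : ℕ) : ℂ := ∑ i, x i ^ k

/-- Newton's identities in six variables with sum zero. -/
theorem exists_esymm (x : Fin 6 → ℂ) (h1 : psum x 1 = 0) : ∃ e₄ e₅ e₆ : ℂ,
    (∀ i, x i ^ 6 - psum x 2 / 2 * x i ^ 4 - psum x 3 / 3 * x i ^ 3 + e₄ * x i ^ 2 - e₅ * x i + e₆ = 0) ∧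
      e₄ = psum x 2 ^ 2 / 8 - psum x 4 / 4 ∧
      e₅ = psum x 5 / 5 - psum x 2 * psum x 3 / 6 := by
  obtain ⟨a, ha⟩ : ∃ a, a = x 0 := ⟨_, rfl⟩
  obtain ⟨b, hb⟩ : ∃ a, a = x 1 := ⟨_, rfl⟩
  obtain ⟨c, hc⟩ : ∃ a, a = x 2 := ⟨_, rfl⟩
  obtain ⟨d, hd⟩ : ∃ a, a = x 3 := ⟨_, rfl⟩
  obtain ⟨e, he⟩ : ∃ a, a = x 4 := ⟨_, rfl⟩
  have hf : x 5 = -(a + b + c + d + e) := by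
    simp only [psum, Fin.sum_univ_six, pow_one] at h1
    rw [ha, hb, hc, hd, he]
    linear_combination h1
  have hp (k : ℕ) : psum x k = a ^ k + b ^ k + c ^ k + d ^ k + e ^ k + (-(a + b + c + d + e)) ^ k := by
    rw [psum, Fin.sum_univ_six, hf, ha, hb, hc, hd, he]
  -- These are the elementary symmetric functions of five of the coordinates. As the sixth is `-s₁`,
  -- those of all six are `s_k - s₁ s_{k-1}`.
  let s₁ := a + b + c + d + e
  let s₂ := a * b + a * c + a * d + a * e + b * c + b * d + b * e + c * d + c * e + d * e
  let s₃ := a * b * c + a * b * d + a * b * e + a * c * d + a * c * e + a * d * e + b * c * d +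
    b * c * e + b * d * e + c * d * e
  let s₄ := a * b * c * d + a * b * c * e + a * b * d * e + a * c * d * e + b * c * d * e
  let s₅ := a * b * c * d * e
  have h2 : psum x 2 / 2 = -(s₂ - s₁ ^ 2) := by rw [hp]; simp only [s₁, s₂]; ring
  have h3 : psum x 3 / 3 = s₃ - s₁ * s₂ := by rw [hp]; simp only [s₁, s₂, s₃]; ring
  have h4 : psum x 4 / 4 = (s₂ - s₁ ^ 2) ^ 2 / 2 - (s₄ - s₁ * s₃) := by
    rw [hp]; simp only [s₁, s₂, s₃, s₄]; ring
  have h5 : psum x 5 / 5 = (s₅ - s₁ * s₄) - (s₂ - s₁ ^ 2) * (s₃ - s₁ * s₂) := by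
    rw [hp]; simp only [s₁, s₂, s₃, s₄, s₅]; ring
  refine ⟨s₄ - s₁ * s₃, s₅ - s₁ * s₄, -s₁ * s₅, fun i => ?_, ?_, ?_⟩
  · have key (t : ℂ) : t ^ 6 - psum x 2 / 2 * t ^ 4 - psum x 3 / 3 * t ^ 3 + (s₄ - s₁ * s₃) * t ^ 2 -
        (s₅ - s₁ * s₄) * t + -s₁ * s₅ =
        (t - a) * (t - b) * (t - c) * (t - d) * (t - e) * (t + (a + b + c + d + e)) := by
      rw [h2, h3]
      simp only [s₁, s₂, s₃, s₄, s₅]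
      ring
    rw [key]
    by_cases hi : i = 5
    · rw [hi, hf, neg_add_cancel, mul_zero]
    · fin_cases i <;> simp_all
  · linear_combination h4 - 1 / 2 * (psum x 2 / 2 - (s₂ - s₁ ^ 2)) * h2
  · linear_combination -h5 + psum x 3 / 3 * h2 - (s₂ - s₁ ^ 2) * h3

/-- The quartic form defining the dual of the Segre cubic in the hyperplane `H`. -/
def igusaForm (y : Fin 6 → ℂ) : ℂ := psum y 2 ^ 2 - 4 * psum y 4

theorem mem_H_iff (y : Fin 6 → ℂ) : y ∈ H ↔ psum y 1 = 0 := by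
  simp only [psum, pow_one]
  rfl

theorem eval_segreForm (x : Fin 6 → ℂ) : eval x segreForm = psum x 3 := by
  simp [segreForm, psum]

theorem segreDiff_eq (x v : Fin 6 → ℂ) : segreDiff x v = 3 * ∑ i, x i ^ 2 * v i := by
  have h (i : Fin 6) : eval x (pderiv i segreForm) = 3 * x i ^ 2 := by
    rw [segreForm, map_sum, Finset.sum_eq_single i]
    · simp
    · intro j _ hj
      rw [pderiv_pow, pderiv_X_of_ne hj, mul_zero]
    · simp
  simp only [segreDiff, h, Finset.mul_sum, mul_assoc]

/-- The Gauss map sends `x` to its squares, shifted by the constant that brings them into `H`.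
Newton's identities with `p₁ = p₃ = 0` express the power sums of the squares through `p₂, e₄, e₆`,
and the quartic vanishes identically in these. -/
theorem igusaForm_sq_sub {x : Fin 6 → ℂ} (h1 : psum x 1 = 0) (h3 : psum x 3 = 0) (r c : ℂ)
    (hc : 6 * c = -r * psum x 2) : igusaForm (fun i => r * x i ^ 2 + c) = 0 := by
  obtain ⟨e₄, e₅, e₆, hx, h4, -⟩ := exists_esymm x h1
  rw [h3] at hx
  -- This sums the sextic equation of the coordinates; `h8` sums its product with `x i ^ 2`.
  have h6 : psum x 6 = psum x 2 / 2 * psum x 4 - e₄ * psum x 2 - 6 * e₆ := by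
    have := Finset.sum_congr rfl fun i (_ : i ∈ Finset.univ) => hx i
    simp only [Fin.sum_univ_six] at this
    simp only [psum, Fin.sum_univ_six, pow_one] at *
    linear_combination this + e₅ * h1
  have h8 : psum x 8 = psum x 2 / 2 * psum x 6 - e₄ * psum x 4 - e₆ * psum x 2 := by
    have : ∑ i, (x i ^ 2 * (x i ^ 6 - psum x 2 / 2 * x i ^ 4 - 0 / 3 * x i ^ 3 + e₄ * x i ^ 2 -
        e₅ * x i + e₆)) = ∑ i : Fin 6, 0 :=
      Finset.sum_congr rfl fun i (_ : i ∈ Finset.univ) => by rw [hx i, mul_zero]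
    simp only [Fin.sum_univ_six] at this
    simp only [psum, Fin.sum_univ_six, pow_one] at *
    linear_combination this + e₅ * h3
  have e2 : psum (fun i => r * x i ^ 2 + c) 2 = r ^ 2 * psum x 4 + 2 * r * c * psum x 2 + 6 * c ^ 2 := by
    simp only [psum, Fin.sum_univ_six]
    ring
  have e4 : psum (fun i => r * x i ^ 2 + c) 4 = r ^ 4 * psum x 8 + 4 * r ^ 3 * c * psum x 6 +
      6 * r ^ 2 * c ^ 2 * psum x 4 + 4 * r * c ^ 3 * psum x 2 + 6 * c ^ 4 := by
    simp only [psum, Fin.sum_univ_six]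
    ring
  have hc' : c = -r * psum x 2 / 6 := by linear_combination hc / 6
  have h4' : psum x 4 = psum x 2 ^ 2 / 2 - 4 * e₄ := by linear_combination 4 * h4
  rw [igusaForm, e2, e4, h8, h6, hc', h4']
  ring

/-- The coefficient of the inverse Gauss map. -/
noncomputable def gaussCoeff (y : Fin 6 → ℂ) : ℂ := 16 / 5 * psum y 5 - 4 / 3 * (psum y 2 * psum y 3)

/-- The inverse Gauss map. -/
noncomputable def gaussInv (y : Fin 6 → ℂ) (i : Fin 6) : ℂ :=
  psum y 2 * y i - 4 * y i ^ 3 + 2 / 3 * psum y 3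

/-- `gaussInv y` is a quarter of the gradient of `igusaForm`, projected to `H`. Subtracting `16`
times the sextic equation of `y i` from its square leaves a quadratic polynomial in `y i` with
leading coefficient `-igusaForm y` and linear coefficient `gaussCoeff y`. -/
theorem gaussInv_sq {y : Fin 6 → ℂ} (h1 : psum y 1 = 0) (hF : igusaForm y = 0) :
    ∃ d, ∀ i, gaussInv y i ^ 2 = gaussCoeff y * y i + d := by
  obtain ⟨e₄, e₅, e₆, hy, h4, h5⟩ := exists_esymm y h1
  refine ⟨4 / 9 * psum y 3 ^ 2 - 16 * e₆, fun i => ?_⟩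
  rw [igusaForm] at hF
  rw [gaussInv, gaussCoeff]
  linear_combination 16 * hy i - 16 * y i ^ 2 * h4 + 16 * y i * h5 - y i ^ 2 * hF

theorem sum_mul_sub (y v : Fin 6 → ℂ) (hv : v ∈ H) (d : ℂ) : ∑ i, (y i + d) * v i = ∑ i, y i * v i := by
  have h : ∑ i, v i = 0 := hv
  simp only [Fin.sum_univ_six] at *
  linear_combination d * h

theorem exists_mem_H_sum_ne {y : Fin 6 → ℂ} (hy : y ∈ H) (hy0 : y ≠ 0) :
    ∃ v ∈ H, ∑ i, y i * v i ≠ 0 := by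
  by_contra! h
  have hc (i : Fin 6) : y i = y 0 := by
    have h2 := h (Pi.single i 1 - Pi.single 0 1) (by
      change ∑ j, _ = (0 : ℂ)
      simp)
    simpa [mul_sub, Finset.sum_sub_distrib, Pi.single_apply, sub_eq_zero] using h2
  apply hy0
  have hs : ∑ i, y i = 0 := hy
  simp only [hc, Finset.sum_const, Finset.card_univ, Fintype.card_fin, nsmul_eq_mul] at hs
  have h0 : y 0 = 0 := by simpa using hs
  funext i
  rw [hc, h0]
  rfl

/-- A general point of the quartic is a tangent hyperplane of the Segre cubic. -/
theorem exists_tangent {y : Fin 6 → ℂ} (hy : y ∈ H) (hy0 : y ≠ 0) (hF : igusaForm y = 0)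
    (hg : gaussCoeff y ≠ 0) : ∃ x, IsSmoothSegrePoint x ∧ IsTangentHyperplane x y := by
  have h1 := (mem_H_iff y).mp hy
  obtain ⟨d, hd⟩ := gaussInv_sq h1 hF
  have hdiff (v : Fin 6 → ℂ) (hv : v ∈ H) :
      segreDiff (gaussInv y) v = 3 * gaussCoeff y * ∑ i, y i * v i := by
    have h := sum_mul_sub (fun i => gaussCoeff y * y i) v hv d
    rw [segreDiff_eq]
    simp only [hd]
    rw [h, mul_assoc]
    simp only [Finset.mul_sum, mul_assoc]
  have hg3 : 3 * gaussCoeff y ≠ 0 := mul_ne_zero (by norm_num) hg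
  have hsm : ∃ v ∈ H, segreDiff (gaussInv y) v ≠ 0 := by
    obtain ⟨v, hv, hne⟩ := exists_mem_H_sum_ne hy hy0
    exact ⟨v, hv, by rw [hdiff v hv]; exact mul_ne_zero hg3 hne⟩
  have hs1 : psum (gaussInv y) 1 = 0 := by
    have h : psum (gaussInv y) 1 = psum y 2 * psum y 1 := by
      simp only [psum, Fin.sum_univ_six, gaussInv, pow_one]
      ring
    rw [h, h1, mul_zero]
  refine ⟨gaussInv y, ⟨?_, (mem_H_iff _).mpr hs1, ?_, hsm⟩, hy0, hy, fun v hv => ?_⟩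
  · rintro h0
    obtain ⟨v, hv, hne⟩ := hsm
    rw [h0, segreDiff_eq] at hne
    simp at hne
  · rw [eval_segreForm]
    -- With `x = gaussInv y`, writing `x³ = x² · x` and using `x ∈ H` reduces the cubic form to
    -- `gaussCoeff y * ∑ y i * x i`. By Euler's identity the last sum is `igusaForm y = 0`.
    have h3 : psum (gaussInv y) 3 = ∑ i, (gaussCoeff y * y i + d) * gaussInv y i :=
      Finset.sum_congr rfl fun i _ => by rw [← hd]; ring
    have h4 : ∑ i, y i * gaussInv y i = igusaForm y + 2 / 3 * psum y 3 * psum y 1 := by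
      simp only [igusaForm, psum, Fin.sum_univ_six, gaussInv, pow_one]
      ring
    rw [h3, sum_mul_sub (fun i => gaussCoeff y * y i) _ ((mem_H_iff _).mpr hs1)]
    simp only [mul_assoc]
    rw [← Finset.mul_sum, h4, hF, h1]
    ring
  · rw [hdiff v hv, mul_eq_zero]
    simp [hg]

/-- The tangent hyperplanes of the Segre cubic lie on the quartic. -/
theorem igusaForm_of_tangent {x y : Fin 6 → ℂ} (hx : IsSmoothSegrePoint x)
    (hxy : IsTangentHyperplane x y) : igusaForm y = 0 := by
  obtain ⟨-, hxH, hx3, w, hw, hwne⟩ := hx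
  obtain ⟨-, hy, hker⟩ := hxy
  rw [eval_segreForm] at hx3
  have hwne' : ∑ i, x i ^ 2 * w i ≠ 0 := by
    intro h
    rw [segreDiff_eq, h, mul_zero] at hwne
    exact hwne rfl
  -- Two functionals on `H` with the same kernel are proportional; `r` is the factor.
  let r := (∑ i, y i * w i) / ∑ i, x i ^ 2 * w i
  have hr (v : Fin 6 → ℂ) (hv : v ∈ H) : ∑ i, y i * v i = r * ∑ i, x i ^ 2 * v i := by
    have hmem : v - ((∑ i, x i ^ 2 * v i) / ∑ i, x i ^ 2 * w i) • w ∈ H :=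
      H.sub_mem hv (H.smul_mem _ hw)
    have hsum (z : Fin 6 → ℂ) (k : ℂ) : ∑ i, z i * (v - k • w) i =
        ∑ i, z i * v i - k * ∑ i, z i * w i := by
      simp only [Pi.sub_apply, Pi.smul_apply, smul_eq_mul, Fin.sum_univ_six]
      ring
    have h := (hker _ hmem).mpr (by
      rw [segreDiff_eq, hsum (fun i => x i ^ 2), div_mul_cancel₀ _ hwne', sub_self, mul_zero])
    rw [hsum] at h
    simp only [r]
    rw [sub_eq_zero.mp h]
    ring
  -- The vector `y - r x²` annihilates `H`, so it is constant.
  have hconst (i : Fin 6) : y i = r * x i ^ 2 + (y 0 - r * x 0 ^ 2) := by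
    have h2 := hr (Pi.single i 1 - Pi.single 0 1) (by
      change ∑ j, _ = (0 : ℂ)
      simp)
    have hs (z : Fin 6 → ℂ) : ∑ j, z j * (Pi.single i (1 : ℂ) - Pi.single 0 1 : Fin 6 → ℂ) j =
        z i - z 0 := by
      simp [mul_sub, Finset.sum_sub_distrib, Pi.single_apply]
    rw [hs, hs fun i => x i ^ 2] at h2
    linear_combination h2
  have hy' : y = fun i => r * x i ^ 2 + (y 0 - r * x 0 ^ 2) := funext hconst
  rw [hy']
  refine igusaForm_sq_sub ((mem_H_iff x).mp hxH) hx3 r _ ?_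
  have hsy : ∑ i, y i = 0 := hy
  rw [Finset.sum_congr rfl fun i _ => hconst i] at hsy
  simp only [psum, Fin.sum_univ_six] at *
  linear_combination hsy

end IgusaQuotient
end DualVariety

/-! ### The morphism to the Igusa quartic and its image. -/

section IgusaMap

namespace IgusaQuotient

/-- Coordinates on `H` in which the equation of the Igusa quartic is `relation`. -/
noncomputable def coordVec (t : Fin 5 → ℂ) : Fin 6 → ℂ :=
  ![12 * t 0 - 6 * (t 0 + t 1 + t 2) - t 3, 12 * t 1 - 6 * (t 0 + t 1 + t 2) - t 3,
    12 * t 2 - 6 * (t 0 + t 1 + t 2) - t 3, 2 * t 3 + 24 * t 4, 2 * t 3 - 24 * t 4,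
    6 * (t 0 + t 1 + t 2) - t 3]

theorem coordVec_mem_H (t : Fin 5 → ℂ) : coordVec t ∈ H := by
  change ∑ i, _ = (0 : ℂ)
  simp [coordVec, Fin.sum_univ_six]
  ring

/-- The inverse of `coordVec`. -/
noncomputable def coordInv (y : Fin 6 → ℂ) : Fin 5 → ℂ :=
  ![(2 * y 0 + 2 * y 5 + y 3 + y 4) / 24, (2 * y 1 + 2 * y 5 + y 3 + y 4) / 24,
    (2 * y 2 + 2 * y 5 + y 3 + y 4) / 24, (y 3 + y 4) / 4, (y 3 - y 4) / 48]

theorem coordInv_coordVec (t : Fin 5 → ℂ) : coordInv (coordVec t) = t := by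
  funext i
  fin_cases i <;> simp [coordVec, coordInv] <;> ring

theorem coordVec_coordInv {y : Fin 6 → ℂ} (hy : y ∈ H) : coordVec (coordInv y) = y := by
  have h : ∑ i, y i = 0 := hy
  rw [Fin.sum_univ_six] at h
  funext i
  fin_cases i <;> simp [coordVec, coordInv]
  · linear_combination (-1 / 2) * h
  · linear_combination (-1 / 2) * h
  · linear_combination (-1 / 2) * h
  · ring
  · ring
  · linear_combination (1 / 2) * h

/-- The linear isomorphism `ℂ⁵ ≃ H` given by `coordVec`. -/
noncomputable def coordEquiv : (Fin 5 → ℂ) ≃ₗ[ℂ] H where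
  toFun t := ⟨coordVec t, coordVec_mem_H t⟩
  map_add' s t := Subtype.ext <| funext fun i => by
    fin_cases i <;> simp [coordVec] <;> ring
  map_smul' c t := Subtype.ext <| funext fun i => by
    fin_cases i <;> simp [coordVec] <;> ring
  invFun y := coordInv y.1
  left_inv := coordInv_coordVec
  right_inv y := Subtype.ext (coordVec_coordInv y.2)

theorem igusaForm_coordVec (t : Fin 5 → ℂ) :
    igusaForm (coordVec t) = 82944 * eval t relation := by
  simp [igusaForm, psum, coordVec, Fin.sum_univ_six, relation]
  ring

/-- The linear forms defining `coordVec`. -/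
noncomputable def coordPoly : Fin 6 → MvPolynomial (Fin 5) ℂ :=
  ![12 * X 0 - 6 * (X 0 + X 1 + X 2) - X 3, 12 * X 1 - 6 * (X 0 + X 1 + X 2) - X 3,
    12 * X 2 - 6 * (X 0 + X 1 + X 2) - X 3, 2 * X 3 + 24 * X 4, 2 * X 3 - 24 * X 4,
    6 * (X 0 + X 1 + X 2) - X 3]

theorem eval_coordPoly (t : Fin 5 → ℂ) (i : Fin 6) : eval t (coordPoly i) = coordVec t i := by
  fin_cases i <;> simp [coordPoly, coordVec]

theorem eval_aeval_coordPoly (t : Fin 5 → ℂ) (G : MvPolynomial (Fin 6) ℂ) :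
    eval t (aeval coordPoly G) = eval (coordVec t) G := by
  rw [← funext (eval_coordPoly t), ← coe_aeval_eq_eval, ← coe_aeval_eq_eval]
  simp only [RingHom.coe_coe]
  rw [← AlgHom.comp_apply, comp_aeval]

theorem coordPoly_isHomogeneous (i : Fin 6) : (coordPoly i).IsHomogeneous 1 := by
  have h (c : ℂ) (j : Fin 5) : (C c * X j : MvPolynomial (Fin 5) ℂ).IsHomogeneous 1 :=
    isHomogeneous_C_mul_X _ _
  have hn (k : ℕ) [k.AtLeastTwo] (j : Fin 5) :
      ((OfNat.ofNat k : MvPolynomial (Fin 5) ℂ) * X j).IsHomogeneous 1 := by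
    have := h (OfNat.ofNat k) j
    rwa [map_ofNat] at this
  have hs (k : ℕ) [k.AtLeastTwo] (a b c : Fin 5) :
      ((OfNat.ofNat k : MvPolynomial (Fin 5) ℂ) * (X a + X b + X c)).IsHomogeneous 1 := by
    rw [mul_add, mul_add]
    exact ((hn _ _).add (hn _ _)).add (hn _ _)
  have hX (j : Fin 5) := isHomogeneous_X ℂ j
  fin_cases i
  · exact ((hn 12 0).sub (hs 6 0 1 2)).sub (hX 3)
  · exact ((hn 12 1).sub (hs 6 0 1 2)).sub (hX 3)
  · exact ((hn 12 2).sub (hs 6 0 1 2)).sub (hX 3)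
  · exact (hn 2 3).add (hn 24 4)
  · exact (hn 2 3).sub (hn 24 4)
  · exact (hs 6 0 1 2).sub (hX 3)

theorem aeval_coordPoly_surjective :
    Function.Surjective (aeval coordPoly : MvPolynomial (Fin 6) ℂ →ₐ[ℂ] MvPolynomial (Fin 5) ℂ) := by
  let b : Fin 5 → MvPolynomial (Fin 6) ℂ :=
    ![C (1 / 24) * (2 * X 0 + 2 * X 5 + X 3 + X 4), C (1 / 24) * (2 * X 1 + 2 * X 5 + X 3 + X 4),
      C (1 / 24) * (2 * X 2 + 2 * X 5 + X 3 + X 4), C (1 / 4) * (X 3 + X 4),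
      C (1 / 48) * (X 3 - X 4)]
  have hb (y : Fin 6 → ℂ) (i : Fin 5) : eval y (b i) = coordInv y i := by
    fin_cases i <;> simp [b, coordInv] <;> ring
  intro p
  refine ⟨aeval b p, MvPolynomial.funext fun t => ?_⟩
  have h : eval (coordVec t) (aeval b p) = eval (fun i => eval (coordVec t) (b i)) p := by
    rw [← coe_aeval_eq_eval, ← coe_aeval_eq_eval]
    simp only [RingHom.coe_coe]
    rw [← AlgHom.comp_apply, comp_aeval]
  rw [eval_aeval_coordPoly, h]
  simp only [hb, coordInv_coordVec]

/-- The homomorphism of homogeneous coordinate rings defining `ℙ³ ⟶ ℙ(ℂ⁶)`. -/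
noncomputable def igusaHom : MvPolynomial (Fin 6) ℂ →+* MvPolynomial (Fin 4) ℂ :=
  (aeval f : MvPolynomial (Fin 5) ℂ →ₐ[ℂ] MvPolynomial (Fin 4) ℂ).toRingHom.comp
    (aeval coordPoly : MvPolynomial (Fin 6) ℂ →ₐ[ℂ] MvPolynomial (Fin 5) ℂ).toRingHom

theorem igusaHom_apply (p : MvPolynomial (Fin 6) ℂ) : igusaHom p = aeval f (aeval coordPoly p) := rfl

theorem igusaHom_C (c : ℂ) : igusaHom (C c) = C c := by
  rw [igusaHom_apply, algHom_C, algebraMap_eq, algHom_C, algebraMap_eq]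

/-- The values at `v` of the six quartic forms defining `ℙ³ ⟶ ℙ(ℂ⁶)`. -/
noncomputable def igusaVec (v : Fin 4 → ℂ) : Fin 6 → ℂ := coordVec fun i => eval v (f i)

theorem eval_igusaHom (v : Fin 4 → ℂ) (p : MvPolynomial (Fin 6) ℂ) :
    eval v (igusaHom p) = eval (igusaVec v) p := by
  rw [igusaHom_apply, eval_aeval_f, eval_aeval_coordPoly, igusaVec]

theorem f_isHomogeneous (i : Fin 5) : (f i).IsHomogeneous 4 := by
  have h (i j : Fin 4) : (X i ^ 2 * X j ^ 2 : MvPolynomial (Fin 4) ℂ).IsHomogeneous 4 :=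
    ((isHomogeneous_X ℂ i).pow 2).mul ((isHomogeneous_X ℂ j).pow 2)
  have h4 (i : Fin 4) : (X i ^ 4 : MvPolynomial (Fin 4) ℂ).IsHomogeneous 4 :=
    (isHomogeneous_X ℂ i).pow 4
  have hX (j : Fin 4) := isHomogeneous_X ℂ j
  fin_cases i
  · exact (h 0 3).add (h 1 2)
  · exact (h 0 2).add (h 1 3)
  · exact (h 0 1).add (h 2 3)
  · exact (((h4 0).add (h4 1)).add (h4 2)).add (h4 3)
  · exact (((hX 0).mul (hX 1)).mul (hX 2)).mul (hX 3)

theorem igusaHom_mulsDegree : MulsDegree (grading 6) (grading 4) 4 igusaHom where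
  mem {d a} ha := by
    have h : a.IsHomogeneous d := ha
    have h1 := h.aeval coordPoly (n := 1) coordPoly_isHomogeneous
    have h2 := h1.aeval f (n := 4) f_isHomogeneous
    rw [one_mul] at h2
    exact h2

/-- The action of `N` on `ℂ⁴`. -/
noncomputable def actN : N →* ((Fin 4 → ℂ) ≃ₗ[ℂ] (Fin 4 → ℂ)) :=
  Matrix.SpecialLinearGroup.toLin'.comp N.subtype

theorem igusaHom_invariant (p : MvPolynomial (Fin 4) ℂ) :
    (∀ g, linSubst (actN g) p = p) ↔ ∃ a, igusaHom a = p := by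
  have h : (∀ g, linSubst (actN g) p = p) ↔ ∀ g ∈ N, linSubst (lin g) p = p :=
    ⟨fun h g hg => h ⟨g, hg⟩, fun h g => h g.1 g.2⟩
  rw [h, invariant_iff, Algebra.adjoin_range_eq_range_aeval]
  constructor
  · rintro ⟨a, rfl⟩
    obtain ⟨b, rfl⟩ := aeval_coordPoly_surjective a
    exact ⟨b, rfl⟩
  · rintro ⟨a, rfl⟩
    exact ⟨aeval coordPoly a, rfl⟩

theorem igusaForm_igusaVec (v : Fin 4 → ℂ) : igusaForm (igusaVec v) = 0 := by
  rw [igusaVec, igusaForm_coordVec, ← eval_aeval_f, aeval_f_relation, map_zero, mul_zero]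

/-- The polynomial with values `gaussCoeff`. -/
noncomputable def gaussPoly : MvPolynomial (Fin 6) ℂ :=
  C (16 / 5) * ∑ i, X i ^ 5 - C (4 / 3) * ((∑ i, X i ^ 2) * ∑ i, X i ^ 3)

theorem eval_gaussPoly (y : Fin 6 → ℂ) : eval y gaussPoly = gaussCoeff y := by
  simp [gaussPoly, gaussCoeff, psum]

/-- A general point of the image therefore lies where the Gauss map can be inverted; one sample
point is enough to see this. -/
theorem igusaHom_gaussPoly_ne_zero : igusaHom gaussPoly ≠ 0 := by
  intro h
  have h1 := congr(eval ![1, 1, 1, 0] $h)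
  rw [eval_igusaHom, eval_gaussPoly, map_zero] at h1
  have hy : igusaVec ![1, 1, 1, 0] = ![-9, -9, -9, 6, 6, 15] := by
    funext i
    fin_cases i <;> simp [igusaVec, coordVec, f] <;> norm_num
  rw [hy] at h1
  simp [gaussCoeff, psum, Fin.sum_univ_six] at h1
  norm_num at h1

theorem eval_eq_zero_of_mem_ker {y : Fin 6 → ℂ} (hy : y ∈ H) (hF : igusaForm y = 0)
    {G : MvPolynomial (Fin 6) ℂ} (hG : igusaHom G = 0) : eval y G = 0 := by
  have h : aeval coordPoly G ∈ RingHom.ker (aeval (R := ℂ) f) := hG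
  rw [ker_aeval_f, Ideal.mem_span_singleton] at h
  obtain ⟨c, hc⟩ := h
  have h2 := eval_aeval_coordPoly (coordInv y) G
  have h3 := igusaForm_coordVec (coordInv y)
  rw [coordVec_coordInv hy] at h2 h3
  rw [hF, eq_comm, mul_eq_zero] at h3
  rw [← h2, hc, map_mul, h3.resolve_left (by norm_num), zero_mul]

theorem decompose_mem_of_homogeneous {n : ℕ} {I : Ideal (MvPolynomial (Fin n) ℂ)}
    (hI : I.IsHomogeneous (grading n)) (G : MvPolynomial (Fin n) ℂ) :
    G ∈ I ↔ ∀ i, (DirectSum.decompose (grading n) G i : MvPolynomial (Fin n) ℂ) ∈ I :=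
  hI.mem_iff

theorem ker_igusaHom_isHomogeneous : (RingHom.ker igusaHom).IsHomogeneous (grading 6) :=
  igusaHom_mulsDegree.isHomogeneous_comap (by norm_num) (Ideal.IsHomogeneous.bot (grading 4))

/-- Forms in the kernel vanish on tangent hyperplanes, since on `H` they are multiples of the
quartic. Conversely, a form vanishing on all tangent hyperplanes vanishes at the general point of
the image, hence lies in the kernel. -/
theorem mem_igusaSet_iff (P : PP 6) :
    P ∈ igusaSet ↔ RingHom.ker igusaHom ≤ P.asHomogeneousIdeal.toIdeal := by
  let S : Set (PP 6) :=
    {p | ∃ x y, IsSmoothSegrePoint x ∧ IsTangentHyperplane x y ∧ IsPointOf y p}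
  have hS : P ∈ igusaSet ↔ P ∈ closure S := Iff.rfl
  rw [hS]
  constructor
  · have hcl : IsClosed {P : PP 6 | RingHom.ker igusaHom ≤ P.asHomogeneousIdeal.toIdeal} :=
      ProjectiveSpectrum.isClosed_zeroLocus (grading 6)
        (RingHom.ker igusaHom : Set (MvPolynomial (Fin 6) ℂ))
    refine fun hP => closure_minimal ?_ hcl hP
    rintro p ⟨x, y, hx, hxy, hp⟩ G hG
    refine (decompose_mem_of_homogeneous p.asHomogeneousIdeal.isHomogeneous G).mpr fun i => ?_
    refine (hp i _ (SetLike.coe_mem _)).mpr ?_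
    exact eval_eq_zero_of_mem_ker hxy.2.1 (igusaForm_of_tangent hx hxy)
      ((decompose_mem_of_homogeneous ker_igusaHom_isHomogeneous G).mp hG i)
  · intro hP
    have hz := ProjectiveSpectrum.zeroLocus_vanishingIdeal_eq_closure (grading 6) S
    have : P ∈ ProjectiveSpectrum.zeroLocus (grading 6)
        (ProjectiveSpectrum.vanishingIdeal S : Set (MvPolynomial (Fin 6) ℂ)) := by
      intro G hG
      refine (decompose_mem_of_homogeneous P.asHomogeneousIdeal.isHomogeneous G).mpr fun i => ?_
      apply hP
      have hGi := (decompose_mem_of_homogeneous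
        (ProjectiveSpectrum.vanishingIdeal S).isHomogeneous G).mp hG i
      have hhom : (DirectSum.decompose (grading 6) G i : MvPolynomial (Fin 6) ℂ) ∈ grading 6 i :=
        SetLike.coe_mem _
      generalize (DirectSum.decompose (grading 6) G i : MvPolynomial (Fin 6) ℂ) = G' at hGi hhom
      -- At each `v` either `gaussCoeff` vanishes or the image of `v` is a tangent hyperplane. The
      -- product is thus zero everywhere, and the polynomial ring is a domain.
      have hprod : igusaHom gaussPoly * igusaHom G' = 0 := by
        refine MvPolynomial.funext fun v => ?_
        rw [map_mul, eval_igusaHom, eval_igusaHom, eval_gaussPoly, map_zero, mul_eq_zero]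
        by_cases hg : gaussCoeff (igusaVec v) = 0
        · exact Or.inl hg
        · have hy0 : igusaVec v ≠ 0 := by
            intro h
            rw [h] at hg
            simp [gaussCoeff, psum] at hg
          obtain ⟨x, hx, hxy⟩ := exists_tangent (coordVec_mem_H _) hy0 (igusaForm_igusaVec v) hg
          obtain ⟨p, hp⟩ := exists_isPointOf hy0
          have hpS : p ∈ S := ⟨x, _, hx, hxy, hp⟩
          exact Or.inr ((hp i G' hhom).mp
            ((ProjectiveSpectrum.mem_vanishingIdeal S G').mp hGi p hpS))
      exact (mul_eq_zero.mp hprod).resolve_left igusaHom_gaussPoly_ne_zero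
    rw [hz] at this
    exact this

/-- The quotient morphism. -/
theorem exists_quotient (hc : igusaHom_mulsDegree.Covers) :
    ∃ q : PP 4 ⟶ igusaQuartic, q ≫ igusaι = igusaHom_mulsDegree.projMap (by norm_num) hc ∧
      IsQuotient (fun g : N => projAut (lin g)) q :=
  exists_isQuotient igusaHom_mulsDegree (by norm_num) hc igusaHom_invariant
    igusaSet mem_igusaSet_iff

theorem igusaHom_covers : igusaHom_mulsDegree.Covers :=
  covers_of_isIntegral igusaHom_mulsDegree (by norm_num)
    (isIntegral_of_invariant igusaHom_invariant)

end IgusaQuotient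
end IgusaMap

/-! ### The exterior square and the action of `M` on six lines. -/

section ExteriorSquare

namespace IgusaQuotient

open Matrix

/-- The exterior product of two vectors. -/
noncomputable def wdg (u v : Fin 4 → ℂ) : ⋀[ℂ]^2 (Fin 4 → ℂ) := exteriorPower.ιMulti ℂ 2 ![u, v]

theorem wdg_smul_left (c : ℂ) (u v : Fin 4 → ℂ) : wdg (c • u) v = c • wdg u v :=
  (exteriorPower.ιMulti ℂ 2).map_vecCons_smul ![v] c u

theorem wdg_swap (u v : Fin 4 → ℂ) : wdg v u = -wdg u v := by
  have h := (exteriorPower.ιMulti ℂ 2).map_swap ![u, v] (i := 0) (j := 1) (by decide)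
  have h2 : ![u, v] ∘ Equiv.swap 0 1 = ![v, u] := by
    funext i
    fin_cases i <;> simp
  rw [h2] at h
  exact h

theorem wdg_smul_right (c : ℂ) (u v : Fin 4 → ℂ) : wdg u (c • v) = c • wdg u v := by
  rw [wdg_swap, wdg_smul_left, wdg_swap u v, smul_neg, neg_neg]

theorem wdg_self (u : Fin 4 → ℂ) : wdg u u = 0 :=
  (exteriorPower.ιMulti ℂ 2).map_eq_zero_of_eq ![u, u] (i := 0) (j := 1) rfl (by decide)

theorem wedge_eq (i j : Fin 4) : wedge i j = wdg (Pi.single i 1) (Pi.single j 1) := rfl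

theorem wedge_swap (i j : Fin 4) : wedge j i = -wedge i j := wdg_swap _ _

theorem wedge_self (i : Fin 4) : wedge i i = 0 := wdg_self _

/-- The action of `SL(4, ℂ)` on the exterior square. -/
noncomputable def ext2 (g : SL4) : ⋀[ℂ]^2 (Fin 4 → ℂ) →ₗ[ℂ] ⋀[ℂ]^2 (Fin 4 → ℂ) :=
  exteriorPower.map 2 (lin g).toLinearMap

theorem ext2_wdg (g : SL4) (u v : Fin 4 → ℂ) : ext2 g (wdg u v) = wdg (g.1 *ᵥ u) (g.1 *ᵥ v) := by
  rw [ext2, wdg, exteriorPower.map_apply_ιMulti, wdg]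
  congr 1
  funext i
  fin_cases i <;> rfl

theorem ext2_mul (g h : SL4) (ω : ⋀[ℂ]^2 (Fin 4 → ℂ)) : ext2 (g * h) ω = ext2 g (ext2 h ω) := by
  have hl : (lin (g * h)).toLinearMap = (lin g).toLinearMap ∘ₗ (lin h).toLinearMap :=
    LinearMap.ext fun v => mul_mulVec g h v
  rw [ext2, hl, exteriorPower.map_comp]
  rfl

theorem ext2_one (ω : ⋀[ℂ]^2 (Fin 4 → ℂ)) : ext2 1 ω = ω := by
  have hl : (lin 1).toLinearMap = LinearMap.id := LinearMap.ext fun v => one_mulVec' v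
  rw [ext2, hl, exteriorPower.map_id]
  rfl

theorem ext2_injective (g : SL4) : Function.Injective (ext2 g) := fun ω ω' h => by
  rw [← ext2_one ω, ← inv_mul_cancel g, ext2_mul, h, ← ext2_mul, inv_mul_cancel, ext2_one]

/-- The vectors `w i` form a basis of the exterior square. -/
theorem span_w : ⊤ ≤ Submodule.span ℂ (Set.range w) := by
  have hs : Submodule.span ℂ (Set.range fun i : Fin 4 => (Pi.single i 1 : Fin 4 → ℂ)) = ⊤ := by
    have := (Pi.basisFun ℂ (Fin 4)).span_eq
    convert this using 3
    funext i
    simp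
  have hw (k : Fin 6) : w k ∈ Submodule.span ℂ (Set.range w) := Submodule.subset_span ⟨k, rfl⟩
  have hlt : ∀ i j : Fin 4, i < j → wedge i j ∈ Submodule.span ℂ (Set.range w) := by
    have hadd {a b : ⋀[ℂ]^2 (Fin 4 → ℂ)} (h1 : a + b ∈ Submodule.span ℂ (Set.range w))
        (h2 : a - b ∈ Submodule.span ℂ (Set.range w)) :
        a ∈ Submodule.span ℂ (Set.range w) ∧ b ∈ Submodule.span ℂ (Set.range w) := by
      have ha := Submodule.smul_mem _ (1 / 2 : ℂ) (Submodule.add_mem _ h1 h2)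
      have hb := Submodule.smul_mem _ (1 / 2 : ℂ) (Submodule.sub_mem _ h1 h2)
      have ea : (1 / 2 : ℂ) • ((a + b) + (a - b)) = a := by module
      have eb : (1 / 2 : ℂ) • ((a + b) - (a - b)) = b := by module
      exact ⟨ea ▸ ha, eb ▸ hb⟩
    have h0 := hadd (hw 0) (hw 1)
    have h1 := hadd (hw 2) (hw 3)
    have h2 := hadd (hw 4) (hw 5)
    intro i j hij
    fin_cases i <;> fin_cases j <;> first | exact absurd hij (by decide) | skip
    exacts [h0.1, h1.1, h2.1, h2.2, h1.2, h0.2]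
  rw [← exteriorPower.ιMulti_span_of_span ℂ 2 _ hs, Submodule.span_le]
  rintro _ ⟨a, ha, rfl⟩
  obtain ⟨i, hi⟩ := ha ⟨0, rfl⟩
  obtain ⟨j, hj⟩ := ha ⟨1, rfl⟩
  have hij : exteriorPower.ιMulti ℂ 2 a = wedge i j := by
    rw [wedge]
    congr 1
    funext k
    fin_cases k
    · exact hi.symm
    · exact hj.symm
  rw [hij]
  rcases lt_trichotomy i j with h | h | h
  · exact hlt i j h
  · rw [h, wedge_self]
    exact Submodule.zero_mem _
  · rw [wedge_swap]
    exact Submodule.neg_mem _ (hlt j i h)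

/-- The basis `w` of the exterior square. -/
noncomputable def wBasis : Module.Basis (Fin 6) ℂ (⋀[ℂ]^2 (Fin 4 → ℂ)) :=
  Module.Basis.mk (linearIndependent_of_top_le_span_of_card_eq_finrank span_w (by
    rw [exteriorPower.finrank_eq]
    simp
    decide)) span_w

theorem wBasis_apply (i : Fin 6) : wBasis i = w i := by
  rw [wBasis, Module.Basis.mk_apply]

/-- The signs by which the generators of the Heisenberg group act on the `w i`. -/
def wSign : Fin 6 → Fin 4 → Fin 2 :=
  ![![0, 1, 1, 0], ![0, 1, 1, 1], ![1, 0, 0, 1], ![1, 0, 1, 1], ![1, 1, 0, 1], ![1, 1, 1, 0]]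

/-- Distinct characters make the common eigenspaces of the generators one-dimensional. -/
theorem wSign_injective : Function.Injective wSign := by decide

theorem heis_single (j i : Fin 4) : (heis j).1 *ᵥ Pi.single i 1 =
    (-1 : ℂ) ^ ((![![0, 0, 1, 1], ![0, 1, 0, 1], ![0, 0, 0, 0], ![0, 0, 0, 0]] :
      Fin 4 → Fin 4 → ℕ) j i) • Pi.single
        ((![![0, 1, 2, 3], ![0, 1, 2, 3], ![1, 0, 3, 2], ![2, 3, 0, 1]] :
          Fin 4 → Fin 4 → Fin 4) j i) 1 := by
  fin_cases j <;> fin_cases i <;> funext k <;> fin_cases k <;>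
    simp [heis, d₁, d₂, t₁, t₂]

theorem ext2_heis_wedge (j a b : Fin 4) : ext2 (heis j) (wedge a b) =
    (-1 : ℂ) ^ ((![![0, 0, 1, 1], ![0, 1, 0, 1], ![0, 0, 0, 0], ![0, 0, 0, 0]] :
      Fin 4 → Fin 4 → ℕ) j a + (![![0, 0, 1, 1], ![0, 1, 0, 1], ![0, 0, 0, 0], ![0, 0, 0, 0]] :
      Fin 4 → Fin 4 → ℕ) j b) •
    wedge ((![![0, 1, 2, 3], ![0, 1, 2, 3], ![1, 0, 3, 2], ![2, 3, 0, 1]] :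
          Fin 4 → Fin 4 → Fin 4) j a) ((![![0, 1, 2, 3], ![0, 1, 2, 3], ![1, 0, 3, 2],
            ![2, 3, 0, 1]] : Fin 4 → Fin 4 → Fin 4) j b) := by
  rw [wedge_eq, ext2_wdg, heis_single, heis_single, wdg_smul_left, wdg_smul_right, smul_smul,
    pow_add]
  rfl

theorem ext2_heis_w (j : Fin 4) (i : Fin 6) :
    ext2 (heis j) (w i) = (-1 : ℂ) ^ (wSign i j : ℕ) • w i := by
  have h1 := wedge_swap 0 1
  have h2 := wedge_swap 0 2
  have h3 := wedge_swap 0 3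
  have h4 := wedge_swap 1 2
  have h5 := wedge_swap 1 3
  have h6 := wedge_swap 2 3
  fin_cases i <;> fin_cases j <;>
    simp [w, wSign, ext2_heis_wedge, h1, h2, h3, h4, h5, h6] <;> module

theorem ext2_sI_w (i : Fin 6) : ext2 sI (w i) = (-1 : ℂ) • w i := by
  have h (a b : Fin 4) : ext2 sI (wedge a b) = (-1 : ℂ) • wedge a b := by
    rw [wedge_eq, ext2_wdg, val_sI, smul_mulVec, smul_mulVec, one_mulVec, one_mulVec,
      wdg_smul_left, wdg_smul_right, smul_smul, Complex.I_mul_I]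
  fin_cases i <;> simp [w, h] <;> module

theorem exists_ext2_w {g : SL4} (hg : g ∈ N) (i : Fin 6) : ∃ c : ℂ, ext2 g (w i) = c • w i := by
  refine N_induction (p := fun g => ∃ c : ℂ, ext2 g (w i) = c • w i) ⟨_, ext2_sI_w i⟩
    (fun j => ⟨_, ext2_heis_w j i⟩) ⟨1, by rw [ext2_one, one_smul]⟩ ?_ hg
  rintro g h ⟨c, hc⟩ ⟨d, hd⟩
  exact ⟨d * c, by rw [ext2_mul, hd, map_smul, hc, smul_smul]⟩

/-- The common eigenvectors of `N` in the exterior square are multiples of the `w i`. -/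
theorem exists_eq_smul_w {ω : ⋀[ℂ]^2 (Fin 4 → ℂ)} (hω : ω ≠ 0)
    (h : ∀ j, ∃ μ : ℂ, ext2 (heis j) ω = μ • ω) : ∃ (i : Fin 6) (c : ℂ), c ≠ 0 ∧ ω = c • w i := by
  choose μ hμ using h
  have hrep (j : Fin 4) (k : Fin 6) :
      ((-1 : ℂ) ^ (wSign k j : ℕ) - μ j) * wBasis.repr ω k = 0 := by
    have h1 : wBasis.repr (ext2 (heis j) ω) k = (-1 : ℂ) ^ (wSign k j : ℕ) * wBasis.repr ω k := by
      have h2 (i : Fin 6) : ext2 (heis j) (wBasis i) = (-1 : ℂ) ^ (wSign i j : ℕ) • wBasis i := by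
        rw [wBasis_apply, ext2_heis_w]
      conv_lhs => rw [← wBasis.sum_repr ω]
      simp [h2, Finsupp.single_apply, mul_comm, -Module.Basis.sum_repr]
    rw [hμ, map_smul, Finsupp.smul_apply, smul_eq_mul] at h1
    linear_combination -h1
  obtain ⟨i, hi⟩ : ∃ i, wBasis.repr ω i ≠ 0 := by
    by_contra! hc
    exact hω (wBasis.repr.map_eq_zero_iff.mp (Finsupp.ext hc))
  have hμi (j : Fin 4) : (-1 : ℂ) ^ (wSign i j : ℕ) = μ j :=
    sub_eq_zero.mp ((mul_eq_zero.mp (hrep j i)).resolve_right hi)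
  have hzero (k : Fin 6) (hk : k ≠ i) : wBasis.repr ω k = 0 := by
    obtain ⟨j, hj⟩ := Function.ne_iff.mp (wSign_injective.ne hk)
    refine (mul_eq_zero.mp (hrep j k)).resolve_left ?_
    rw [← hμi]
    revert hj
    generalize wSign k j = a
    generalize wSign i j = b
    intro hab
    fin_cases a <;> fin_cases b <;> first | exact absurd rfl hab | norm_num
  refine ⟨i, wBasis.repr ω i, hi, ?_⟩
  conv_lhs => rw [← wBasis.sum_repr ω]
  rw [Finset.sum_eq_single i, wBasis_apply]
  · intro k _ hk
    rw [hzero k hk, zero_smul]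
  · simp

theorem w_ne_zero (i : Fin 6) : w i ≠ 0 := by
  rw [← wBasis_apply]
  exact wBasis.ne_zero i

theorem W_injective : Function.Injective W := by
  intro i j h
  have hi : w i ∈ W j := h ▸ Submodule.mem_span_singleton_self _
  obtain ⟨c, hc⟩ := Submodule.mem_span_singleton.mp hi
  by_contra hij
  have h1 := congr(wBasis.repr $hc i)
  rw [← wBasis_apply, ← wBasis_apply, map_smul, Finsupp.smul_apply, Module.Basis.repr_self,
    Module.Basis.repr_self, Finsupp.single_eq_same, Finsupp.single_eq_of_ne hij] at h1
  simp at h1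

theorem map_W_eq {g : SL4} {i j : Fin 6} {c : ℂ} (hc : c ≠ 0) (h : ext2 g (w i) = c • w j) :
    (W i).map (ext2 g) = W j := by
  rw [W, Submodule.map_span, Set.image_singleton, h, W]
  exact Submodule.span_singleton_smul_eq (IsUnit.mk0 c hc) _

/-- As `g` normalizes `N`, it carries common eigenvectors of `N` to common eigenvectors, and these
are the multiples of the `w j`. -/
theorem exists_map_W_eq {g : SL4} (hg : g ∈ M) (i : Fin 6) :
    ∃ j, ∃ c : ℂ, c ≠ 0 ∧ ext2 g (w i) = c • w j := by
  refine exists_eq_smul_w (fun h => w_ne_zero i (ext2_injective g (h.trans (map_zero _).symm)))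
    fun j => ?_
  have hX : g⁻¹ * heis j * g ∈ N := by
    have h := (M.inv_mem hg (heis j)).mp (heis_mem_N j)
    rwa [inv_inv] at h
  obtain ⟨c, hc⟩ := exists_ext2_w hX i
  refine ⟨c, ?_⟩
  rw [← ext2_mul, show heis j * g = g * (g⁻¹ * heis j * g) by group, ext2_mul, hc, map_smul]

/-- The coordinates of the exterior square. -/
noncomputable def minor (a b : Fin 4) : ⋀[ℂ]^2 (Fin 4 → ℂ) →ₗ[ℂ] ℂ :=
  exteriorPower.alternatingMapLinearEquiv
    ((Matrix.detRowAlternating (n := Fin 2) (R := ℂ)).compLinearMap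
      (LinearMap.funLeft ℂ ℂ ![a, b]))

theorem minor_wdg (a b : Fin 4) (u v : Fin 4 → ℂ) : minor a b (wdg u v) = u a * v b - u b * v a := by
  rw [minor, wdg, exteriorPower.alternatingMapLinearEquiv_apply_ιMulti,
    AlternatingMap.compLinearMap_apply]
  refine (Matrix.det_fin_two (Matrix.of fun i => LinearMap.funLeft ℂ ℂ ![a, b] (![u, v] i))).trans ?_
  simp [LinearMap.funLeft]

theorem minor_eq_of_ext2_eq_id {g : SL4} (h : ∀ ω, ext2 g ω = ω) (a b i j : Fin 4) :
    g.1 a i * g.1 b j - g.1 b i * g.1 a j =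
      (1 : Matrix (Fin 4) (Fin 4) ℂ) a i * (1 : Matrix (Fin 4) (Fin 4) ℂ) b j -
        (1 : Matrix (Fin 4) (Fin 4) ℂ) b i * (1 : Matrix (Fin 4) (Fin 4) ℂ) a j := by
  have h1 := congr(minor a b $(h (wedge i j)))
  rw [wedge_eq, ext2_wdg, minor_wdg, minor_wdg] at h1
  simpa [Matrix.one_apply, Pi.single_apply] using h1

/-- An element of `SL(4, ℂ)` acting trivially on the exterior square is `1` or `-1`. -/
theorem eq_sNeg_pow_of_ext2_eq_id {g : SL4} (h : ∀ ω, ext2 g ω = ω) : ∃ n, g = sNeg ^ n := by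
  have hm := minor_eq_of_ext2_eq_id h
  have hoff : ∀ k i : Fin 4, k ≠ i → g.1 k i = 0 := by
    intro k i hki
    obtain ⟨p, r, hpk, hpi, hrk, hri, hpr⟩ : ∃ p r : Fin 4, p ≠ k ∧ p ≠ i ∧ r ≠ k ∧ r ≠ i ∧ p ≠ r := by
      revert k i
      decide
    have e1 := hm p r p r
    have e2 := hm k r i p
    have e3 := hm k r i r
    have e4 := hm k r p r
    have e5 := hm p r i r
    have e6 := hm p r i p
    simp only [Matrix.one_apply, hki, hpk.symm, hpi, hrk.symm, hri, hpr, hpr.symm, if_true,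
      if_false] at e1 e2 e3 e4 e5 e6
    -- The `3 × 3` minor on rows `k, p, r` and columns `i, p, r` is expanded twice. Along row `k` it
    -- gives `g k i`, because the complementary minors are `1, 0, 0`; along row `p` all
    -- complementary minors vanish.
    linear_combination (-g.1 k i) * e1 - g.1 p r * e2 + g.1 p p * e3 - g.1 p i * e4 +
      g.1 k p * e5 - g.1 k r * e6
  have hdiag (i j : Fin 4) (hij : i ≠ j) : g.1 i i * g.1 j j = 1 := by
    have e1 := hm i j i j
    simp only [Matrix.one_apply, hij, hij.symm, if_true, if_false] at e1
    rw [hoff j i hij.symm] at e1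
    linear_combination e1
  have h01 := hdiag 0 1 (by decide)
  have h02 := hdiag 0 2 (by decide)
  have h03 := hdiag 0 3 (by decide)
  have h12 := hdiag 1 2 (by decide)
  have hsq : g.1 0 0 * g.1 0 0 = 1 := by
    linear_combination (g.1 0 0 * g.1 2 2) * h01 + h02 - g.1 0 0 * g.1 0 0 * h12
  have hval (i : Fin 4) : g.1 i i = g.1 0 0 := by
    by_cases hi : i = 0
    · rw [hi]
    · linear_combination g.1 0 0 * hdiag 0 i (Ne.symm hi) - g.1 i i * hsq
  have hg : g.1 = g.1 0 0 • (1 : Matrix (Fin 4) (Fin 4) ℂ) := by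
    ext i j
    by_cases hij : i = j
    · subst hij
      simp [hval i]
    · simp [hij, hoff i j hij]
  rcases mul_self_eq_one_iff.mp hsq with h1 | h1
  · refine ⟨0, Subtype.ext ?_⟩
    rw [hg, h1, one_smul, pow_zero, val_one]
  · refine ⟨1, Subtype.ext ?_⟩
    rw [hg, h1, pow_one, sNeg, val_sI_pow, Complex.I_sq]

/-- In the basis `w` both `g` and the generators of `N` are diagonal. Their commutators act
trivially on the exterior square, so they are signs, and `N` is the group of elements with that
property. -/
theorem mem_N_of_ext2_w {g : SL4} (h : ∀ i, ∃ c : ℂ, ext2 g (w i) = c • w i) : g ∈ N := by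
  rw [N_eq_heisGroup]
  intro j
  obtain ⟨n, hn⟩ := eq_sNeg_pow_of_ext2_eq_id (g := (heis j * g)⁻¹ * (g * heis j)) fun ω => by
    have hcomm : ext2 (g * heis j) = ext2 (heis j * g) := wBasis.ext fun i => by
      obtain ⟨c, hc⟩ := h i
      rw [wBasis_apply, ext2_mul, ext2_mul, hc, ext2_heis_w, map_smul, map_smul, hc, ext2_heis_w,
        smul_comm]
    rw [ext2_mul, hcomm, ← ext2_mul, inv_mul_cancel, ext2_one]
  refine ⟨n, ?_⟩
  rw [CommSign, sNeg_pow_mul, ← hn, mul_inv_cancel_left]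

/-- A functional multiplicative relation between groups defines a homomorphism. -/
theorem exists_monoidHom_of_relation {G K : Type*} [Group G] [Group K] (R : G → K → Prop)
    (hex : ∀ g, ∃ k, R g k) (huniq : ∀ g k k', R g k → R g k' → k = k')
    (hmul : ∀ g h k l, R g k → R h l → R (g * h) (k * l)) : ∃ π : G →* K, ∀ g, R g (π g) := by
  choose φ hφ using hex
  exact ⟨MonoidHom.mk' φ fun g h => huniq _ _ _ (hφ _) (hmul _ _ _ _ (hφ g) (hφ h)), hφ⟩

/-- The permutation of the lines `W i` by an element of `M`. -/
theorem exists_lineAction : ∃ π : M →* Equiv.Perm (Fin 6), ∀ g i, (W i).map (ext2 g.1) = W (π g i) := by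
  refine exists_monoidHom_of_relation (fun (g : M) (σ : Equiv.Perm (Fin 6)) =>
    ∀ i, (W i).map (ext2 g.1) = W (σ i)) ?_ ?_ ?_
  · intro g
    choose s c hc hs using exists_map_W_eq g.2
    have hs' (i : Fin 6) := map_W_eq (hc i) (hs i)
    have hinj : Function.Injective s := fun i j hij => by
      have h := (hs' i).trans ((congrArg W hij).trans (hs' j).symm)
      exact W_injective (Submodule.map_injective_of_injective (ext2_injective g.1) h)
    exact ⟨Equiv.ofBijective s (Finite.injective_iff_bijective.mp hinj), hs'⟩
  · intro g σ τ hσ hτ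
    exact Equiv.ext fun i => W_injective ((hσ i).symm.trans (hτ i))
  · intro g h σ τ hσ hτ i
    have hl : ext2 (g * h).1 = ext2 g.1 ∘ₗ ext2 h.1 := LinearMap.ext fun ω => ext2_mul g.1 h.1 ω
    rw [show (g * h).1 = g.1 * h.1 from rfl] at hl
    rw [show ((g * h : M) : SL4) = g.1 * h.1 from rfl, hl, Submodule.map_comp, hτ, hσ]
    rfl

theorem lineAction_eq {π : M →* Equiv.Perm (Fin 6)} (hπ : ∀ g i, (W i).map (ext2 g.1) = W (π g i))
    {g : M} {i j : Fin 6} {c : ℂ} (hc : c ≠ 0) (h : ext2 g.1 (w i) = c • w j) : π g i = j :=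
  W_injective ((hπ g i).symm.trans (map_W_eq hc h))

theorem ker_lineAction {π : M →* Equiv.Perm (Fin 6)}
    (hπ : ∀ g i, (W i).map (ext2 g.1) = W (π g i)) : π.ker = N.subgroupOf M := by
  ext g
  rw [MonoidHom.mem_ker, Subgroup.mem_subgroupOf]
  constructor
  · intro h
    refine mem_N_of_ext2_w fun i => ?_
    obtain ⟨j, c, hc, hw⟩ := exists_map_W_eq g.2 i
    have hj := lineAction_eq hπ hc hw
    rw [h] at hj
    exact ⟨c, by rw [hw, ← hj]; rfl⟩
  · intro h
    refine Equiv.ext fun i => ?_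
    obtain ⟨c, hc⟩ := exists_ext2_w h i
    refine lineAction_eq hπ (fun hc0 => w_ne_zero i (ext2_injective g.1 ?_)) hc
    rw [hc, hc0, zero_smul, map_zero]

end IgusaQuotient
end ExteriorSquare

/-! ### Elements of the normalizer realising all permutations of the lines. -/

section Normalizer

namespace IgusaQuotient

open Matrix

set_option linter.unnecessarySeqFocus false

/-- The number `1 / √2`. -/
noncomputable def rs : ℂ := (1 / Real.sqrt 2 : ℝ)

theorem rs_sq : rs ^ 2 = 1 / 2 := by
  rw [rs, ← Complex.ofReal_pow, div_pow, Real.sq_sqrt (by norm_num)]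
  norm_num

theorem rs_pow_four : rs ^ 4 = 1 / 4 := by
  rw [show rs ^ 4 = (rs ^ 2) ^ 2 by ring, rs_sq]
  norm_num

/-- Elements of the Heisenberg group with square `-1`. -/
noncomputable def nElt : Fin 5 → SL4 :=
  ![sI * d₁, t₁ * (t₂ * d₂), sI * d₂, t₁ * d₂, sI * (d₁ * d₂)]

/-- The matrices `1 + n` for `n` as in `nElt`. -/
noncomputable def oneAddN : Fin 5 → Matrix (Fin 4) (Fin 4) ℂ :=
  ![!![1 + Complex.I, 0, 0, 0; 0, 1 + Complex.I, 0, 0; 0, 0, 1 - Complex.I, 0; 0, 0, 0, 1 - Complex.I],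
    !![1, 0, 0, -1; 0, 1, 1, 0; 0, -1, 1, 0; 1, 0, 0, 1],
    !![1 + Complex.I, 0, 0, 0; 0, 1 - Complex.I, 0, 0; 0, 0, 1 + Complex.I, 0; 0, 0, 0, 1 - Complex.I],
    !![1, -1, 0, 0; 1, 1, 0, 0; 0, 0, 1, -1; 0, 0, 1, 1],
    !![1 + Complex.I, 0, 0, 0; 0, 1 - Complex.I, 0, 0; 0, 0, 1 - Complex.I, 0; 0, 0, 0, 1 + Complex.I]]

theorem det_oneAddN (k : Fin 5) : (oneAddN k).det = 4 := by
  have h : (1 + Complex.I) * (1 - Complex.I) = 2 := by linear_combination -Complex.I_sq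
  have h2 : (1 + Complex.I) ^ 2 * (1 - Complex.I) ^ 2 = 4 := by
    rw [← mul_pow, h]
    norm_num
  fin_cases k <;> simp [oneAddN, det_succ_row_zero, Fin.sum_univ_succ, Fin.succAbove]
  · linear_combination h2
  · norm_num
  · linear_combination h2
  · norm_num
  · linear_combination h2

/-- Elements of `M` that act on the six lines by transpositions. -/
noncomputable def tau (k : Fin 5) : SL4 :=
  ⟨rs • oneAddN k, by
    rw [det_smul, det_oneAddN, Fintype.card_fin, rs_pow_four]
    norm_num⟩

theorem nElt_mulVec (k : Fin 5) (v : Fin 4 → ℂ) : (nElt k).1 *ᵥ v =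
    (![![Complex.I * v 0, Complex.I * v 1, -(Complex.I * v 2), -(Complex.I * v 3)],
      ![-v 3, v 2, -v 1, v 0],
      ![Complex.I * v 0, -(Complex.I * v 1), Complex.I * v 2, -(Complex.I * v 3)],
      ![-v 1, v 0, -v 3, v 2],
      ![Complex.I * v 0, -(Complex.I * v 1), -(Complex.I * v 2), Complex.I * v 3]] :
      Fin 5 → Fin 4 → ℂ) k := by
  fin_cases k
  · change (sI * d₁).1 *ᵥ v = _
    rw [mul_mulVec, d₁_mulVec, sI_mulVec]
    simp
  · change (t₁ * (t₂ * d₂)).1 *ᵥ v = _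
    rw [mul_mulVec, mul_mulVec, d₂_mulVec, t₂_mulVec, t₁_mulVec]
    simp
  · change (sI * d₂).1 *ᵥ v = _
    rw [mul_mulVec, d₂_mulVec, sI_mulVec]
    simp
  · change (t₁ * d₂).1 *ᵥ v = _
    rw [mul_mulVec, d₂_mulVec, t₁_mulVec]
    simp
  · change (sI * (d₁ * d₂)).1 *ᵥ v = _
    rw [mul_mulVec, mul_mulVec, d₂_mulVec, d₁_mulVec, sI_mulVec]
    simp

theorem tau_mulVec (k : Fin 5) (v : Fin 4 → ℂ) :
    (tau k).1 *ᵥ v = rs • (v + (nElt k).1 *ᵥ v) := by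
  rw [tau, smul_mulVec, nElt_mulVec]
  congr 1
  fin_cases k <;> funext i <;> fin_cases i <;>
    simp [oneAddN, mulVec, dotProduct, Fin.sum_univ_four] <;> ring

theorem nElt_mul_self_mulVec (k : Fin 5) (v : Fin 4 → ℂ) :
    (nElt k).1 *ᵥ ((nElt k).1 *ᵥ v) = -v := by
  rw [nElt_mulVec, nElt_mulVec]
  fin_cases k <;> funext i <;> fin_cases i <;> simp [← mul_assoc]

/-- The signs of the commutators of the `nElt k` with the generators. -/
def nSign : Fin 5 → Fin 4 → Fin 2 :=
  ![![0, 0, 0, 1], ![1, 1, 1, 0], ![0, 0, 1, 0], ![0, 1, 1, 0], ![0, 0, 1, 1]]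

theorem nElt_mul_heis (k : Fin 5) (j : Fin 4) (v : Fin 4 → ℂ) :
    (nElt k).1 *ᵥ ((heis j).1 *ᵥ v) = (-1 : ℂ) ^ (nSign k j : ℕ) • (heis j).1 *ᵥ ((nElt k).1 *ᵥ v) := by
  rw [nElt_mulVec, nElt_mulVec]
  fin_cases k <;> fin_cases j <;> funext i <;> fin_cases i <;>
    simp [nSign, heis, d₁_mulVec, d₂_mulVec, t₁_mulVec, t₂_mulVec]

/-- With `n² = -1`, an `h` commuting with `n` commutes with `1 + n`. If `h` anticommutes with `n`,
then `h (1 + n) = (1 - n) h` and `1 - n = (1 + n)(-n)`. -/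
theorem heis_mul_tau (k : Fin 5) (j : Fin 4) :
    heis j * tau k = tau k * ((sNeg * nElt k) ^ (nSign k j : ℕ) * heis j) ∧
      tau k * heis j = (nElt k) ^ (nSign k j : ℕ) * heis j * tau k := by
  have hn := nElt_mul_heis k j
  have h1 := nElt_mul_self_mulVec k
  generalize nSign k j = a at hn ⊢
  constructor
  all_goals
    apply SL4_ext
    intro v
    fin_cases a
    · simp only [pow_zero, one_mul, one_smul] at hn ⊢
      rw [mul_mulVec, mul_mulVec, tau_mulVec, tau_mulVec, mulVec_smul, mulVec_add, hn]
    · simp only [pow_one, neg_smul, one_smul] at hn ⊢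
      have hn' := hn v
      have h2 := h1 ((heis j).1 *ᵥ v)
      have h4 := hn ((nElt k).1 *ᵥ v)
      rw [h1, mulVec_neg, neg_neg] at h4
      simp only [mul_mulVec, tau_mulVec, mulVec_smul, mulVec_add, sNeg_mulVec, mulVec_neg]
      first
        | rw [h2, hn']; module
        | rw [hn', h4]; module

theorem nElt_mem_N (k : Fin 5) : nElt k ∈ N := by
  fin_cases k
  · exact N.mul_mem sI_mem_N d₁_mem_N
  · exact N.mul_mem t₁_mem_N (N.mul_mem t₂_mem_N d₂_mem_N)
  · exact N.mul_mem sI_mem_N d₂_mem_N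
  · exact N.mul_mem t₁_mem_N d₂_mem_N
  · exact N.mul_mem sI_mem_N (N.mul_mem d₁_mem_N d₂_mem_N)

theorem sNeg_mem_N : sNeg ∈ N := pow_mem sI_mem_N 2

theorem tau_mem_M (k : Fin 5) : tau k ∈ M := by
  intro g
  constructor
  · intro hg
    refine N_induction (p := fun g => tau k * g * (tau k)⁻¹ ∈ N) ?_ (fun j => ?_) ?_ ?_ hg
    · rw [← sI_mul, mul_inv_cancel_right]
      exact sI_mem_N
    · rw [(heis_mul_tau k j).2, mul_inv_cancel_right]
      exact N.mul_mem (pow_mem (nElt_mem_N k) _) (heis_mem_N j)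
    · rw [mul_one, mul_inv_cancel]
      exact N.one_mem
    · intro a b ha hb
      have h := N.mul_mem ha hb
      rwa [show tau k * a * (tau k)⁻¹ * (tau k * b * (tau k)⁻¹) = tau k * (a * b) * (tau k)⁻¹ by
        group] at h
  · intro hg
    have key : (tau k)⁻¹ * (tau k * g * (tau k)⁻¹) * tau k ∈ N := by
      refine N_induction (p := fun g => (tau k)⁻¹ * g * tau k ∈ N) ?_ (fun j => ?_) ?_ ?_ hg
      · rw [mul_assoc, sI_mul, inv_mul_cancel_left]
        exact sI_mem_N
      · rw [mul_assoc, (heis_mul_tau k j).1, inv_mul_cancel_left]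
        exact N.mul_mem (pow_mem (N.mul_mem sNeg_mem_N (nElt_mem_N k)) _) (heis_mem_N j)
      · rw [mul_one, inv_mul_cancel]
        exact N.one_mem
      · intro a b ha hb
        have h := N.mul_mem ha hb
        rwa [show (tau k)⁻¹ * a * tau k * ((tau k)⁻¹ * b * tau k) = (tau k)⁻¹ * (a * b) * tau k by
          group] at h
    rwa [show (tau k)⁻¹ * (tau k * g * (tau k)⁻¹) * tau k = g by group] at key

theorem ext2_sNeg_w (i : Fin 6) : ext2 sNeg (w i) = w i := by
  rw [sNeg, pow_two, ext2_mul, ext2_sI_w, map_smul, ext2_sI_w, smul_smul]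
  norm_num

/-- The signs by which the `nElt k` act on the `w i`. -/
def nwSign (k : Fin 5) (i : Fin 6) : ℕ :=
  -- The summand `1` is the contribution of the scalar `√-1`, which acts by `-1` on the exterior
  -- square. The sums are taken modulo two.
  (![1 + wSign i 0, wSign i 2 + wSign i 3 + wSign i 1, 1 + wSign i 1, wSign i 2 + wSign i 1,
    1 + wSign i 0 + wSign i 1] : Fin 5 → Fin 2) k

theorem neg_one_pow_add (a b : Fin 2) :
    (-1 : ℂ) ^ ((a + b : Fin 2) : ℕ) = (-1) ^ (a : ℕ) * (-1) ^ (b : ℕ) := by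
  fin_cases a <;> fin_cases b <;> simp

theorem ext2_nElt_w (k : Fin 5) (i : Fin 6) :
    ext2 (nElt k) (w i) = (-1 : ℂ) ^ nwSign k i • w i := by
  have h0 : ext2 d₁ (w i) = _ := ext2_heis_w 0 i
  have h1 : ext2 d₂ (w i) = _ := ext2_heis_w 1 i
  have h2 : ext2 t₁ (w i) = _ := ext2_heis_w 2 i
  have h3 : ext2 t₂ (w i) = _ := ext2_heis_w 3 i
  have hs := ext2_sI_w i
  fin_cases k <;>
    simp [nElt, nwSign, ext2_mul, h0, h1, h2, h3, hs, neg_one_pow_add, smul_smul] <;> module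

theorem neg_one_pow_inj {a b : ℕ} (h : (-1 : ℂ) ^ a = (-1) ^ b) : a % 2 = b % 2 := by
  rcases Nat.even_or_odd a with ha | ha <;> rcases Nat.even_or_odd b with hb | hb
  · rw [Nat.even_iff.mp ha, Nat.even_iff.mp hb]
  · rw [ha.neg_one_pow, hb.neg_one_pow] at h
    norm_num at h
  · rw [ha.neg_one_pow, hb.neg_one_pow] at h
    norm_num at h
  · rw [Nat.odd_iff.mp ha, Nat.odd_iff.mp hb]

/-- The image line is identified by its character, which the commutation rule of `heis_mul_tau`
determines; comparing it with the six characters is a finite check. -/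
theorem ext2_tau_w (k : Fin 5) (i : Fin 6) :
    ∃ c : ℂ, c ≠ 0 ∧ ext2 (tau k) (w i) = c • w (Equiv.swap k.castSucc k.succ i) := by
  obtain ⟨i', c, hc, h⟩ := exists_map_W_eq (tau_mem_M k) i
  have hj (j : Fin 4) : (wSign i' j : ℕ) % 2 = ((nSign k j : ℕ) * nwSign k i + wSign i j) % 2 := by
    have h1 := congr(ext2 (heis j) $h)
    have hpow (m : ℕ) : ext2 ((sNeg * nElt k) ^ m) (w i) = (-1 : ℂ) ^ (m * nwSign k i) • w i := by
      induction m with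
      | zero => simp [ext2_one]
      | succ m ih =>
        rw [pow_succ, ext2_mul, ext2_mul, ext2_nElt_w, map_smul, ext2_sNeg_w, map_smul, ih,
          smul_smul, Nat.succ_mul, pow_add, mul_comm]
    rw [← ext2_mul, (heis_mul_tau k j).1, ext2_mul, ext2_mul, ext2_heis_w, map_smul, hpow, smul_smul,
      map_smul, h, map_smul, ext2_heis_w, smul_smul, smul_smul] at h1
    have h2 := smul_left_injective ℂ (w_ne_zero i') h1
    apply neg_one_pow_inj
    rw [pow_add]
    apply mul_left_cancel₀ hc
    linear_combination -h2
  have hdec : ∀ (k : Fin 5) (i i' : Fin 6), (∀ j : Fin 4, (wSign i' j : ℕ) % 2 =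
      ((nSign k j : ℕ) * nwSign k i + wSign i j) % 2) → i' = Equiv.swap k.castSucc k.succ i := by
    decide
  rw [hdec k i i' hj] at h
  exact ⟨c, hc, h⟩

theorem lineAction_tau {π : M →* Equiv.Perm (Fin 6)}
    (hπ : ∀ g i, (W i).map (ext2 g.1) = W (π g i)) (k : Fin 5) :
    π ⟨tau k, tau_mem_M k⟩ = Equiv.swap k.castSucc k.succ := by
  refine Equiv.ext fun i => ?_
  obtain ⟨c, hc, h⟩ := ext2_tau_w k i
  exact lineAction_eq hπ hc h

theorem surjective_of_swap_mem_range {G : Type*} [Group G] (φ : G →* Equiv.Perm (Fin 6))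
    (h : ∀ k : Fin 5, ∃ g, φ g = Equiv.swap k.castSucc k.succ) : Function.Surjective φ := by
  rw [← MonoidHom.mrange_eq_top, eq_top_iff, ← Equiv.Perm.mclosure_swap_castSucc_succ 5,
    Submonoid.closure_le]
  rintro _ ⟨k, rfl⟩
  exact h k

end IgusaQuotient
end Normalizer

/-! ### The outer automorphism. -/

section OuterAction

namespace IgusaQuotient

open Matrix

set_option linter.unnecessarySeqFocus false

theorem igusaVec_smul (c : ℂ) (v : Fin 4 → ℂ) : igusaVec (c • v) = c ^ 4 • igusaVec v := by
  funext i
  fin_cases i <;> simp [igusaVec, coordVec, f, -Matrix.add_cons] <;> ring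

/-- The images of the transpositions `(k, k + 1)` under an outer automorphism. -/
def outerGen : Fin 5 → Equiv.Perm (Fin 6) :=
  ![Equiv.swap 0 1 * Equiv.swap 2 5 * Equiv.swap 3 4, Equiv.swap 0 5 * Equiv.swap 1 4 * Equiv.swap 2 3,
    Equiv.swap 0 2 * Equiv.swap 1 5 * Equiv.swap 3 4, Equiv.swap 0 3 * Equiv.swap 1 4 * Equiv.swap 2 5,
    Equiv.swap 0 5 * Equiv.swap 1 2 * Equiv.swap 3 4]

theorem one_add_I_pow : (1 + Complex.I) ^ 4 = -4 := by
  linear_combination (Complex.I ^ 2 + 4 * Complex.I + 5) * Complex.I_sq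

theorem one_sub_I_pow : (1 - Complex.I) ^ 4 = -4 := by
  linear_combination (Complex.I ^ 2 - 4 * Complex.I + 5) * Complex.I_sq

theorem one_add_I_sq_mul : (1 + Complex.I) ^ 2 * (1 - Complex.I) ^ 2 = 4 := by
  linear_combination (Complex.I ^ 2 - 3) * Complex.I_sq

theorem igusaVec_eq_of_eval_f {v v' : Fin 4 → ℂ} {ε : Fin 5 → ℂ}
    (h : ∀ i, eval v' (f i) = ε i * eval v (f i)) :
    igusaVec v' = coordVec fun i => ε i * eval v (f i) := by
  rw [igusaVec, funext h]

/-- Here `nElt` is diagonal, so `1 + n` multiplies each variable by `1 ± √-1`, and each `f i` by `±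
4`. The same happens for the indices two and four, while one and three need a direct expansion. -/
theorem igusaVec_add_nElt_zero (v : Fin 4 → ℂ) (i : Fin 6) :
    igusaVec (v + (nElt 0).1 *ᵥ v) i = -4 * igusaVec v (((![1, 0, 5, 4, 3, 2]) : Fin 6 → Fin 6) i) := by
  have h : ∀ i, eval (v + (nElt 0).1 *ᵥ v) (f i) = (![4, 4, -4, -4, 4] : Fin 5 → ℂ) i * eval v (f i) := by
    intro i
    rw [nElt_mulVec]
    fin_cases i <;> simp [f, -Matrix.add_cons]
    · linear_combination (v 0 ^ 2 * v 3 ^ 2 + v 1 ^ 2 * v 2 ^ 2) * one_add_I_sq_mul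
    · linear_combination (v 0 ^ 2 * v 2 ^ 2 + v 1 ^ 2 * v 3 ^ 2) * one_add_I_sq_mul
    · linear_combination v 0 ^ 2 * v 1 ^ 2 * one_add_I_pow + v 2 ^ 2 * v 3 ^ 2 * one_sub_I_pow
    · linear_combination (v 0 ^ 4 + v 1 ^ 4) * one_add_I_pow + (v 2 ^ 4 + v 3 ^ 4) * one_sub_I_pow
    · linear_combination v 0 * v 1 * v 2 * v 3 * one_add_I_sq_mul
  rw [igusaVec_eq_of_eval_f h]
  fin_cases i <;> simp [igusaVec, coordVec] <;> ring

theorem igusaVec_add_nElt_two (v : Fin 4 → ℂ) (i : Fin 6) :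
    igusaVec (v + (nElt 2).1 *ᵥ v) i = -4 * igusaVec v (((![2, 5, 0, 4, 3, 1]) : Fin 6 → Fin 6) i) := by
  have h : ∀ i, eval (v + (nElt 2).1 *ᵥ v) (f i) = (![4, -4, 4, -4, 4] : Fin 5 → ℂ) i * eval v (f i) := by
    intro i
    rw [nElt_mulVec]
    fin_cases i <;> simp [f, -Matrix.add_cons]
    · linear_combination (v 0 ^ 2 * v 3 ^ 2 + v 1 ^ 2 * v 2 ^ 2) * one_add_I_sq_mul
    · linear_combination v 0 ^ 2 * v 2 ^ 2 * one_add_I_pow + v 1 ^ 2 * v 3 ^ 2 * one_sub_I_pow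
    · linear_combination (v 0 ^ 2 * v 1 ^ 2 + v 2 ^ 2 * v 3 ^ 2) * one_add_I_sq_mul
    · linear_combination (v 0 ^ 4 + v 2 ^ 4) * one_add_I_pow + (v 1 ^ 4 + v 3 ^ 4) * one_sub_I_pow
    · linear_combination v 0 * v 1 * v 2 * v 3 * one_add_I_sq_mul
  rw [igusaVec_eq_of_eval_f h]
  fin_cases i <;> simp [igusaVec, coordVec] <;> ring

theorem igusaVec_add_nElt_four (v : Fin 4 → ℂ) (i : Fin 6) :
    igusaVec (v + (nElt 4).1 *ᵥ v) i = -4 * igusaVec v (((![5, 2, 1, 4, 3, 0]) : Fin 6 → Fin 6) i) := by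
  have h : ∀ i, eval (v + (nElt 4).1 *ᵥ v) (f i) = (![-4, 4, 4, -4, 4] : Fin 5 → ℂ) i * eval v (f i) := by
    intro i
    rw [nElt_mulVec]
    fin_cases i <;> simp [f, -Matrix.add_cons]
    · linear_combination v 0 ^ 2 * v 3 ^ 2 * one_add_I_pow + v 1 ^ 2 * v 2 ^ 2 * one_sub_I_pow
    · linear_combination (v 0 ^ 2 * v 2 ^ 2 + v 1 ^ 2 * v 3 ^ 2) * one_add_I_sq_mul
    · linear_combination (v 0 ^ 2 * v 1 ^ 2 + v 2 ^ 2 * v 3 ^ 2) * one_add_I_sq_mul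
    · linear_combination (v 0 ^ 4 + v 3 ^ 4) * one_add_I_pow + (v 1 ^ 4 + v 2 ^ 4) * one_sub_I_pow
    · linear_combination v 0 * v 1 * v 2 * v 3 * one_add_I_sq_mul
  rw [igusaVec_eq_of_eval_f h]
  fin_cases i <;> simp [igusaVec, coordVec] <;> ring

theorem igusaVec_add_nElt_one (v : Fin 4 → ℂ) (i : Fin 6) :
    igusaVec (v + (nElt 1).1 *ᵥ v) i = -4 * igusaVec v (((![5, 4, 3, 2, 1, 0]) : Fin 6 → Fin 6) i) := by
  rw [nElt_mulVec]
  fin_cases i <;> simp [igusaVec, coordVec, f, -Matrix.add_cons] <;> ring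

theorem igusaVec_add_nElt_three (v : Fin 4 → ℂ) (i : Fin 6) :
    igusaVec (v + (nElt 3).1 *ᵥ v) i = -4 * igusaVec v (((![3, 4, 5, 0, 1, 2]) : Fin 6 → Fin 6) i) := by
  rw [nElt_mulVec]
  fin_cases i <;> simp [igusaVec, coordVec, f, -Matrix.add_cons] <;> ring

theorem igusaVec_add_nElt (k : Fin 5) (v : Fin 4 → ℂ) (i : Fin 6) :
    igusaVec (v + (nElt k).1 *ᵥ v) i = -4 * igusaVec v ((![![1, 0, 5, 4, 3, 2], ![5, 4, 3, 2, 1, 0],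
      ![2, 5, 0, 4, 3, 1], ![3, 4, 5, 0, 1, 2], ![5, 2, 1, 4, 3, 0]] : Fin 5 → Fin 6 → Fin 6) k i) := by
  fin_cases k
  exacts [igusaVec_add_nElt_zero v i, igusaVec_add_nElt_one v i, igusaVec_add_nElt_two v i,
    igusaVec_add_nElt_three v i, igusaVec_add_nElt_four v i]

theorem outerGen_symm_apply : ∀ (k : Fin 5) (i : Fin 6), (outerGen k).symm i =
    (![![1, 0, 5, 4, 3, 2], ![5, 4, 3, 2, 1, 0],
      ![2, 5, 0, 4, 3, 1], ![3, 4, 5, 0, 1, 2], ![5, 2, 1, 4, 3, 0]] : Fin 5 → Fin 6 → Fin 6) k i := by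
  decide

/-- The map `igusaVec` intertwines `g` and the permutation `σ` up to a scalar. -/
def Intertwines (g : SL4) (σ : Equiv.Perm (Fin 6)) : Prop :=
  ∃ c : ℂ, c ≠ 0 ∧ ∀ v, igusaVec (g.1 *ᵥ v) = c • permLin σ (igusaVec v)

theorem permLin_apply (σ : Equiv.Perm (Fin 6)) (y : Fin 6 → ℂ) (i : Fin 6) :
    permLin σ y i = y (σ.symm i) := rfl

theorem Intertwines.mul {g h : SL4} {σ τ : Equiv.Perm (Fin 6)} (hg : Intertwines g σ)
    (hh : Intertwines h τ) : Intertwines (g * h) (σ * τ) := by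
  obtain ⟨c, hc, hg⟩ := hg
  obtain ⟨d, hd, hh⟩ := hh
  refine ⟨c * d, mul_ne_zero hc hd, fun v => ?_⟩
  rw [mul_mulVec, hg, hh, map_smul, smul_smul]
  rfl

theorem intertwines_of_mem_N {g : SL4} (hg : g ∈ N) : Intertwines g 1 := by
  refine ⟨1, one_ne_zero, fun v => ?_⟩
  have h (i : Fin 5) : eval (g.1 *ᵥ v) (f i) = eval v (f i) := by
    rw [← lin_apply, ← eval_linSubst, linSubst_f hg]
  rw [igusaVec, funext h, one_smul]
  rfl

theorem intertwines_tau (k : Fin 5) : Intertwines (tau k) (outerGen k) := by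
  refine ⟨-1, by norm_num, fun v => funext fun i => ?_⟩
  rw [tau_mulVec, igusaVec_smul, rs_pow_four, Pi.smul_apply, igusaVec_add_nElt, Pi.smul_apply,
    permLin_apply, outerGen_symm_apply, smul_eq_mul, smul_eq_mul]
  ring

/-- The squares of these coordinates are pairwise distinct and have nonzero sum, so the point
separates permutations even up to a scalar. -/
theorem igusaVec_sample :
    igusaVec ![1, 2, 3, 5] = ![-2385, -1809, -369, 2166, 726, 1671] := by
  funext i
  fin_cases i <;> simp [igusaVec, coordVec, f] <;> norm_num

theorem Intertwines.unique {g : SL4} {σ τ : Equiv.Perm (Fin 6)} (h : Intertwines g σ)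
    (h' : Intertwines g τ) : σ = τ := by
  obtain ⟨c, hc, h⟩ := h
  obtain ⟨d, hd, h'⟩ := h'
  let y : Fin 6 → ℂ := igusaVec ![1, 2, 3, 5]
  have hy : y = ![-2385, -1809, -369, 2166, 726, 1671] := igusaVec_sample
  have hi (i : Fin 6) : c * y (σ.symm i) = d * y (τ.symm i) :=
    congrFun ((h ![1, 2, 3, 5]).symm.trans (h' ![1, 2, 3, 5])) i
  -- The sum of squares does not change under permutations, so `c² = d²`; the squares of the
  -- coordinates can then be compared without knowing the scalars.
  have hsum : c ^ 2 * ∑ i, y i ^ 2 = d ^ 2 * ∑ i, y i ^ 2 := by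
    have hs : ∑ i, y (σ.symm i) ^ 2 = ∑ i, y i ^ 2 := Equiv.sum_comp σ.symm fun i => y i ^ 2
    have ht : ∑ i, y (τ.symm i) ^ 2 = ∑ i, y i ^ 2 := Equiv.sum_comp τ.symm fun i => y i ^ 2
    conv_lhs => rw [← hs, Finset.mul_sum]
    conv_rhs => rw [← ht, Finset.mul_sum]
    exact Finset.sum_congr rfl fun i _ => by rw [← mul_pow, hi, mul_pow]
  have hp : ∑ i, y i ^ 2 ≠ 0 := by
    rw [hy]
    simp [Fin.sum_univ_six]
    norm_num
  have hcd := mul_right_cancel₀ hp hsum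
  have hinj : Function.Injective fun i => y i ^ 2 := by
    intro i j hij
    rw [hy] at hij
    fin_cases i <;> fin_cases j <;> first | rfl | (norm_num at hij)
  have hst (i : Fin 6) : σ.symm i = τ.symm i := by
    apply hinj
    apply mul_left_cancel₀ (pow_ne_zero 2 hc)
    change c ^ 2 * y _ ^ 2 = c ^ 2 * y _ ^ 2
    rw [← mul_pow, hi, mul_pow, hcd]
  have := Equiv.ext hst
  simpa using congrArg Equiv.symm this

/-- Every element of `M` acts on the Igusa quartic through a permutation of the coordinates. -/
theorem exists_intertwines {π : M →* Equiv.Perm (Fin 6)}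
    (hπ : ∀ g i, (W i).map (ext2 g.1) = W (π g i)) (g : M) : ∃ σ, Intertwines g.1 σ := by
  have hmem : π g ∈ Submonoid.closure
      (Set.range fun k : Fin 5 => Equiv.swap k.castSucc k.succ) := by
    rw [Equiv.Perm.mclosure_swap_castSucc_succ]
    trivial
  have key : ∃ h : M, π h = π g ∧ ∃ σ, Intertwines h.1 σ := by
    refine Submonoid.closure_induction (motive := fun s _ => ∃ h : M, π h = s ∧ ∃ σ, Intertwines h.1 σ)
      ?_ ?_ ?_ hmem
    · rintro _ ⟨k, rfl⟩
      exact ⟨_, lineAction_tau hπ k, _, intertwines_tau k⟩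
    · exact ⟨1, map_one π, 1, intertwines_of_mem_N N.one_mem⟩
    · rintro _ _ _ _ ⟨h, rfl, σ, hσ⟩ ⟨h', rfl, σ', hσ'⟩
      exact ⟨h * h', map_mul π h h', _, hσ.mul hσ'⟩
  obtain ⟨h, hh, σ, hσ⟩ := key
  have hk : h⁻¹ * g ∈ π.ker := by
    rw [MonoidHom.mem_ker, map_mul, map_inv, hh, inv_mul_cancel]
  rw [ker_lineAction hπ, Subgroup.mem_subgroupOf] at hk
  have h2 := hσ.mul (intertwines_of_mem_N hk)
  rw [show h.1 * ((h⁻¹ * g : M) : SL4) = g.1 from congrArg Subtype.val (mul_inv_cancel_left h g)] at h2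
  exact ⟨_, h2⟩

/-- The permutations `outerGen` generate `𝔖₆`, which makes the homomorphism in `exists_outer`
surjective. The index lists are words in these generators. -/
theorem outerGen_words (k : Fin 5) : Equiv.swap k.castSucc k.succ =
    (((![[0, 3, 2, 4, 3], [1, 0, 2, 1, 4], [0, 1, 0, 3, 2, 1, 0, 4, 3], [0, 2, 4],
      [1, 0, 3, 2, 1, 4, 3]] : Fin 5 → List (Fin 5)) k).map outerGen).prod := by
  revert k
  decide

theorem outerGen_zero_apply_ne : ∀ i, outerGen 0 i ≠ i := by decide

/-- The action of `M` on the Igusa quartic factors through the action on the six lines by an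
outer automorphism of the symmetric group. -/
theorem exists_outer {π : M →* Equiv.Perm (Fin 6)}
    (hπ : ∀ g i, (W i).map (ext2 g.1) = W (π g i)) :
    ∃ l : MulAut (Equiv.Perm (Fin 6)), (∀ τ, l ≠ MulAut.conj τ) ∧ ∀ g, Intertwines g.1 (l (π g)) := by
  have hsurj : Function.Surjective π :=
    surjective_of_swap_mem_range π fun k => ⟨_, lineAction_tau hπ k⟩
  obtain ⟨l, hl⟩ := exists_monoidHom_of_relation
    (fun σ τ : Equiv.Perm (Fin 6) => ∃ g : M, π g = σ ∧ Intertwines g.1 τ)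
    (fun σ => by
      obtain ⟨g, rfl⟩ := hsurj σ
      obtain ⟨τ, hτ⟩ := exists_intertwines hπ g
      exact ⟨τ, g, rfl, hτ⟩)
    (by
      rintro σ τ τ' ⟨g, rfl, hg⟩ ⟨g', hgg', hg'⟩
      have hk : g⁻¹ * g' ∈ π.ker := by
        rw [MonoidHom.mem_ker, map_mul, map_inv, hgg', inv_mul_cancel]
      rw [ker_lineAction hπ, Subgroup.mem_subgroupOf] at hk
      have h2 := hg.mul (intertwines_of_mem_N hk)
      rw [show g.1 * ((g⁻¹ * g' : M) : SL4) = g'.1 from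
        congrArg Subtype.val (mul_inv_cancel_left g g'), mul_one] at h2
      exact h2.unique hg')
    (by
      rintro _ _ τ τ' ⟨g, rfl, hg⟩ ⟨g', rfl, hg'⟩
      exact ⟨g * g', map_mul π g g', hg.mul hg'⟩)
  have hlπ (g : M) : Intertwines g.1 (l (π g)) := by
    obtain ⟨g', hgg', hg'⟩ := hl (π g)
    have hk : g'⁻¹ * g ∈ π.ker := by
      rw [MonoidHom.mem_ker, map_mul, map_inv, hgg', inv_mul_cancel]
    rw [ker_lineAction hπ, Subgroup.mem_subgroupOf] at hk
    have h2 := hg'.mul (intertwines_of_mem_N hk)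
    rwa [show g'.1 * ((g'⁻¹ * g : M) : SL4) = g.1 from
      congrArg Subtype.val (mul_inv_cancel_left g' g), mul_one] at h2
  have hgen (k : Fin 5) : l (Equiv.swap k.castSucc k.succ) = outerGen k := by
    have h := hlπ ⟨tau k, tau_mem_M k⟩
    rw [lineAction_tau hπ] at h
    exact h.unique (intertwines_tau k)
  have hbij : Function.Bijective l := by
    refine Finite.surjective_iff_bijective.mp (surjective_of_swap_mem_range l fun k => ?_)
    -- The homomorphism `l` sends this word in the adjacent transpositions to the same word in
    -- `outerGen`.
    refine ⟨(((![[0, 3, 2, 4, 3], [1, 0, 2, 1, 4], [0, 1, 0, 3, 2, 1, 0, 4, 3], [0, 2, 4],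
      [1, 0, 3, 2, 1, 4, 3]] : Fin 5 → List (Fin 5)) k).map fun j =>
        Equiv.swap j.castSucc j.succ).prod, ?_⟩
    rw [outerGen_words, map_list_prod, List.map_map]
    congr 2
    exact funext hgen
  refine ⟨MulEquiv.ofBijective l hbij, fun τ hτ => ?_, hlπ⟩
  -- A conjugate of the transposition of `0` and `1` by `τ` fixes `τ 2`, while `outerGen 0` has no
  -- fixed point.
  have h1 : outerGen 0 = τ * Equiv.swap 0 1 * τ⁻¹ := (hgen 0).symm.trans congr($hτ (Equiv.swap 0 1))
  apply outerGen_zero_apply_ne (τ 2)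
  rw [h1, Equiv.Perm.mul_apply, Equiv.Perm.mul_apply, show τ⁻¹ (τ 2) = 2 from τ.symm_apply_apply 2,
    Equiv.swap_apply_of_ne_of_ne (by decide) (by decide)]

end IgusaQuotient
end OuterAction

/-! ### The theorem. -/

theorem mainTheorem4 :
    Nat.card IgusaQuotient.N = 64 ∧
    -- the ring of invariants of `N` is generated by `f₁, …, f₅`
    (∀ p : MvPolynomial (Fin 4) ℂ,
      (∀ g ∈ IgusaQuotient.N, IgusaQuotient.linSubst (IgusaQuotient.lin g) p = p) ↔
        p ∈ Algebra.adjoin ℂ (Set.range IgusaQuotient.f)) ∧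
    -- the only relation
    RingHom.ker (aeval (R := ℂ) IgusaQuotient.f) = Ideal.span {IgusaQuotient.relation} ∧
    -- the Igusa quartic is the quotient, equivariantly for `M / N ≅ 𝔖₆`
    ∃ (q : IgusaQuotient.PP 4 ⟶ IgusaQuotient.igusaQuartic)
      (T : (Fin 5 → ℂ) ≃ₗ[ℂ] IgusaQuotient.H)
      (π : IgusaQuotient.M →* Equiv.Perm (Fin 6)) (l : MulAut (Equiv.Perm (Fin 6))),
      q ≫ IgusaQuotient.igusaι ≫ IgusaQuotient.structureMap 6 = IgusaQuotient.structureMap 4 ∧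
      IgusaQuotient.IsQuotient
        (fun g : IgusaQuotient.N => IgusaQuotient.projAut (IgusaQuotient.lin g)) q ∧
      (∀ (v : Fin 4 → ℂ) (p : IgusaQuotient.PP 4), IgusaQuotient.IsPointOf v p →
        IgusaQuotient.IsPointOf (T fun i => eval v (IgusaQuotient.f i)).1
          (IgusaQuotient.igusaι (q p))) ∧
      Function.Surjective π ∧
      π.ker = IgusaQuotient.N.subgroupOf IgusaQuotient.M ∧
      (∀ (g : IgusaQuotient.M) (i : Fin 6),
        (IgusaQuotient.W i).map (exteriorPower.map 2 (IgusaQuotient.lin g).toLinearMap) =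
          IgusaQuotient.W (π g i)) ∧
      (∀ τ : Equiv.Perm (Fin 6), l ≠ MulAut.conj τ) ∧
      (∀ g : IgusaQuotient.M,
        IgusaQuotient.projAut (IgusaQuotient.lin g) ≫ q ≫ IgusaQuotient.igusaι =
          q ≫ IgusaQuotient.igusaι ≫
            IgusaQuotient.projAut (IgusaQuotient.permLin (l (π g)))) := by
  open IgusaQuotient in
  obtain ⟨q, hq, hquot⟩ := exists_quotient igusaHom_covers
  obtain ⟨π, hπ⟩ := exists_lineAction
  obtain ⟨l, hl, hint⟩ := exists_outer hπ
  have hX (v : Fin 4 → ℂ) : (fun i => eval v (igusaHom (X i))) = igusaVec v := by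
    funext i
    rw [eval_igusaHom, eval_X]
  refine ⟨card_N, invariant_iff, ker_aeval_f, q, coordEquiv, π, l, ?_, hquot, ?_,
    surjective_of_swap_mem_range π fun k => ⟨_, lineAction_tau hπ k⟩, ker_lineAction hπ, hπ, hl, ?_⟩
  · rw [← Category.assoc, hq]
    exact projMap_structureMap igusaHom_mulsDegree (by norm_num) igusaHom_covers igusaHom_C
  · intro v p hp
    have h := isPointOf_projMap igusaHom_mulsDegree (by norm_num) igusaHom_covers igusaHom_C hp
    rw [hX, ← hq] at h
    exact h
  · intro g
    obtain ⟨c, hc, hg⟩ := hint g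
    rw [← Category.assoc q, hq]
    refine projAut_comp_projMap_eq igusaHom_mulsDegree (by norm_num) igusaHom_covers igusaHom_C
      _ _ hc fun v => ?_
    rw [hX, hX]
    exact hg v
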